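/- **Setting.** Let $M$ be a $2d$-dimensional (Hausdorff, second countable, smooth) manifold covered by doubled coordinates $X^A$, $A=1,\dots,2d$, in which a metric $\eta$ has the constant components $\eta_{AB}=\begin{pmatrix}0&1\\1&0\end{pmatrix}$ (so all coordinate changes are locally affine with linear part in $O(d,d)$). Write $\eta^{AB}$ for the inverse matrix, $\partial_A$ for the coordinate vector fields, $\eta^{-1}(df)=\eta^{AB}\partial_Af\,\partial_B$, and $u_C=\eta_{CD}u^D$. Let $L\to M$ be a smooth vector bundle of rank $2d$ with an $\mathbb R$-bilinear skew-symmetric bracket $[\![\cdot,\cdot]\!]$ on $\Gamma(L)$, a smooth non-degenerate symmetric form $\langle\cdot,\cdot\rangle$ and a smooth bundle map $\rho:L\to TM$. Define $\mathcal D:C^\infty(M)\to\Gamma(L)$ by $\langle\mathcal Df,e\rangle=\tfrac12\rho(e)f$, and $$\mathcal N(e_1,e_2,e_3)=\tfrac13\langle[\![e_1,e_2]\!],e_3\rangle+\text{cyclic},\qquad \mathrm{Jac}(e_1,e_2,e_3)=[\![[\![e_1,e_2]\!],e_3]\!]+\text{cyclic},$$ $$\mathsf{SC}_\rho(e_1,e_2)=\tfrac12\,\eta^{AB}\,\rho(e_1)_C\,\partial_A\rho(e_2)^C\,\partial_B-(e_1\leftrightarrow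 e_2),$$ $$\mathsf{SC}_{\rm Jac}(e_1,e_2,e_3)=\tfrac12\rho^{-1}\big\{W(e_1,e_2)^A\partial_A\rho(e_3)^B\partial_B\big\}+\text{cyclic},$$ where $\rho^{-1}:TM\to L$ is given by $\langle\rho^{-1}(h),e\rangle=\eta(h,\rho(e))$, and $W(e_1,e_2)=-\eta^{-1}(\rho(e_2))(\eta(\rho(e_1)))+\eta^{-1}(\rho(e_1))(\eta(\rho(e_2)))+[\rho(e_1),\rho(e_2)]$ with $\eta^{-1}(v)(\eta(u))=u_C\,\eta^{AB}\partial_Av^C\,\partial_B+u^A\partial_Av^C\,\partial_C$. These data form a *DFT algebroid* if 1. $\langle\mathcal Df,\mathcal Dg\rangle=\tfrac14\eta^{AB}\partial_Af\,\partial_Bg$; 2. $[\![e_1,fe_2]\!]=f[\![e_1,e_2]\!]+(\rho(e_1)f)e_2-\langle e_1,e_2\rangle\mathcal Df$; 3. $\langle[\![e_3,e_1]\!]+\mathcal D\langle e_3,e_1\rangle,e_2\rangle+\langle e_1,[\![e_3,e_2]\!]+\mathcal D\langle e_3,e_2\rangle\rangle=\rho(e_3)\langle e_1,e_2\rangle$;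 4. the bracket is the C-bracket: for local sections $e_I$ with constant pairings, the twist $\langle[\![e_I,e_J]\!],e_K\rangle$ equals the generalised flux $3\rho_{[I}{}^A\partial_A\rho_J{}^B\rho_{K]B}$, that is, $\eta(\rho(e_I)^A\partial_A\rho(e_J),\rho(e_K))+\text{cyclic}(I,J,K)$. **Brackets.** On the graded vector space $\mathsf L=\mathsf L_{-1}\oplus\mathsf L_0\oplus\mathsf L_1\oplus\mathsf L_2=C^\infty(M)\oplus\Gamma(L)\oplus\mathfrak X(M)\oplus\mathbb R\mu_0$ (elements $f$, $e$, $h$, $\mu_0$) consider the following maps, for all $i\ge0$: $$\begin{aligned} &\text{the nullary map is the element }\mu_0,\qquad \mu_1(f)=\mathcal Df,\qquad \mu_2(e_1,e_2)=[\![e_1,e_2]\!],\qquad \mu_2(e,f)=\langle e,\mathcal Df\rangle,\\ &\mu_3(e_1,e_2,e_3)=\mathcal N(e_1,e_2,e_3),\qquad \mu_3(\mu_0,e,f)=[\![e,\mathcal Df]\!]-\mathcal D\langle e,\mathcal Df\rangle,\qquad \mu_3(\mu_0,f_1,f_2)=2\langle\mathcal Df_1,\mathcal Df_2\rangle,\\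 &\mu_4(\mu_0,e_1,e_2,e_3)=\mathcal D\mathcal N(e_1,e_2,e_3)-\mathrm{Jac}(e_1,e_2,e_3),\\ &\mu_5(\mu_0,e_1,e_2,e_3,e_4)=\tfrac12\big(\langle X_{123},e_4\rangle-\langle X_{124},e_3\rangle+\langle X_{134},e_2\rangle-\langle X_{234},e_1\rangle\big),\quad X_{abc}=\mathcal D\mathcal N(e_a,e_b,e_c)-\mathrm{Jac}(e_a,e_b,e_c),\\ &\mu_{i+1}(h_1,\dots,h_i,e)=h_1^{A_1}\cdots h_i^{A_i}\,\partial_{A_1}\cdots\partial_{A_i}\rho(e)^B\,\partial_B,\\ &\mu_{i+2}(h_1,\dots,h_i,\mu_0,f)=\tfrac12\eta^{BC}h_1^{A_1}\cdots h_i^{A_i}\,\partial_{A_1}\cdots\partial_{A_i}\partial_Cf\,\partial_B,\\ &\mu_{i+3}(h_1,\dots,h_i,\mu_0,e_1,e_2)=h_1^{A_1}\cdots h_i^{A_i}\,\partial_{A_1}\cdots\partial_{A_i}\mathsf{SC}_\rho(e_1,e_2)^B\,\partial_B, \end{aligned}$$ all maps on other combinations of arguments being zero. The maps are multilinear of degree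 $2-n$ and graded antisymmetric, $\mu_n(\dots,l_r,l_s,\dots)=(-1)^{|l_r||l_s|+1}\mu_n(\dots,l_s,l_r,\dots)$. The $n$-th homotopy expression is $$J_n(l_1,\dots,l_n)=\sum_{j+k=n}\sum_{\sigma}\chi(\sigma;l)(-1)^k\mu_{k+1}(\mu_j(l_{\sigma(1)},\dots,l_{\sigma(j)}),l_{\sigma(j+1)},\dots,l_{\sigma(n)}),$$ with $\sigma$ running over $(j,k)$-unshuffles and $\chi$ the graded Koszul sign including the parity; a curved $L_\infty$-algebra satisfies $J_n=0$ for all $n\ge0$ and has a non-zero nullary map. **Theorem.** (a) For every quadruple $(L,[\![\cdot,\cdot]\!],\langle\cdot,\cdot\rangle,\rho)$ as above (not assuming 1–4) there is exactly one family of graded antisymmetric multilinear maps of degree $2-n$ with the listed values. (b) If the quadruple is a DFT algebroid, these maps form a curved $L_\infty$-algebra on $\mathsf L$. Moreover $$(\rho\circ\mathcal D)f=\tfrac12\eta^{-1}(df),\qquad \rho[\![e_1,e_2]\!]-[\rho(e_1),\rho(e_2)]=-\mathsf{SC}_\rho(e_1,e_2),\qquad \mathrm{Jac}-\mathcal D\mathcal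 N=\mathsf{SC}_{\rm Jac},$$ together with all derivatives $\partial_{A_1}\cdots\partial_{A_k}$ of these identities (of the image under $\rho$ for the third one), and $\mu_4(\mu_0,e_1,e_2,e_3)=-\mathsf{SC}_{\rm Jac}(e_1,e_2,e_3)$. (c) The homotopy relations reproduce these identities: for every quadruple (not assuming 1–4) and all $k\ge0$, with $h^k\partial^k:=h_1^{A_1}\cdots h_k^{A_k}\partial_{A_1}\cdots\partial_{A_k}$ acting on components, $$\begin{aligned} J_{k+1}(h_1,\dots,h_k,f)&=h^k\partial^k\big(\rho(\mathcal Df)-\tfrac12\eta^{-1}(df)\big),\\ J_{k+2}(h_1,\dots,h_k,e_1,e_2)&=h^k\partial^k\big(\rho[\![e_1,e_2]\!]-[\rho(e_1),\rho(e_2)]+\mathsf{SC}_\rho(e_1,e_2)\big),\\ J_3(e_1,e_2,e_3)&=\mathcal D\mathcal N(e_1,e_2,e_3)-\mathrm{Jac}(e_1,e_2,e_3)-\mu_4(\mu_0,e_1,e_2,e_3),\\ J_{k+3}(h_1,\dots,h_k,\mu_0,e,f)&=h^k\partial^k\big(\rho([\![e,\mathcal Df]\!]-\mathcal D\langle e,\mathcal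 Df\rangle)+\tfrac12\eta^{-1}(d\langle e,\mathcal Df\rangle)-[\rho(e),\tfrac12\eta^{-1}(df)]+\mathsf{SC}_\rho(e,\mathcal Df)\big),\\ J_{k+4}(h_1,\dots,h_k,\mu_0,e_1,e_2,e_3)&=h^k\partial^k\big(\rho(\mathcal D\mathcal N-\mathrm{Jac})-\tfrac12\eta^{-1}(d\mathcal N)-\{\mathsf{SC}_\rho([\![e_1,e_2]\!],e_3)+[\mathsf{SC}_\rho(e_1,e_2),\rho(e_3)]+\text{cyclic}\}\big), \end{aligned}$$ where in the last line $\mathcal N$ and $\mathrm{Jac}$ are evaluated on $(e_1,e_2,e_3)$. (d) If 1–3 hold, the listed maps form a curved $L_\infty$-algebra if and only if 4 holds. -/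

import Mathlib

open scoped Manifold ContDiff Topology Bundle
open Bundle

noncomputable section

/-! ## Curved `L_∞`-algebras -/

section LInfinity

variable {W : Type*} [AddCommGroup W] [Module ℝ W]

/-- A collection of multilinear maps `μ_n : W^{× n} → W`, one for every `n ≥ 0`. -/
abbrev Brackets (W : Type*) [AddCommGroup W] [Module ℝ W] : Type _ :=
  ∀ n : ℕ, MultilinearMap ℝ (fun _ : Fin n => W) W

/-- `W` is graded by the subspaces `gr k`, the map `μ_n` has degree `2 - n`, and all `μ_n` are
graded totally antisymmetric:
`μ_n(…, l_{r+1}, l_r, …) = (-1)^{|l_r||l_{r+1}| + 1} μ_n(…, l_r, l_{r+1}, …)`. -/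
structure IsGradedAntisymmetric (gr : ℤ → Submodule ℝ W) (μ : Brackets W) : Prop where
  grading : DirectSum.IsInternal gr
  degree : ∀ (n : ℕ) (deg : Fin n → ℤ) (l : Fin n → W), (∀ i, l i ∈ gr (deg i)) →
    μ n l ∈ gr (∑ i, deg i + 2 - n)
  antisymm : ∀ (n : ℕ) (deg : Fin n → ℤ) (l : Fin n → W), (∀ i, l i ∈ gr (deg i)) →
    ∀ r s : Fin n, s.val = r.val + 1 →
      μ n (fun i => l (Equiv.swap r s i)) = ((-1 : ℝ) ^ (deg r * deg s + 1)) • μ n l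

/-- Graded Koszul sign (including the parity of the permutation) of the unshuffle `σ` of
`{1, …, n}` which lists the elements of `S` in increasing order and then those of the
complement of `S` in increasing order: every inversion, that is every pair `r < s` with
`r ∉ S` and `s ∈ S`, contributes a factor `(-1)^{|l_r||l_s| + 1}`. -/
def koszulSign {n : ℕ} (deg : Fin n → ℤ) (S : Finset (Fin n)) : ℝ :=
  ∏ r ∈ Sᶜ, ∏ s ∈ S, if r < s then (-1 : ℝ) ^ (deg r * deg s + 1) else 1

/-- Left-hand side of the homotopy Jacobi identity,
`∑_{j+k=n} ∑_σ χ(σ; l) (-1)^k μ_{k+1}(μ_j(l_{σ(1)}, …, l_{σ(j)}), l_{σ(j+1)}, …, l_{σ(n)})`.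
The unshuffles `σ` with `σ(1) < ⋯ < σ(j)` and `σ(j+1) < ⋯ < σ(n)` are indexed by the sets
`S = {σ(1), …, σ(j)}`. -/
def homotopyJacobi (μ : Brackets W) (n : ℕ) (deg : Fin n → ℤ) (l : Fin n → W) : W :=
  ∑ S : Finset (Fin n), (koszulSign deg S * (-1 : ℝ) ^ Sᶜ.card) •
    μ (Sᶜ.card + 1) (Fin.cons (α := fun _ => W)
      (μ S.card (fun i => l (S.orderEmbOfFin rfl i)))
      (fun i => l (Sᶜ.orderEmbOfFin rfl i)))

/-- `(W, μ)` is a (possibly curved) `L_∞`-algebra. -/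
structure IsLInfinityAlgebra (gr : ℤ → Submodule ℝ W) (μ : Brackets W) : Prop extends
    IsGradedAntisymmetric gr μ where
  jacobi : ∀ (n : ℕ) (deg : Fin n → ℤ) (l : Fin n → W), (∀ i, l i ∈ gr (deg i)) →
    homotopyJacobi μ n deg l = 0

/-- A curved `L_∞`-algebra is an `L_∞`-algebra with `μ_0 ≠ 0`. -/
structure IsCurvedLInfinityAlgebra (gr : ℤ → Submodule ℝ W) (μ : Brackets W) : Prop extends
    IsLInfinityAlgebra gr μ where
  curved : μ 0 ![] ≠ 0

end LInfinity

/-! ## The doubled space and its constant metric -/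

/-- `ℝ^{2d}` with coordinates `(x^a, x̃_a)`. -/
abbrev DoubledSpace (d : ℕ) : Type := Fin d ⊕ Fin d → ℝ

/-- The constant `O(d,d)` metric `η_{AB}`: `η(u, v) = ∑_a (u^a ṽ_a + ũ_a v^a)`. -/
def eta {d : ℕ} (u v : DoubledSpace d) : ℝ := ∑ A, u A * v A.swap

/-- Raising an index with `η^{AB}` (the inverse of `η_{AB}`, which is the same matrix): the vector
`η^{AB} α_A ∂_B` of a covector `α`, where `α_A = α(∂_A)`. -/
def sharp {d : ℕ} (α : DoubledSpace d → ℝ) : DoubledSpace d :=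
  fun B => α (Pi.single B.swap 1)

/-- `M` is a `2d`-dimensional manifold covered by doubled coordinates `X^A` in which the metric `η`
has the constant components `η_{AB}`: all changes of coordinates are locally affine with linear
part in `O(d,d)`. -/
class IsDoubledManifold (d : ℕ) (M : Type*) [TopologicalSpace M]
    [ChartedSpace (DoubledSpace d) M] : Prop where
  flat : ∀ φ ∈ atlas (DoubledSpace d) M, ∀ ψ ∈ atlas (DoubledSpace d) M,
    ∀ x ∈ (φ.symm ≫ₕ ψ).source,
      ∃ (L : DoubledSpace d →L[ℝ] DoubledSpace d) (b : DoubledSpace d),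
        (∀ u v, eta (L u) (L v) = eta u v) ∧ ∀ᶠ y in 𝓝 x, (φ.symm ≫ₕ ψ) y = L y + b

/-- `C^∞(M)`. -/
abbrev Functions (d : ℕ) (M : Type*) [TopologicalSpace M] [ChartedSpace (DoubledSpace d) M] :
    Type _ :=
  C^∞⟮𝓘(ℝ, DoubledSpace d), M; ℝ⟯

/-- `Γ(L)`, for a vector bundle `L = V` with typical fibre `F`. -/
abbrev Sections (d : ℕ) {M : Type*} [TopologicalSpace M] [ChartedSpace (DoubledSpace d) M]
    (F : Type*) [NormedAddCommGroup F] [NormedSpace ℝ F] (V : M → Type*)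
    [TopologicalSpace (TotalSpace F V)] [∀ x, TopologicalSpace (V x)] [FiberBundle F V] : Type _ :=
  Cₛ^∞⟮𝓘(ℝ, DoubledSpace d); F, V⟯

/-- `𝔛(M)`. -/
abbrev VectorFields (d : ℕ) (M : Type*) [TopologicalSpace M] [ChartedSpace (DoubledSpace d) M]
    [IsManifold 𝓘(ℝ, DoubledSpace d) ∞ M] : Type _ :=
  Cₛ^∞⟮𝓘(ℝ, DoubledSpace d); DoubledSpace d,
    (TangentSpace 𝓘(ℝ, DoubledSpace d) : M → Type)⟯

section Flat

variable {d : ℕ} {M : Type*} [TopologicalSpace M] [ChartedSpace (DoubledSpace d) M]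

/-- Vector fields without any smoothness requirement. -/
abbrev RawVectorField (d : ℕ) (M : Type*) [TopologicalSpace M]
    [ChartedSpace (DoubledSpace d) M] : Type _ :=
  ∀ x : M, TangentSpace 𝓘(ℝ, DoubledSpace d) x

/-- `w_1^{A_1} ⋯ w_i^{A_i} ∂_{A_1} ⋯ ∂_{A_i} v^B ∂_B` at the point `x`, in the doubled coordinates
around `x` (with which the tangent space at `x` is identified with `ℝ^{2d}`). -/
def flatDeriv (i : ℕ) (v : RawVectorField d M) (x : M)
    (w : Fin i → TangentSpace 𝓘(ℝ, DoubledSpace d) x) : TangentSpace 𝓘(ℝ, DoubledSpace d) x :=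
  iteratedFDeriv ℝ i
    (fun y : DoubledSpace d =>
      (VectorField.mpullbackWithin 𝓘(ℝ, DoubledSpace d) 𝓘(ℝ, DoubledSpace d)
        (extChartAt 𝓘(ℝ, DoubledSpace d) x).symm v (Set.range 𝓘(ℝ, DoubledSpace d)) y :
        DoubledSpace d))
    (extChartAt 𝓘(ℝ, DoubledSpace d) x x) w

/-- The directional derivative `w^A ∂_A v^B ∂_B`. -/
def dirDeriv (w v : RawVectorField d M) : RawVectorField d M :=
  fun x => flatDeriv 1 v x ![w x]

/-- The differential `df`. -/
def differential (f : M → ℝ) (x : M) (w : TangentSpace 𝓘(ℝ, DoubledSpace d) x) : ℝ :=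
  mfderiv 𝓘(ℝ, DoubledSpace d) 𝓘(ℝ, ℝ) f x w

theorem differential_isLinearMap (f : M → ℝ) (x : M) :
    IsLinearMap ℝ (differential (d := d) f x) :=
  (mfderiv 𝓘(ℝ, DoubledSpace d) 𝓘(ℝ, ℝ) f x).toLinearMap.isLinear

/-- `η^{-1}(df) = η^{AB} ∂_A f ∂_B`. -/
def etaGrad (f : M → ℝ) : RawVectorField d M :=
  fun x => sharp (differential (d := d) f x)

/-- `u_C η^{AB} ∂_A v^C ∂_B`, where `u_C = η_{CD} u^D`. -/
def contractDeriv (u v : RawVectorField d M) : RawVectorField d M :=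
  fun x => sharp fun w => eta (u x) (flatDeriv 1 v x ![w])

/-- The vector field `η^{-1}(v)(η(u))`: the contraction of the symmetric 2-vector
`η^{-1}(v) = η^{AB} ∂_A v^C ∂_C ∨ ∂_B`, where `a ∨ b = a ⊗ b + b ⊗ a`, with the 1-form
`η(u) = u_C dX^C`. -/
def etaInvContract (v u : RawVectorField d M) : RawVectorField d M :=
  fun x => contractDeriv u v x + dirDeriv u v x

end Flat

/-! ## The structural data of a DFT algebroid -/

section Data

variable (d : ℕ) (M : Type*) [TopologicalSpace M] [ChartedSpace (DoubledSpace d) M]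
  [IsManifold 𝓘(ℝ, DoubledSpace d) ∞ M]
  (F : Type*) [NormedAddCommGroup F] [NormedSpace ℝ F]
  (V : M → Type*) [TopologicalSpace (TotalSpace F V)]
  [∀ x, AddCommGroup (V x)] [∀ x, Module ℝ (V x)] [∀ x, TopologicalSpace (V x)]
  [∀ x, IsTopologicalAddGroup (V x)] [∀ x, ContinuousSMul ℝ (V x)]
  [FiberBundle F V] [VectorBundle ℝ F V]

/-- A quadruple `(L, [[·,·]], ⟨·,·⟩, ρ)`: a vector bundle `L = V` over `M` with a skew-symmetric
bracket on its sections, a non-degenerate symmetric form and a smooth bundle map `ρ : L → TM`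
(and no compatibility condition between them). -/
structure BracketBundle where
  bracket : Sections d F V →ₗ[ℝ] Sections d F V →ₗ[ℝ] Sections d F V
  bracket_skew : ∀ e₁ e₂, bracket e₁ e₂ = -bracket e₂ e₁
  form : ∀ x, V x →L[ℝ] V x →L[ℝ] ℝ
  form_symm : ∀ x v w, form x v w = form x w v
  form_nondeg : ∀ x v, (∀ w, form x v w = 0) → v = 0
  form_smooth : ContMDiff 𝓘(ℝ, DoubledSpace d)
    (𝓘(ℝ, DoubledSpace d).prod 𝓘(ℝ, F →L[ℝ] F →L[ℝ] ℝ)) ∞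
    (fun x => TotalSpace.mk' (F →L[ℝ] F →L[ℝ] ℝ)
      (E := fun x => V x →L[ℝ] V x →L[ℝ] ℝ) x (form x))
  anchor : ∀ x, V x →L[ℝ] TangentSpace 𝓘(ℝ, DoubledSpace d) x
  anchor_smooth : ContMDiff 𝓘(ℝ, DoubledSpace d)
    (𝓘(ℝ, DoubledSpace d).prod 𝓘(ℝ, F →L[ℝ] DoubledSpace d)) ∞
    (fun x => TotalSpace.mk' (F →L[ℝ] DoubledSpace d)
      (E := fun x => V x →L[ℝ] TangentSpace 𝓘(ℝ, DoubledSpace d) x) x (anchor x))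

/-- The graded vector space
`L_{-1} ⊕ L_0 ⊕ L_1 ⊕ L_2 = C^∞(M) ⊕ Γ(L) ⊕ 𝔛(M) ⊕ ℝ μ_0`; the real number `r` in the last
summand stands for `r μ_0`, where `μ_0` represents the constant symmetric 2-vector `η^{-1}`. -/
abbrev ExtSpace : Type _ :=
  Functions d M × Sections d F V × VectorFields d M × ℝ

/-- The homogeneous subspaces `L_k` (zero unless `k = -1, 0, 1, 2`). -/
def extGrading (k : ℤ) : Submodule ℝ (ExtSpace d M F V) where
  carrier := {l | (k ≠ -1 → l.1 = 0) ∧ (k ≠ 0 → l.2.1 = 0) ∧ (k ≠ 1 → l.2.2.1 = 0) ∧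
    (k ≠ 2 → l.2.2.2 = 0)}
  add_mem' := by
    rintro a b ⟨h1, h2, h3, h4⟩ ⟨k1, k2, k3, k4⟩
    refine ⟨fun h => ?_, fun h => ?_, fun h => ?_, fun h => ?_⟩
    · simp [h1 h, k1 h]
    · simp [h2 h, k2 h]
    · simp [h3 h, k3 h]
    · simp [h4 h, k4 h]
  zero_mem' := by simp
  smul_mem' := by
    rintro c a ⟨h1, h2, h3, h4⟩
    refine ⟨fun h => ?_, fun h => ?_, fun h => ?_, fun h => ?_⟩
    · simp [h1 h]
    · simp [h2 h]
    · simp [h3 h]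
    · simp [h4 h]

variable {d M F V}

/-- `f ∈ C^∞(M) = L_{-1}`. -/
def inF (f : Functions d M) : ExtSpace d M F V := (f, 0, 0, 0)

/-- `e ∈ Γ(L) = L_0`. -/
def inE (e : Sections d F V) : ExtSpace d M F V := (0, e, 0, 0)

/-- `h ∈ 𝔛(M) = L_1`. -/
def inH (h : VectorFields d M) : ExtSpace d M F V := (0, 0, h, 0)

variable (d M F V) in
/-- The basis element `μ_0` of `L_2`. -/
def muZero : ExtSpace d M F V := (0, 0, 0, 1)

/-- `l ∈ L_1` and `l` is the vector field `v`. -/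
def IsVectorField (l : ExtSpace d M F V) (v : RawVectorField d M) : Prop :=
  ∃ h : VectorFields d M, l = inH h ∧ ∀ x, h x = v x

end Data

namespace BracketBundle

variable {d : ℕ} {M : Type*} [TopologicalSpace M] [ChartedSpace (DoubledSpace d) M]
  [IsManifold 𝓘(ℝ, DoubledSpace d) ∞ M]
  {F : Type*} [NormedAddCommGroup F] [NormedSpace ℝ F]
  {V : M → Type*} [TopologicalSpace (TotalSpace F V)]
  [∀ x, AddCommGroup (V x)] [∀ x, Module ℝ (V x)] [∀ x, TopologicalSpace (V x)]
  [∀ x, IsTopologicalAddGroup (V x)] [∀ x, ContinuousSMul ℝ (V x)]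
  [FiberBundle F V] [VectorBundle ℝ F V]
  [ContMDiffVectorBundle ∞ F V 𝓘(ℝ, DoubledSpace d)]
  (A : BracketBundle d M F V)

/-- The vector field `ρ(e)`. -/
def rho (e : Sections d F V) : VectorFields d M where
  toFun x := A.anchor x (e x)
  contMDiff_toFun := A.anchor_smooth.clm_bundle_apply e.contMDiff

/-- The function `⟨e₁, e₂⟩`. -/
def pair (e₁ e₂ : Sections d F V) : Functions d M where
  val x := A.form x (e₁ x) (e₂ x)
  property := by
    have h := A.form_smooth.clm_bundle_apply₂ (F₃ := ℝ) (E₃ := Trivial M ℝ)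
      e₁.contMDiff e₂.contMDiff
    intro x
    exact (Bundle.contMDiffAt_section (E := Trivial M ℝ) x).1 (h x)

/-- The section `f e`. -/
def fsmul (f : Functions d M) (e : Sections d F V) : Sections d F V where
  toFun x := f x • e x
  contMDiff_toFun := f.contMDiff.smul_section e.contMDiff

theorem finiteDimensional_fiber [FiniteDimensional ℝ F] (V : M → Type*)
    [TopologicalSpace (TotalSpace F V)]
    [∀ x, AddCommGroup (V x)] [∀ x, Module ℝ (V x)] [∀ x, TopologicalSpace (V x)]
    [FiberBundle F V] [VectorBundle ℝ F V] (x : M) : FiniteDimensional ℝ (V x) :=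
  ((trivializationAt F V x).linearEquivAt ℝ x
    (FiberBundle.mem_baseSet_trivializationAt' x)).symm.finiteDimensional

/-- The form is a duality between the fibre and its dual. -/
theorem exists_raise [FiniteDimensional ℝ F] (x : M) (α : V x → ℝ) (hα : IsLinearMap ℝ α) :
    ∃ v : V x, ∀ w, A.form x v w = α w := by
  have := finiteDimensional_fiber (F := F) V x
  let f : V x →ₗ[ℝ] Module.Dual ℝ (V x) :=
    { toFun := fun v => (A.form x v : V x →ₗ[ℝ] ℝ)
      map_add' := by intros; ext; simp
      map_smul' := by intros; ext; simp }
  have hf : Function.Injective f := by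
    rw [← LinearMap.ker_eq_bot, LinearMap.ker_eq_bot']
    intro v hv
    exact A.form_nondeg x v fun w => by simpa [f] using LinearMap.congr_fun hv w
  have hs := (LinearMap.injective_iff_surjective_of_finrank_eq_finrank
    (Subspace.dual_finrank_eq (K := ℝ) (V := V x)).symm).1 hf
  obtain ⟨v, hv⟩ := hs hα.mk'
  exact ⟨v, fun w => by simpa [f] using LinearMap.congr_fun hv w⟩

theorem contMDiffAt_raise [FiniteDimensional ℝ F] (x₀ : M) (s : ∀ x, V x) (a : M → F →L[ℝ] ℝ)
    (ha : ContMDiffAt 𝓘(ℝ, DoubledSpace d) 𝓘(ℝ, F →L[ℝ] ℝ) ∞ a x₀)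
    (hs : ∀ᶠ x in 𝓝 x₀, ∀ b : F,
      A.form x (s x) ((trivializationAt F V x₀).symm x b) = a x b) :
    ContMDiffAt 𝓘(ℝ, DoubledSpace d) (𝓘(ℝ, DoubledSpace d).prod 𝓘(ℝ, F)) ∞
      (fun x => TotalSpace.mk' F x (s x)) x₀ := by
  rw [Bundle.contMDiffAt_section]
  have := FiniteDimensional.complete ℝ F
  set K : M → F →L[ℝ] F →L[ℝ] ℝ := fun x =>
    ContinuousLinearMap.inCoordinates F V (F →L[ℝ] ℝ)
      (fun x => V x →L[ℝ] ℝ) x₀ x x₀ x (A.form x) with hK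
  have hKs : ContMDiffAt 𝓘(ℝ, DoubledSpace d) 𝓘(ℝ, F →L[ℝ] F →L[ℝ] ℝ) ∞ K x₀ :=
    ((contMDiffAt_hom_bundle _).1 (A.form_smooth x₀)).2
  have hb : ∀ᶠ x in 𝓝 x₀, x ∈ (trivializationAt F V x₀).baseSet :=
    (trivializationAt F V x₀).open_baseSet.mem_nhds (FiberBundle.mem_baseSet_trivializationAt' x₀)
  have hKv : ∀ x ∈ (trivializationAt F V x₀).baseSet, ∀ b c, K x b c =
      A.form x ((trivializationAt F V x₀).symm x b) ((trivializationAt F V x₀).symm x c) := by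
    intro x hx b c
    have := inCoordinates_apply_eq₂ (F₃ := ℝ) (E₃ := Trivial M ℝ) (x₀ := x₀) (ϕ := A.form x)
      (v := b) (w := c) hx hx (Set.mem_univ _)
    refine this.trans ?_
    simp
  have hinv : ∀ x ∈ (trivializationAt F V x₀).baseSet, (K x).IsInvertible := by
    intro x hx
    have hinj : Function.Injective (K x) := by
      rw [← LinearMap.coe_coe, ← LinearMap.ker_eq_bot, LinearMap.ker_eq_bot']
      intro b hb
      have h1 : (trivializationAt F V x₀).symm x b = 0 := by
        apply A.form_nondeg
        intro w
        have h2 := hKv x hx b ((trivializationAt F V x₀) ⟨x, w⟩).2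
        rw [Trivialization.symm_apply_apply_mk _ hx] at h2
        rw [← h2]
        have h3 : K x b = 0 := hb
        rw [h3]; rfl
      have h4 := Trivialization.apply_mk_symm (trivializationAt F V x₀) hx b
      rw [h1] at h4
      have h5 : ((trivializationAt F V x₀) ⟨x, 0⟩).2 = b := congrArg Prod.snd h4
      rw [← h5]
      exact ((trivializationAt F V x₀).linear ℝ hx).map_zero
    have hfr : Module.finrank ℝ F = Module.finrank ℝ (F →L[ℝ] ℝ) := by
      rw [← (LinearMap.toContinuousLinearMap (𝕜 := ℝ) (E := F) (F' := ℝ)).finrank_eq]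
      exact (Subspace.dual_finrank_eq (K := ℝ) (V := F)).symm
    exact ⟨(LinearEquiv.ofInjectiveOfFinrankEq (K x : F →ₗ[ℝ] (F →L[ℝ] ℝ))
      hinj hfr).toContinuousLinearEquiv, by ext; rfl⟩
  have hc : ContMDiffAt 𝓘(ℝ, DoubledSpace d) 𝓘(ℝ, F) ∞ (fun x => (K x).inverse (a x)) x₀ := by
    refine ContMDiffAt.clm_apply ?_ ha
    exact ((hinv x₀ (FiberBundle.mem_baseSet_trivializationAt'
      x₀)).contDiffAt_map_inverse).contMDiffAt.comp x₀ hKs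
  refine hc.congr_of_eventuallyEq ?_
  filter_upwards [hb, hs] with x hx hsx
  have h1 : K x ((trivializationAt F V x₀) ⟨x, s x⟩).2 = a x := by
    ext c
    rw [hKv x hx, Trivialization.symm_apply_apply_mk _ hx, hsx]
  rw [← h1]
  exact ((hinv x hx).inverse_apply_eq.2 rfl).symm

theorem exists_D [FiniteDimensional ℝ F] (f : Functions d M) :
    ∃ s : Sections d F V, ∀ x v, A.form x (s x) v =
      1 / 2 * differential f x (A.anchor x v) := by
  have h : ∀ x, ∃ v : V x, ∀ w, A.form x v w =
      1 / 2 * differential f x (A.anchor x w) := fun x =>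
    A.exists_raise (F := F) x _ ⟨fun v w => by
        rw [map_add, (differential_isLinearMap _ _).map_add, mul_add],
      fun c v => by
        rw [map_smul, (differential_isLinearMap _ _).map_smul, smul_eq_mul, smul_eq_mul,
          mul_left_comm]⟩
  choose s hs using h
  refine ⟨⟨s, fun x₀ => ?_⟩, hs⟩
  have hdf := (f.contMDiff x₀).mfderiv_const (m := ∞) (by simp)
  have hρ := ((contMDiffAt_hom_bundle _).1 (A.anchor_smooth x₀)).2
  refine A.contMDiffAt_raise x₀ s (fun x => (1 / 2 : ℝ) •
    (inTangentCoordinates 𝓘(ℝ, DoubledSpace d) 𝓘(ℝ, ℝ) id f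
      (mfderiv 𝓘(ℝ, DoubledSpace d) 𝓘(ℝ, ℝ) f) x₀ x).comp
    (ContinuousLinearMap.inCoordinates F V (DoubledSpace d)
      (TangentSpace 𝓘(ℝ, DoubledSpace d)) x₀ x x₀ x (A.anchor x))) ?_ ?_
  · have hc : ContMDiffAt 𝓘(ℝ, DoubledSpace d) 𝓘(ℝ, ℝ) ∞ (fun _ : M => (1 / 2 : ℝ)) x₀ :=
      contMDiffAt_const
    exact hc.smul (hdf.clm_comp hρ)
  · have hb : ∀ᶠ x in 𝓝 x₀, x ∈ (trivializationAt F V x₀).baseSet :=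
      (trivializationAt F V x₀).open_baseSet.mem_nhds
        (FiberBundle.mem_baseSet_trivializationAt' x₀)
    have hb' : ∀ᶠ x in 𝓝 x₀, x ∈ (trivializationAt (DoubledSpace d)
        (TangentSpace 𝓘(ℝ, DoubledSpace d)) x₀).baseSet :=
      (trivializationAt (DoubledSpace d)
        (TangentSpace 𝓘(ℝ, DoubledSpace d)) x₀).open_baseSet.mem_nhds
          (FiberBundle.mem_baseSet_trivializationAt' x₀)
    filter_upwards [hb, hb'] with x hx hx' b
    have h1 := ContinuousLinearMap.inCoordinates_eq (ϕ := A.anchor x) hx hx'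
    have h2 : inTangentCoordinates 𝓘(ℝ, DoubledSpace d) 𝓘(ℝ, ℝ) id f
        (mfderiv 𝓘(ℝ, DoubledSpace d) 𝓘(ℝ, ℝ) f) x₀ x = _ :=
      ContinuousLinearMap.inCoordinates_eq (F' := ℝ) (E' := TangentSpace 𝓘(ℝ, ℝ))
        (ϕ := mfderiv 𝓘(ℝ, DoubledSpace d) 𝓘(ℝ, ℝ) f x) hx'
        (by rw [TangentBundle.trivializationAt_baseSet, chartAt_self_eq]; trivial)
    rw [hs, h1, h2]
    simp only [differential, one_div, ContinuousLinearMap.coe_comp, Function.comp_apply,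
      _root_.smul_apply, ContinuousLinearEquiv.coe_coe,
      ContinuousLinearEquiv.symm_apply_apply, smul_eq_mul]
    simp

variable [FiniteDimensional ℝ F]

/-- The derivative `D : C^∞(M) → Γ(L)`, defined by `⟨D f, e⟩ = ½ ρ(e) f`
(it is unique since the form is non-degenerate). -/
def D (f : Functions d M) : Sections d F V := (A.exists_D f).choose

theorem pair_D (f : Functions d M) (e : Sections d F V) (x : M) :
    A.pair (A.D f) e x = 1 / 2 * differential f x (A.rho e x) :=
  (A.exists_D f).choose_spec x (e x)

/-- `N(e₁,e₂,e₃) = ⅓ ⟨[[e₁,e₂]],e₃⟩ + cyclic`. -/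
def calN (e₁ e₂ e₃ : Sections d F V) : Functions d M :=
  (1 / 3 : ℝ) • (A.pair (A.bracket e₁ e₂) e₃ + A.pair (A.bracket e₂ e₃) e₁ +
    A.pair (A.bracket e₃ e₁) e₂)

/-- `Jac(e₁,e₂,e₃) = [[[[e₁,e₂]],e₃]] + cyclic`. -/
def Jac (e₁ e₂ e₃ : Sections d F V) : Sections d F V :=
  A.bracket (A.bracket e₁ e₂) e₃ + A.bracket (A.bracket e₂ e₃) e₁ +
    A.bracket (A.bracket e₃ e₁) e₂

/-- `D N(e₁,e₂,e₃) - Jac(e₁,e₂,e₃)`. -/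
def DNsubJac (e₁ e₂ e₃ : Sections d F V) : Sections d F V :=
  A.D (A.calN e₁ e₂ e₃) - A.Jac e₁ e₂ e₃

/-- The vector field `SC_ρ(e₁,e₂)`, that is
`SC_ρ(e₁,e₂) f = ½ η(ρ(e₁), η^{-1}(df)(ρ(e₂))) - (e₁ ↔ e₂)
  = ½ ρ(e₁)_C η^{AB} ∂_B f ∂_A ρ(e₂)^C - (e₁ ↔ e₂)`. -/
def SCrho (e₁ e₂ : Sections d F V) : RawVectorField d M := fun x =>
  (1 / 2 : ℝ) • contractDeriv (A.rho e₁) (A.rho e₂) x -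
    (1 / 2 : ℝ) • contractDeriv (A.rho e₂) (A.rho e₁) x

/-- The map `ρ^{-1} : TM → L` determined by `⟨ρ^{-1}(h), e⟩ = η(h, ρ(e))`. -/
def rhoInv (h : RawVectorField d M) (x : M) : V x :=
  (A.exists_raise (F := F) x (fun v => eta (h x) (A.anchor x v))
    ⟨fun v w => by
      simp only [eta, map_add, ← Finset.sum_add_distrib]
      exact Finset.sum_congr rfl fun i _ => mul_add _ _ _,
    fun c v => by
      simp only [eta, map_smul, smul_eq_mul, Finset.mul_sum]
      exact Finset.sum_congr rfl fun i _ => mul_left_comm _ _ _⟩).choose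

/-- The vector field
`-η^{-1}(ρ(e₂))(η(ρ(e₁))) + η^{-1}(ρ(e₁))(η(ρ(e₂))) + [ρ(e₁), ρ(e₂)]`. -/
def SCJacVector (e₁ e₂ : Sections d F V) : RawVectorField d M := fun x =>
  -etaInvContract (A.rho e₂) (A.rho e₁) x + etaInvContract (A.rho e₁) (A.rho e₂) x +
    VectorField.mlieBracket 𝓘(ℝ, DoubledSpace d) (A.rho e₁) (A.rho e₂) x

/-- `SC_Jac(e₁,e₂,e₃) = ½ ρ^{-1}{(-η^{-1}(ρ(e₂))(η(ρ(e₁))) + η^{-1}(ρ(e₁))(η(ρ(e₂)))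
  + [ρ(e₁), ρ(e₂)]) ρ(e₃)} + cyclic`. -/
def SCJac (e₁ e₂ e₃ : Sections d F V) (x : M) : V x :=
  (1 / 2 : ℝ) • A.rhoInv (dirDeriv (A.SCJacVector e₁ e₂) (A.rho e₃)) x +
  (1 / 2 : ℝ) • A.rhoInv (dirDeriv (A.SCJacVector e₂ e₃) (A.rho e₁)) x +
  (1 / 2 : ℝ) • A.rhoInv (dirDeriv (A.SCJacVector e₃ e₁) (A.rho e₂)) x

/-- The three compatibility conditions between bracket, form and anchor. -/
structure SatisfiesAxioms : Prop where
  /-- `⟨D f, D g⟩ = ¼ η^{-1}(df, dg)` -/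
  axiom_metric : ∀ (f g : Functions d M) (x : M),
    A.pair (A.D f) (A.D g) x = 1 / 4 * differential f x (etaGrad (d := d) g x)
  /-- `[[e₁, f e₂]] = f [[e₁,e₂]] + (ρ(e₁) f) e₂ - ⟨e₁,e₂⟩ D f` -/
  axiom_leibniz : ∀ (e₁ e₂ : Sections d F V) (f : Functions d M) (x : M),
    A.bracket e₁ (fsmul f e₂) x = f x • A.bracket e₁ e₂ x +
      differential f x (A.rho e₁ x) • e₂ x - A.pair e₁ e₂ x • A.D f x
  /-- `⟨[[e₃,e₁]] + D⟨e₃,e₁⟩, e₂⟩ + ⟨e₁, [[e₃,e₂]] + D⟨e₃,e₂⟩⟩ = ρ(e₃)⟨e₁,e₂⟩` -/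
  axiom_compat : ∀ (e₁ e₂ e₃ : Sections d F V) (x : M),
    A.pair (A.bracket e₃ e₁ + A.D (A.pair e₃ e₁)) e₂ x +
      A.pair e₁ (A.bracket e₃ e₂ + A.D (A.pair e₃ e₂)) x =
        differential (A.pair e₁ e₂) x (A.rho e₃ x)

/-- The bracket is the C-bracket of double field theory: in local frames with constant pairings
`⟨e_I, e_J⟩` its twist `T_{IJK} = ⟨[[e_I,e_J]],e_K⟩` is the generalised flux
`F_{IJK} = 3 ρ_{[I}^A ∂_A ρ_J^B ρ_{K]B}` of the anchor, i.e. the cyclic sum of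
`η(ρ(e_I)^A ∂_A ρ(e_J), ρ(e_K))`. -/
def IsCBracket : Prop :=
  ∀ (e : Fin 3 → Sections d F V) (x : M),
    (∀ I J, ∀ᶠ y in 𝓝 x, A.pair (e I) (e J) y = A.pair (e I) (e J) x) →
      A.pair (A.bracket (e 0) (e 1)) (e 2) x =
        eta (dirDeriv (A.rho (e 0)) (A.rho (e 1)) x) (A.rho (e 2) x) +
        eta (dirDeriv (A.rho (e 1)) (A.rho (e 2)) x) (A.rho (e 0) x) +
        eta (dirDeriv (A.rho (e 2)) (A.rho (e 0)) x) (A.rho (e 1) x)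

/-- A DFT algebroid. -/
structure IsDFTAlgebroid : Prop extends A.SatisfiesAxioms where
  cBracket : A.IsCBracket

/-- The number of arguments of degree `-1`, `0`, `1` and `2`. -/
def argType {n : ℕ} (deg : Fin n → ℤ) : ℕ × ℕ × ℕ × ℕ :=
  ((Finset.univ.filter fun i => deg i = -1).card, (Finset.univ.filter fun i => deg i = 0).card,
    (Finset.univ.filter fun i => deg i = 1).card, (Finset.univ.filter fun i => deg i = 2).card)

/-- The combinations of arguments (numbers of `f`'s, `e`'s, `h`'s and `μ_0`'s) for which a bracket
is listed in `HasExtendedBrackets`. -/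
def listedTypes : Set (ℕ × ℕ × ℕ × ℕ) :=
  {(0, 0, 0, 0), (1, 0, 0, 0), (0, 2, 0, 0), (1, 1, 0, 0), (0, 3, 0, 0), (1, 1, 0, 1),
    (2, 0, 0, 1), (0, 3, 0, 1), (0, 4, 0, 1)} ∪
  Set.range (fun i => (0, 1, i, 0)) ∪ Set.range (fun i => (1, 0, i, 1)) ∪
  Set.range (fun i => (0, 2, i, 1))

/-- The list of maps of the extended algebra; all other maps vanish. -/
structure HasExtendedBrackets (μ : Brackets (ExtSpace d M F V)) : Prop where
  mu_curvature : μ 0 ![] = muZero d M F V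
  mu_f : ∀ f, μ 1 ![inF f] = inE (A.D f)
  mu_ee : ∀ e₁ e₂, μ 2 ![inE e₁, inE e₂] = inE (A.bracket e₁ e₂)
  mu_ef : ∀ e f, μ 2 ![inE e, inF f] = inF (A.pair e (A.D f))
  mu_eee : ∀ e₁ e₂ e₃, μ 3 ![inE e₁, inE e₂, inE e₃] = inF (A.calN e₁ e₂ e₃)
  mu_0ef : ∀ e f, μ 3 ![muZero d M F V, inE e, inF f] =
    inE (A.bracket e (A.D f) - A.D (A.pair e (A.D f)))
  mu_0ff : ∀ f₁ f₂, μ 3 ![muZero d M F V, inF f₁, inF f₂] =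
    inF ((2 : ℝ) • A.pair (A.D f₁) (A.D f₂))
  mu_0eee : ∀ e₁ e₂ e₃, μ 4 ![muZero d M F V, inE e₁, inE e₂, inE e₃] =
    inE (A.DNsubJac e₁ e₂ e₃)
  mu_0eeee : ∀ e₁ e₂ e₃ e₄, μ 5 ![muZero d M F V, inE e₁, inE e₂, inE e₃, inE e₄] =
    inF ((1 / 2 : ℝ) • (A.pair (A.DNsubJac e₁ e₂ e₃) e₄ - A.pair (A.DNsubJac e₁ e₂ e₄) e₃ +
      A.pair (A.DNsubJac e₁ e₃ e₄) e₂ - A.pair (A.DNsubJac e₂ e₃ e₄) e₁))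
  /-- `μ_{i+1}(h_1,…,h_i,e) = h_1^{A_1}⋯h_i^{A_i} ∂_{A_1}⋯∂_{A_i} ρ(e)^B ∂_B` -/
  mu_he : ∀ (i : ℕ) (h : Fin i → VectorFields d M) (e : Sections d F V),
    IsVectorField (μ (i + 1) (Fin.append (fun j => inH (h j)) ![inE e]))
      (fun x => flatDeriv i (A.rho e) x fun j => h j x)
  /-- `μ_{i+2}(h_1,…,h_i,μ_0,f) = ½ η^{BC} h_1^{A_1}⋯h_i^{A_i} ∂_{A_1}⋯∂_{A_i} ∂_C f ∂_B` -/
  mu_h0f : ∀ (i : ℕ) (h : Fin i → VectorFields d M) (f : Functions d M),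
    IsVectorField (μ (i + 2) (Fin.append (fun j => inH (h j)) ![muZero d M F V, inF f]))
      (fun x => (1 / 2 : ℝ) • flatDeriv i (etaGrad f) x fun j => h j x)
  /-- `μ_{i+3}(h_1,…,h_i,μ_0,e₁,e₂) = h_1^{A_1}⋯h_i^{A_i} ∂_{A_1}⋯∂_{A_i} SC_ρ(e₁,e₂)^B ∂_B` -/
  mu_h0ee : ∀ (i : ℕ) (h : Fin i → VectorFields d M) (e₁ e₂ : Sections d F V),
    IsVectorField
      (μ (i + 3) (Fin.append (fun j => inH (h j)) ![muZero d M F V, inE e₁, inE e₂]))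
      (fun x => flatDeriv i (A.SCrho e₁ e₂) x fun j => h j x)
  mu_other : ∀ (n : ℕ) (deg : Fin n → ℤ) (l : Fin n → ExtSpace d M F V),
    (∀ i, l i ∈ extGrading d M F V (deg i)) → argType deg ∉ listedTypes → μ n l = 0

/-- The Lie bracket `[u, v]` of vector fields. -/
abbrev lie (u v : RawVectorField d M) : RawVectorField d M :=
  VectorField.mlieBracket 𝓘(ℝ, DoubledSpace d) u v

/-- What the left-hand sides of the homotopy Jacobi identities are, before any compatibility
condition is imposed: the relations for `f`, for `(e₁,e₂)`, for `(μ_0,e,f)`, for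
`(μ_0,e₁,e₂,e₃)`, each with any number `k ≥ 0` of vector fields `h_1,…,h_k` inserted, are the
`k`-th derivatives of the defects of the corresponding identities, and the relation for
`(e₁,e₂,e₃)` is the Jacobiator identity. -/
structure HomotopyRelationsReproduce (μ : Brackets (ExtSpace d M F V)) : Prop where
  rel_f : ∀ (k : ℕ) (h : Fin k → VectorFields d M) (f : Functions d M),
    IsVectorField
      (homotopyJacobi μ (k + 1) (Fin.append (fun _ => 1) ![-1])
        (Fin.append (fun j => inH (h j)) ![inF f]))
      (fun x => flatDeriv k (fun y => A.rho (A.D f) y - (1 / 2 : ℝ) • etaGrad f y) x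
        fun j => h j x)
  rel_ee : ∀ (k : ℕ) (h : Fin k → VectorFields d M) (e₁ e₂ : Sections d F V),
    IsVectorField
      (homotopyJacobi μ (k + 2) (Fin.append (fun _ => 1) ![0, 0])
        (Fin.append (fun j => inH (h j)) ![inE e₁, inE e₂]))
      (fun x => flatDeriv k
        (fun y => A.rho (A.bracket e₁ e₂) y - lie (A.rho e₁) (A.rho e₂) y + A.SCrho e₁ e₂ y) x
        fun j => h j x)
  rel_eee : ∀ e₁ e₂ e₃ : Sections d F V,
    homotopyJacobi μ 3 ![0, 0, 0] ![inE e₁, inE e₂, inE e₃] =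
      inE (A.D (A.calN e₁ e₂ e₃) - A.Jac e₁ e₂ e₃) -
        μ 4 ![muZero d M F V, inE e₁, inE e₂, inE e₃]
  rel_0ef : ∀ (k : ℕ) (h : Fin k → VectorFields d M) (e : Sections d F V) (f : Functions d M),
    IsVectorField
      (homotopyJacobi μ (k + 3) (Fin.append (fun _ => 1) ![2, 0, -1])
        (Fin.append (fun j => inH (h j)) ![muZero d M F V, inE e, inF f]))
      (fun x => flatDeriv k
        (fun y => A.rho (A.bracket e (A.D f) - A.D (A.pair e (A.D f))) y +
          (1 / 2 : ℝ) • etaGrad (A.pair e (A.D f)) y -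
          lie (A.rho e) (fun z => (1 / 2 : ℝ) • etaGrad f z) y + A.SCrho e (A.D f) y) x
        fun j => h j x)
  rel_0eee : ∀ (k : ℕ) (h : Fin k → VectorFields d M) (e₁ e₂ e₃ : Sections d F V),
    IsVectorField
      (homotopyJacobi μ (k + 4) (Fin.append (fun _ => 1) ![2, 0, 0, 0])
        (Fin.append (fun j => inH (h j)) ![muZero d M F V, inE e₁, inE e₂, inE e₃]))
      (fun x => flatDeriv k
        (fun y => A.rho (A.D (A.calN e₁ e₂ e₃) - A.Jac e₁ e₂ e₃) y -
          (1 / 2 : ℝ) • etaGrad (A.calN e₁ e₂ e₃) y -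
          (A.SCrho (A.bracket e₁ e₂) e₃ y + A.SCrho (A.bracket e₂ e₃) e₁ y +
            A.SCrho (A.bracket e₃ e₁) e₂ y) -
          (lie (A.SCrho e₁ e₂) (A.rho e₃) y + lie (A.SCrho e₂ e₃) (A.rho e₁) y +
            lie (A.SCrho e₃ e₁) (A.rho e₂) y)) x
        fun j => h j x)

/-- The characteristic identities of a DFT algebroid, and their derivatives of every order `k`
along vector fields. -/
structure SatisfiesIdentities : Prop where
  rho_D : ∀ (f : Functions d M) (x : M), A.rho (A.D f) x = (1 / 2 : ℝ) • etaGrad f x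
  rho_bracket : ∀ (e₁ e₂ : Sections d F V) (x : M),
    A.rho (A.bracket e₁ e₂) x - lie (A.rho e₁) (A.rho e₂) x = -A.SCrho e₁ e₂ x
  jacobiator : ∀ (e₁ e₂ e₃ : Sections d F V) (x : M),
    (A.Jac e₁ e₂ e₃ - A.D (A.calN e₁ e₂ e₃)) x = A.SCJac e₁ e₂ e₃ x
  rho_D_deriv : ∀ (k : ℕ) (f : Functions d M) (x : M)
    (w : Fin k → TangentSpace 𝓘(ℝ, DoubledSpace d) x),
    flatDeriv k (A.rho (A.D f)) x w = (1 / 2 : ℝ) • flatDeriv k (etaGrad f) x w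
  rho_bracket_deriv : ∀ (k : ℕ) (e₁ e₂ : Sections d F V) (x : M)
    (w : Fin k → TangentSpace 𝓘(ℝ, DoubledSpace d) x),
    flatDeriv k (A.rho (A.bracket e₁ e₂)) x w - flatDeriv k (lie (A.rho e₁) (A.rho e₂)) x w =
      -flatDeriv k (A.SCrho e₁ e₂) x w
  jacobiator_deriv : ∀ (k : ℕ) (e₁ e₂ e₃ : Sections d F V) (x : M)
    (w : Fin k → TangentSpace 𝓘(ℝ, DoubledSpace d) x),
    flatDeriv k (A.rho (A.Jac e₁ e₂ e₃)) x w - flatDeriv k (A.rho (A.D (A.calN e₁ e₂ e₃))) x w =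
      flatDeriv k (fun y => A.anchor y (A.SCJac e₁ e₂ e₃ y)) x w

end BracketBundle

end

set_option linter.unusedSectionVars false
set_option linter.unusedSimpArgs false

noncomputable section

/-! The proof separates an algebraic statement about brackets from a geometric statement about the
anchor.

Algebra. A `FlatCalculus` retains only functions, sections, vector fields, the maps `D`, `br`, `pr`,
`rho`, `grad`, `SC`, and the iterated flat derivative `pd hs v`. The last is multilinear and
symmetric in the directions and obeys the Leibniz rule `pd_leibniz`, in which each direction
differentiates either factor. Brackets with the listed values exist because any arguments can be
sorted into vector fields, copies of `μ_0`, sections and functions at the cost of a Koszul sign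
(`go`), the values on sorted arguments being `base`. They are unique because multilinearity and
graded antisymmetry reduce everything to sorted homogeneous arguments, where every value is either
listed or zero (`eq_of_eq_on_sorted`).

A homotopy expression is a sum over distributions of the arguments between an inner and an outer
bracket (`signedSplit`, `jacList`). For leading vector fields this is the sum on the right of the
Leibniz rule. Hence the terms with `pd (pd A u :: B) v` recombine to `pd hs` of a Lie bracket, and
the relations with vector fields inserted are derivatives of the relations without them. This gives
part (c) with no axiom. The empty inner bracket is `μ_0`, so brackets with one `μ_0` also enter the
relations without `μ_0`; several of them are exactly what makes such a relation hold.

If the calculus `IsCompatible`, that is `ρD = grad`, `ρ[[a,b]] = [ρa,ρb] - SC(a,b)` and axiom 3, all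
relations hold. With a vector field among the arguments, the value is a vector field, and counting
degrees leaves four types, settled by (c) and the Jacobi identity for `lie`. Without vector fields
the grading leaves finitely many types. These are algebraic consequences of axiom 3, the main one
being `t_eq`, which writes the bracket of `μ_0` with four sections in terms of `N` alone.

Geometry. Coordinate changes are affine, so derivatives of components transform as tensors and can
be computed in one chart (`rep_flatDeriv`); hence a doubled manifold has a flat calculus. Since
differentials at a point are arbitrary, axiom 1 forces `ρD = ½ η⁻¹d`. Then `ρ` is onto, by the rank
it is bijective on fibres, and the form is the pullback of `η` (`form_eq_eta`). By axiom 2 the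
defect `ρ[[a,b]] - [ρa,ρb] + SC(a,b)` is linear over functions and skew (`anchorDefect_fsmul`). The
sections `D g`, with `g` linear in the coordinates near a point, provide a frame with constant
anchor, on which the C-bracket condition says that the defect is zero. Conversely, a vanishing
defect and constant pairings give the flux formula. As the defect is the relation of two sections,
this proves (d).

For the Jacobiator, the relation for `μ_0` and three sections expresses `ρ(DN - Jac)` through `SC`;
the terms that differentiate the anchors along `SC` are `-ρ(SC_Jac)`, and the others cancel by
`cyclic_identity`. Injectivity of `ρ` then removes the anchor. -/

/-! ## Graded-antisymmetric functions of lists -/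

section OnLists

variable {X W : Type*} [AddCommGroup W]

/-- `w` on the empty list, zero otherwise. -/
def onNil : List X → W → W
  | [], w => w
  | _, _ => 0

@[simp] theorem onNil_nil (w : W) : onNil ([] : List X) w = w := rfl

@[simp] theorem onNil_cons (x : X) (l : List X) (w : W) : onNil (x :: l) w = 0 := rfl

/-- `T x` on the list `[x]`, zero otherwise. -/
def onOne : List X → (X → W) → W
  | [x], T => T x
  | _, _ => 0

/-- `T x y` on the list `[x, y]`, zero otherwise. -/
def onTwo : List X → (X → X → W) → W
  | [x, y], T => T x y
  | _, _ => 0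

/-- `T x y z` on the list `[x, y, z]`, zero otherwise. -/
def onThree : List X → (X → X → X → W) → W
  | [x, y, z], T => T x y z
  | _, _ => 0

/-- `T x y z u` on the list `[x, y, z, u]`, zero otherwise. -/
def onFour : List X → (X → X → X → X → W) → W
  | [x, y, z, u], T => T x y z u
  | _, _ => 0

theorem onNil_of_ne {l : List X} (h : l.length ≠ 0) (w : W) : onNil l w = 0 := by
  rcases l with _ | ⟨x, l⟩ <;> simp_all [onNil]

theorem onOne_of_ne {l : List X} (h : l.length ≠ 1) (T : X → W) : onOne l T = 0 := by
  rcases l with _ | ⟨x, _ | ⟨y, l⟩⟩ <;> simp_all [onOne]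

theorem onTwo_of_ne {l : List X} (h : l.length ≠ 2) (T : X → X → W) : onTwo l T = 0 := by
  rcases l with _ | ⟨x, _ | ⟨y, _ | ⟨z, l⟩⟩⟩ <;> simp_all [onTwo]

theorem onThree_of_ne {l : List X} (h : l.length ≠ 3) (T : X → X → X → W) : onThree l T = 0 := by
  rcases l with _ | ⟨x, _ | ⟨y, _ | ⟨z, _ | ⟨u, l⟩⟩⟩⟩ <;> simp_all [onThree]

theorem onFour_of_ne {l : List X} (h : l.length ≠ 4) (T : X → X → X → X → W) :
    onFour l T = 0 := by
  rcases l with _ | ⟨x, _ | ⟨y, _ | ⟨z, _ | ⟨u, _ | ⟨v, l⟩⟩⟩⟩⟩ <;> simp_all [onFour]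

end OnLists

/-! ### Multilinear functions of lists with an exchange sign, and sums over distributions. -/

section Lists

variable {X W : Type*} [AddCommGroup X] [Module ℝ X] [AddCommGroup W] [Module ℝ W]

/-- A function of lists is linear in every entry and is multiplied by `s` when two neighbouring
entries are exchanged. -/
structure IsSignedSymm (s : ℝ) (g : List X → W) : Prop where
  add : ∀ a b x y, g (a ++ (x + y) :: b) = g (a ++ x :: b) + g (a ++ y :: b)
  smul : ∀ a b (c : ℝ) x, g (a ++ (c • x) :: b) = c • g (a ++ x :: b)
  swap : ∀ a b x y, g (a ++ x :: y :: b) = s • g (a ++ y :: x :: b)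

namespace IsSignedSymm

variable {s : ℝ} {g g' : List X → W}

theorem zero (s : ℝ) : IsSignedSymm s (fun _ : List X => (0 : W)) :=
  ⟨by simp, by simp, by simp⟩

theorem fun_add (h : IsSignedSymm s g) (h' : IsSignedSymm s g') :
    IsSignedSymm s (fun l => g l + g' l) where
  add a b x y := by rw [h.add, h'.add]; abel
  smul a b c x := by rw [h.smul, h'.smul, smul_add]
  swap a b x y := by rw [h.swap, h'.swap, smul_add]

/-- None of the three operations changes the length of the list, so the coefficient may depend on
it. The signs in `go` depend on how many arguments have already been collected. -/
theorem length_smul (c : ℕ → ℝ) (h : IsSignedSymm s g) :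
    IsSignedSymm s (fun l => c l.length • g l) where
  add a b x y := by rw [h.add]; simp
  smul a b r x := by rw [h.smul, smul_comm]; simp
  swap a b x y := by rw [h.swap, smul_comm]; simp

theorem const_smul (c : ℝ) (h : IsSignedSymm s g) : IsSignedSymm s (fun l => c • g l) :=
  h.length_smul fun _ => c

theorem append (z : List X) (h : IsSignedSymm s g) : IsSignedSymm s (fun l => g (l ++ z)) where
  add a b x y := by simp [h.add]
  smul a b r x := by simp [h.smul]
  swap a b x y := by simp [h.swap a (b ++ z) x y]

theorem snoc_add (h : IsSignedSymm s g) (a : List X) (x y : X) :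
    g (a ++ [x + y]) = g (a ++ [x]) + g (a ++ [y]) := h.add a [] x y

theorem snoc_smul (h : IsSignedSymm s g) (a : List X) (c : ℝ) (x : X) :
    g (a ++ [c • x]) = c • g (a ++ [x]) := h.smul a [] c x

theorem snoc_zero (h : IsSignedSymm s g) (a : List X) : g (a ++ [0]) = 0 := by
  simpa using h.snoc_smul a 0 0

end IsSignedSymm

@[simp] theorem onNil_zero (l : List X) : onNil l (0 : W) = 0 := by
  rcases l with _ | ⟨x, l⟩ <;> simp [onNil]

@[simp] theorem onTwo_zero (l : List X) : onTwo l (fun _ _ => (0 : W)) = 0 := by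
  rcases l with _ | ⟨x, _ | ⟨y, _ | ⟨z, l⟩⟩⟩ <;> simp [onTwo]

theorem onOne_add (l : List X) (T T' : X → W) :
    onOne l (fun x => T x + T' x) = onOne l T + onOne l T' := by
  rcases l with _ | ⟨x, _ | ⟨y, l⟩⟩ <;> simp [onOne]

theorem onOne_smul (l : List X) (c : ℝ) (T : X → W) :
    onOne l (fun x => c • T x) = c • onOne l T := by
  rcases l with _ | ⟨x, _ | ⟨y, l⟩⟩ <;> simp [onOne]

theorem isSignedSymm_onNil (s : ℝ) (w : W) : IsSignedSymm s (fun l : List X => onNil l w) := by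
  constructor <;> intros <;> simp [onNil_of_ne]

theorem isSignedSymm_onOne (s : ℝ) {T : X → W} (ha : ∀ x y, T (x + y) = T x + T y)
    (hc : ∀ (c : ℝ) x, T (c • x) = c • T x) : IsSignedSymm s (fun l => onOne l T) := by
  constructor
  · rintro (_ | ⟨a, as⟩) (_ | ⟨b, bs⟩) x y <;> simp [onOne_of_ne, onOne, ha]
  · rintro (_ | ⟨a, as⟩) (_ | ⟨b, bs⟩) c x <;> simp [onOne_of_ne, onOne, hc]
  · intros; rw [onOne_of_ne (by simp only [List.length_append, List.length_cons, List.length_nil]; omega),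
      onOne_of_ne (by simp only [List.length_append, List.length_cons, List.length_nil]; omega), smul_zero]

/-- Linearity is asked in the first slot only; exchanging the entries carries it to the other one.
The versions for three and four entries work in the same way. -/
theorem isSignedSymm_onTwo {s : ℝ} (hs : s * s = 1) {T : X → X → W}
    (ha : ∀ x y z, T (x + y) z = T x z + T y z) (hc : ∀ (c : ℝ) x z, T (c • x) z = c • T x z)
    (hsw : ∀ x y, T x y = s • T y x) : IsSignedSymm s (fun l => onTwo l T) := by
  have ha' : ∀ x y z, T z (x + y) = T z x + T z y := fun x y z => by
    rw [hsw, ha, smul_add, ← hsw, ← hsw]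
  have hc' : ∀ (c : ℝ) x z, T z (c • x) = c • T z x := fun c x z => by
    rw [hsw, hc, smul_comm, ← hsw]
  constructor
  · rintro (_ | ⟨a, _ | ⟨a', as⟩⟩) (_ | ⟨b, _ | ⟨b', bs⟩⟩) x y <;> simp [onTwo_of_ne, onTwo, ha, ha']
  · rintro (_ | ⟨a, _ | ⟨a', as⟩⟩) (_ | ⟨b, _ | ⟨b', bs⟩⟩) c x <;> simp [onTwo_of_ne, onTwo, hc, hc']
  · rintro (_ | ⟨a, as⟩) (_ | ⟨b, bs⟩) x y <;>
      first
      | exact hsw _ _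
      | rw [onTwo_of_ne (by simp only [List.length_append, List.length_cons, List.length_nil]; omega),
          onTwo_of_ne (by simp only [List.length_append, List.length_cons, List.length_nil]; omega), smul_zero]

theorem isSignedSymm_onThree {s : ℝ} (hs : s * s = 1) {T : X → X → X → W}
    (ha : ∀ x y z u, T (x + y) z u = T x z u + T y z u)
    (hc : ∀ (c : ℝ) x z u, T (c • x) z u = c • T x z u)
    (h1 : ∀ x y z, T x y z = s • T y x z) (h2 : ∀ x y z, T x y z = s • T x z y) :
    IsSignedSymm s (fun l => onThree l T) := by
  have ha' : ∀ x y z u, T z (x + y) u = T z x u + T z y u := fun x y z u => by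
    rw [h1, ha, smul_add, ← h1, ← h1]
  have hc' : ∀ (c : ℝ) x z u, T z (c • x) u = c • T z x u := fun c x z u => by
    rw [h1, hc, smul_comm, ← h1]
  have ha'' : ∀ x y z u, T z u (x + y) = T z u x + T z u y := fun x y z u => by
    rw [h2, ha', smul_add, ← h2, ← h2]
  have hc'' : ∀ (c : ℝ) x z u, T z u (c • x) = c • T z u x := fun c x z u => by
    rw [h2, hc', smul_comm, ← h2]
  constructor
  · rintro (_ | ⟨a, _ | ⟨a', _ | ⟨a'', as⟩⟩⟩) (_ | ⟨b, _ | ⟨b', _ | ⟨b'', bs⟩⟩⟩) x y <;>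
      simp [onThree_of_ne, onThree, ha, ha', ha'']
  · rintro (_ | ⟨a, _ | ⟨a', _ | ⟨a'', as⟩⟩⟩) (_ | ⟨b, _ | ⟨b', _ | ⟨b'', bs⟩⟩⟩) c x <;>
      simp [onThree_of_ne, onThree, hc, hc', hc'']
  · rintro (_ | ⟨a, _ | ⟨a', as⟩⟩) (_ | ⟨b, _ | ⟨b', bs⟩⟩) x y <;>
      first
      | exact h1 _ _ _
      | exact h2 _ _ _
      | rw [onThree_of_ne (by simp only [List.length_append, List.length_cons, List.length_nil]; omega),
          onThree_of_ne (by simp only [List.length_append, List.length_cons, List.length_nil]; omega), smul_zero]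

theorem isSignedSymm_onFour {s : ℝ} (hs : s * s = 1) {T : X → X → X → X → W}
    (ha : ∀ x y z u v, T (x + y) z u v = T x z u v + T y z u v)
    (hc : ∀ (c : ℝ) x z u v, T (c • x) z u v = c • T x z u v)
    (h1 : ∀ x y z u, T x y z u = s • T y x z u) (h2 : ∀ x y z u, T x y z u = s • T x z y u)
    (h3 : ∀ x y z u, T x y z u = s • T x y u z) :
    IsSignedSymm s (fun l => onFour l T) := by
  have ha1 : ∀ x y z u v, T z (x + y) u v = T z x u v + T z y u v := fun x y z u v => by
    rw [h1, ha, smul_add, ← h1, ← h1]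
  have hc1 : ∀ (c : ℝ) x z u v, T z (c • x) u v = c • T z x u v := fun c x z u v => by
    rw [h1, hc, smul_comm, ← h1]
  have ha2 : ∀ x y z u v, T z u (x + y) v = T z u x v + T z u y v := fun x y z u v => by
    rw [h2, ha1, smul_add, ← h2, ← h2]
  have hc2 : ∀ (c : ℝ) x z u v, T z u (c • x) v = c • T z u x v := fun c x z u v => by
    rw [h2, hc1, smul_comm, ← h2]
  have ha3 : ∀ x y z u v, T z u v (x + y) = T z u v x + T z u v y := fun x y z u v => by
    rw [h3, ha2, smul_add, ← h3, ← h3]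
  have hc3 : ∀ (c : ℝ) x z u v, T z u v (c • x) = c • T z u v x := fun c x z u v => by
    rw [h3, hc2, smul_comm, ← h3]
  constructor
  · rintro (_ | ⟨a, _ | ⟨a', _ | ⟨a'', _ | ⟨a3, as⟩⟩⟩⟩)
      (_ | ⟨b, _ | ⟨b', _ | ⟨b'', _ | ⟨b3, bs⟩⟩⟩⟩) x y <;>
      simp [onFour_of_ne, onFour, ha, ha1, ha2, ha3]
  · rintro (_ | ⟨a, _ | ⟨a', _ | ⟨a'', _ | ⟨a3, as⟩⟩⟩⟩)
      (_ | ⟨b, _ | ⟨b', _ | ⟨b'', _ | ⟨b3, bs⟩⟩⟩⟩) c x <;>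
      simp [onFour_of_ne, onFour, hc, hc1, hc2, hc3]
  · rintro (_ | ⟨a, _ | ⟨a', _ | ⟨a'', as⟩⟩⟩) (_ | ⟨b, _ | ⟨b', _ | ⟨b'', bs⟩⟩⟩) x y <;>
      first
      | exact h1 _ _ _ _
      | exact h2 _ _ _ _
      | exact h3 _ _ _ _
      | rw [onFour_of_ne (by simp only [List.length_append, List.length_cons, List.length_nil]; omega),
          onFour_of_ne (by simp only [List.length_append, List.length_cons, List.length_nil]; omega), smul_zero]

/-- Sum of `G A' B'` over all ways of distributing the entries of a list, in order, over the ends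
of `A` and `B`. -/
def splitSum {Y : Type*} (G : List Y → List Y → W) : List Y → List Y → List Y → W
  | A, B, [] => G A B
  | A, B, x :: xs => splitSum G (A ++ [x]) B xs + splitSum G A (B ++ [x]) xs

theorem splitSum_add {Y : Type*} (G G' : List Y → List Y → W) (A B l : List Y) :
    splitSum (fun A B => G A B + G' A B) A B l = splitSum G A B l + splitSum G' A B l := by
  induction l generalizing A B with
  | nil => rfl
  | cons x l ih => simp only [splitSum, ih]; abel

theorem splitSum_smul {Y : Type*} (c : ℝ) (G : List Y → List Y → W) (A B l : List Y) :
    splitSum (fun A B => c • G A B) A B l = c • splitSum G A B l := by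
  induction l generalizing A B with
  | nil => rfl
  | cons x l ih => simp only [splitSum, ih, smul_add]

theorem splitSum_eq_zero {Y : Type*} {G : List Y → List Y → W} (h : ∀ A B, A ≠ [] → G A B = 0)
    {A : List Y} (hA : A ≠ []) (B l : List Y) : splitSum G A B l = 0 := by
  induction l generalizing A B with
  | nil => exact h A B hA
  | cons x l ih => simp [splitSum, ih (A := A ++ [x]) (by simp), ih hA]

/-- Of all distributions only the one sending every entry to the right survives. It is used for the
terms whose inner bracket admits no vector field. -/
theorem splitSum_of_left {Y : Type*} {G : List Y → List Y → W} (h : ∀ A B, A ≠ [] → G A B = 0)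
    (B l : List Y) : splitSum G [] B l = G [] (B ++ l) := by
  induction l generalizing B with
  | nil => simp [splitSum]
  | cons x l ih => simp [splitSum, ih, splitSum_eq_zero h]

theorem splitSum_map {W' : Type*} [AddCommGroup W'] {Y : Type*} (φ : W →+ W')
    (G : List Y → List Y → W) (A B l : List Y) :
    splitSum (fun A B => φ (G A B)) A B l = φ (splitSum G A B l) := by
  induction l generalizing A B with
  | nil => rfl
  | cons x l ih => simp only [splitSum, ih, map_add]

end Lists

/-! ## The extended algebra of a flat calculus -/

/-- The algebraic structure of functions, sections and vector fields in flat coordinates: `pd hs v`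
is the iterated derivative `h_1 ⋯ h_k ∂_1 ⋯ ∂_k v` of the components of `v`, `grad` stands for
`½ η^{-1} d` and `SC` for the failure of the anchor to be a morphism of brackets. -/
structure FlatCalculus (𝓕 𝓔 𝓗 : Type*) [AddCommGroup 𝓕] [Module ℝ 𝓕] [AddCommGroup 𝓔]
    [Module ℝ 𝓔] [AddCommGroup 𝓗] [Module ℝ 𝓗] where
  pd : List 𝓗 → 𝓗 →ₗ[ℝ] 𝓗
  pd_nil : ∀ v, pd [] v = v
  pd_symm : ∀ v, IsSignedSymm 1 (fun hs => pd hs v)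
  -- The entries of `hs` enter through their components and are not differentiated themselves; each
  -- of them differentiates either the components of `u` or those of `v`.
  pd_leibniz : ∀ hs u v, pd hs (pd [u] v) =
    splitSum (fun A B => pd (pd A u :: B) v) [] [] hs
  D : 𝓕 →ₗ[ℝ] 𝓔
  br : 𝓔 →ₗ[ℝ] 𝓔 →ₗ[ℝ] 𝓔
  br_skew : ∀ a b, br a b = -br b a
  pr : 𝓔 →ₗ[ℝ] 𝓔 →ₗ[ℝ] 𝓕
  pr_symm : ∀ a b, pr a b = pr b a
  rho : 𝓔 →ₗ[ℝ] 𝓗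
  grad : 𝓕 →ₗ[ℝ] 𝓗
  SC : 𝓔 →ₗ[ℝ] 𝓔 →ₗ[ℝ] 𝓗
  SC_skew : ∀ a b, SC a b = -SC b a

namespace FlatCalculus

variable {𝓕 𝓔 𝓗 : Type*} [AddCommGroup 𝓕] [Module ℝ 𝓕] [AddCommGroup 𝓔]
    [Module ℝ 𝓔] [AddCommGroup 𝓗] [Module ℝ 𝓗] (Q : FlatCalculus 𝓕 𝓔 𝓗)

/-- `⅓ ⟨[[a,b]],c⟩ + cyclic` -/
def N (a b c : 𝓔) : 𝓕 :=
  (1 / 3 : ℝ) • (Q.pr (Q.br a b) c + Q.pr (Q.br b c) a + Q.pr (Q.br c a) b)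

/-- `[[[[a,b]],c]] + cyclic` -/
def jac (a b c : 𝓔) : 𝓔 := Q.br (Q.br a b) c + Q.br (Q.br b c) a + Q.br (Q.br c a) b

/-- The bracket with one `μ_0` and three sections. -/
def s (a b c : 𝓔) : 𝓔 := Q.D (Q.N a b c) - Q.jac a b c

/-- The bracket with one `μ_0`, a section and a function. -/
def q (a : 𝓔) (f : 𝓕) : 𝓔 := Q.br a (Q.D f) - Q.D (Q.pr a (Q.D f))

/-- The bracket with one `μ_0` and two functions. -/
def r (f g : 𝓕) : 𝓕 := (2 : ℝ) • Q.pr (Q.D f) (Q.D g)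

/-- The bracket with one `μ_0` and four sections. -/
def t (a b c e : 𝓔) : 𝓕 :=
  (1 / 2 : ℝ) • (Q.pr (Q.s a b c) e - Q.pr (Q.s a b e) c + Q.pr (Q.s a c e) b - Q.pr (Q.s b c e) a)

theorem N_add (a a' b c : 𝓔) : Q.N (a + a') b c = Q.N a b c + Q.N a' b c := by
  simp only [N, map_add, LinearMap.add_apply]; module

theorem N_smul (x : ℝ) (a b c : 𝓔) : Q.N (x • a) b c = x • Q.N a b c := by
  simp only [N, map_smul, LinearMap.smul_apply]; module

theorem N_swap_left (a b c : 𝓔) : Q.N a b c = -Q.N b a c := by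
  simp only [N, Q.br_skew b a, Q.br_skew a c, Q.br_skew c b, map_neg, LinearMap.neg_apply]; module

theorem N_swap_right (a b c : 𝓔) : Q.N a b c = -Q.N a c b := by
  simp only [N, Q.br_skew b a, Q.br_skew a c, Q.br_skew c b, map_neg, LinearMap.neg_apply]; module

theorem jac_add (a a' b c : 𝓔) : Q.jac (a + a') b c = Q.jac a b c + Q.jac a' b c := by
  simp only [jac, map_add, LinearMap.add_apply]; module

theorem jac_smul (x : ℝ) (a b c : 𝓔) : Q.jac (x • a) b c = x • Q.jac a b c := by
  simp only [jac, map_smul, LinearMap.smul_apply]; module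

theorem jac_swap_left (a b c : 𝓔) : Q.jac a b c = -Q.jac b a c := by
  simp only [jac, Q.br_skew b a, Q.br_skew a c, Q.br_skew c b, map_neg, LinearMap.neg_apply]
  module

theorem jac_swap_right (a b c : 𝓔) : Q.jac a b c = -Q.jac a c b := by
  simp only [jac, Q.br_skew b a, Q.br_skew a c, Q.br_skew c b, map_neg, LinearMap.neg_apply]
  module

theorem s_add (a a' b c : 𝓔) : Q.s (a + a') b c = Q.s a b c + Q.s a' b c := by
  simp only [s, N_add, jac_add, map_add]; module

theorem s_smul (x : ℝ) (a b c : 𝓔) : Q.s (x • a) b c = x • Q.s a b c := by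
  simp only [s, N_smul, jac_smul, map_smul]; module

theorem s_swap_left (a b c : 𝓔) : Q.s a b c = -Q.s b a c := by
  simp only [s, Q.N_swap_left a, Q.jac_swap_left a, map_neg]; module

theorem s_swap_right (a b c : 𝓔) : Q.s a b c = -Q.s a c b := by
  simp only [s, Q.N_swap_right a b, Q.jac_swap_right a b, map_neg]; module

theorem t_add (a a' b c e : 𝓔) : Q.t (a + a') b c e = Q.t a b c e + Q.t a' b c e := by
  simp only [t, s_add, map_add, LinearMap.add_apply]; module

theorem t_smul (x : ℝ) (a b c e : 𝓔) : Q.t (x • a) b c e = x • Q.t a b c e := by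
  simp only [t, s_smul, map_smul, LinearMap.smul_apply]; module

theorem t_swap_left (a b c e : 𝓔) : Q.t a b c e = -Q.t b a c e := by
  simp only [t, Q.s_swap_left b a, map_neg, LinearMap.neg_apply]; module

theorem t_swap_mid (a b c e : 𝓔) : Q.t a b c e = -Q.t a c b e := by
  simp only [t, Q.s_swap_right a c b, Q.s_swap_left c b e, map_neg, LinearMap.neg_apply]; module

theorem t_swap_right (a b c e : 𝓔) : Q.t a b c e = -Q.t a b e c := by
  simp only [t, Q.s_swap_right a e c, Q.s_swap_right b e c, map_neg, LinearMap.neg_apply]; module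

/-- The value of the brackets on `h_1, …, h_k`, then `n` copies of `μ_0`, then sections, then
functions. -/
def base (hs : List 𝓗) (n : ℕ) (es : List 𝓔) (fs : List 𝓕) : 𝓕 × 𝓔 × 𝓗 × ℝ :=
  match n with
  | 0 => onNil hs (onNil es (onNil fs (0, 0, 0, 1))) +
      onNil hs (onNil es (onOne fs fun f => (0, Q.D f, 0, 0))) +
      onNil hs (onTwo es fun a b => onNil fs (0, Q.br a b, 0, 0)) +
      onNil hs (onOne es fun a => onOne fs fun f => (Q.pr a (Q.D f), 0, 0, 0)) +
      onNil hs (onThree es fun a b c => onNil fs (Q.N a b c, 0, 0, 0)) +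
      onOne es (fun a => onNil fs (0, 0, Q.pd hs (Q.rho a), 0))
  | 1 => onNil hs (onOne es fun a => onOne fs fun f => (0, Q.q a f, 0, 0)) +
      onNil hs (onNil es (onTwo fs fun f g => (Q.r f g, 0, 0, 0))) +
      onNil hs (onThree es fun a b c => onNil fs (0, Q.s a b c, 0, 0)) +
      onNil hs (onFour es fun a b c e => onNil fs (Q.t a b c e, 0, 0, 0)) +
      onNil es (onOne fs fun f => (0, 0, Q.pd hs (Q.grad f), 0)) +
      onTwo es (fun a b => onNil fs (0, 0, Q.pd hs (Q.SC a b), 0))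
  | _ => 0

theorem base_of_two_le (hs : List 𝓗) {n : ℕ} (hn : 2 ≤ n) (es : List 𝓔) (fs : List 𝓕) :
    Q.base hs n es fs = 0 := by
  obtain ⟨m, rfl⟩ := Nat.exists_eq_add_of_le' hn
  rfl

theorem isSignedSymm_inH {v : 𝓗} :
    IsSignedSymm 1 (fun hs => ((0, 0, Q.pd hs v, 0) : 𝓕 × 𝓔 × 𝓗 × ℝ)) where
  add a b x y := by rw [(Q.pd_symm v).add]; simp
  smul a b c x := by rw [(Q.pd_symm v).smul]; simp
  swap a b x y := by rw [(Q.pd_symm v).swap]; simp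

/-- Vector fields and functions are odd, so exchanging two of them gives no sign, whereas sections
are even and anticommute; this explains the signs here and in `base_e`, `base_f`. For vector fields
the statement is the symmetry of iterated flat derivatives, all other summands requiring an empty
list of vector fields. -/
theorem base_h (n : ℕ) (es : List 𝓔) (fs : List 𝓕) :
    IsSignedSymm 1 (fun hs => Q.base hs n es fs) := by
  match n with
  | 0 =>
    refine .fun_add (.fun_add (.fun_add (.fun_add (.fun_add ?_ ?_) ?_) ?_) ?_) ?_
    any_goals exact isSignedSymm_onNil _ _
    rcases es with _ | ⟨a, _ | ⟨b, l⟩⟩ <;> rcases fs with _ | ⟨f, fs⟩ <;> simp only [onOne, onNil]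
    any_goals exact IsSignedSymm.zero _
    exact Q.isSignedSymm_inH
  | 1 =>
    refine .fun_add (.fun_add (.fun_add (.fun_add (.fun_add ?_ ?_) ?_) ?_) ?_) ?_
    any_goals exact isSignedSymm_onNil _ _
    · rcases fs with _ | ⟨a, _ | ⟨b, l⟩⟩ <;> rcases es with _ | ⟨f, fs⟩ <;>
        simp only [onOne, onNil]
      any_goals exact IsSignedSymm.zero _
      exact Q.isSignedSymm_inH
    · rcases es with _ | ⟨a, _ | ⟨b, _ | ⟨c, l⟩⟩⟩ <;> rcases fs with _ | ⟨f, fs⟩ <;>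
        simp only [onTwo, onNil]
      any_goals exact IsSignedSymm.zero _
      exact Q.isSignedSymm_inH
  | n + 2 => exact IsSignedSymm.zero _

theorem isSignedSymm_onNil_left {X Y W : Type*} [AddCommGroup X] [Module ℝ X] [AddCommGroup Y]
    [Module ℝ Y] [AddCommGroup W] [Module ℝ W] {s : ℝ} {g : List X → W} (l : List Y)
    (h : IsSignedSymm s g) : IsSignedSymm s (fun x => onNil l (g x)) := by
  rcases l with _ | ⟨y, l⟩
  · exact h
  · exact IsSignedSymm.zero _

theorem base_e (hs : List 𝓗) (n : ℕ) (fs : List 𝓕) :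
    IsSignedSymm (-1) (fun es => Q.base hs n es fs) := by
  match n with
  | 0 =>
    refine .fun_add (.fun_add (.fun_add (.fun_add (.fun_add ?_ ?_) ?_) ?_) ?_) ?_
    any_goals apply isSignedSymm_onNil_left
    any_goals exact isSignedSymm_onNil _ _
    · rcases fs with _ | ⟨f, fs⟩ <;> simp only [onNil, onTwo_zero]
      · refine isSignedSymm_onTwo (by norm_num) ?_ ?_ ?_
        · simp
        · simp
        · intro a b; rw [Q.br_skew]; simp
      · exact IsSignedSymm.zero _
    · refine isSignedSymm_onOne _ ?_ ?_
      · intro a b; rw [← onOne_add]; simp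
      · intro a b; rw [← onOne_smul]; simp
    · rcases fs with _ | ⟨f, fs⟩ <;> simp only [onNil]
      · refine isSignedSymm_onThree (by norm_num) ?_ ?_ ?_ ?_
        · simp [N_add]
        · simp [N_smul]
        · intro a b c; rw [Q.N_swap_left]; simp
        · intro a b c; rw [Q.N_swap_right]; simp
      · exact isSignedSymm_onThree (by norm_num) (by simp) (by simp) (by simp) (by simp)
    · rcases fs with _ | ⟨f, fs⟩ <;> simp only [onNil]
      · exact isSignedSymm_onOne _ (by simp) (by simp)
      · exact isSignedSymm_onOne _ (by simp) (by simp)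
  | 1 =>
    refine .fun_add (.fun_add (.fun_add (.fun_add (.fun_add ?_ ?_) ?_) ?_) ?_) ?_
    any_goals apply isSignedSymm_onNil_left
    any_goals exact isSignedSymm_onNil _ _
    · refine isSignedSymm_onOne _ ?_ ?_
      · intro a b; rw [← onOne_add]; congr; funext f; simp [q]; abel
      · intro a b; rw [← onOne_smul]; congr; funext f; simp [q, smul_sub]
    · rcases fs with _ | ⟨f, fs⟩ <;> simp only [onNil]
      · refine isSignedSymm_onThree (by norm_num) ?_ ?_ ?_ ?_
        · simp [s_add]
        · simp [s_smul]
        · intro a b c; rw [Q.s_swap_left]; simp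
        · intro a b c; rw [Q.s_swap_right]; simp
      · exact isSignedSymm_onThree (by norm_num) (by simp) (by simp) (by simp) (by simp)
    · rcases fs with _ | ⟨f, fs⟩ <;> simp only [onNil]
      · refine isSignedSymm_onFour (by norm_num) ?_ ?_ ?_ ?_ ?_
        · simp [t_add]
        · simp [t_smul]
        · intro a b c e; rw [Q.t_swap_left]; simp
        · intro a b c e; rw [Q.t_swap_mid]; simp
        · intro a b c e; rw [Q.t_swap_right]; simp
      · exact isSignedSymm_onFour (by norm_num) (by simp) (by simp) (by simp) (by simp) (by simp)
    · rcases fs with _ | ⟨f, fs⟩ <;> simp only [onNil]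
      · refine isSignedSymm_onTwo (by norm_num) ?_ ?_ ?_
        · simp
        · simp
        · intro a b; rw [Q.SC_skew]; simp
      · exact isSignedSymm_onTwo (by norm_num) (by simp) (by simp) (by simp)
  | n + 2 => exact IsSignedSymm.zero _

theorem isSignedSymm_onOne_left {X Y W : Type*} [AddCommGroup X] [Module ℝ X] [AddCommGroup Y]
    [Module ℝ Y] [AddCommGroup W] [Module ℝ W] {s : ℝ} {g : Y → List X → W} (l : List Y)
    (h : ∀ y, IsSignedSymm s (g y)) : IsSignedSymm s (fun x => onOne l fun y => g y x) := by
  rcases l with _ | ⟨y, _ | ⟨z, l⟩⟩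
  · exact IsSignedSymm.zero _
  · exact h y
  · exact IsSignedSymm.zero _

theorem base_f (hs : List 𝓗) (n : ℕ) (es : List 𝓔) :
    IsSignedSymm 1 (fun fs => Q.base hs n es fs) := by
  match n with
  | 0 =>
    refine .fun_add (.fun_add (.fun_add (.fun_add (.fun_add ?_ ?_) ?_) ?_) ?_) ?_
    all_goals try apply isSignedSymm_onNil_left
    all_goals try apply isSignedSymm_onNil_left
    all_goals try exact isSignedSymm_onNil _ _
    · exact isSignedSymm_onOne _ (by simp) (by simp)
    · rcases es with _ | ⟨a, _ | ⟨b, _ | ⟨c, l⟩⟩⟩ <;> simp only [onTwo]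
      any_goals exact IsSignedSymm.zero _
      exact isSignedSymm_onNil _ _
    · exact isSignedSymm_onOne_left _ fun a => isSignedSymm_onOne _ (by simp) (by simp)
    · rcases es with _ | ⟨a, _ | ⟨b, _ | ⟨c, _ | ⟨e, l⟩⟩⟩⟩ <;> simp only [onThree]
      any_goals exact IsSignedSymm.zero _
      exact isSignedSymm_onNil _ _
    · exact isSignedSymm_onOne_left _ fun a => isSignedSymm_onNil _ _
  | 1 =>
    refine .fun_add (.fun_add (.fun_add (.fun_add (.fun_add ?_ ?_) ?_) ?_) ?_) ?_
    any_goals apply isSignedSymm_onNil_left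
    any_goals apply isSignedSymm_onNil_left
    · refine isSignedSymm_onOne_left _ fun a => isSignedSymm_onOne _ ?_ ?_
      · intro f g; simp [q]; abel
      · intro f g; simp [q, smul_sub]
    · refine isSignedSymm_onTwo (by norm_num) ?_ ?_ ?_
      · simp [r]
      · intro c f g; simp [r, mul_comm, smul_smul]
      · intro f g; simp [r, Q.pr_symm (Q.D f)]
    · rcases es with _ | ⟨a, _ | ⟨b, _ | ⟨c, _ | ⟨e, l⟩⟩⟩⟩ <;> simp only [onThree]
      any_goals exact IsSignedSymm.zero _
      exact isSignedSymm_onNil _ _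
    · rcases es with _ | ⟨a, _ | ⟨b, _ | ⟨c, _ | ⟨e, _ | ⟨e', l⟩⟩⟩⟩⟩ <;> simp only [onFour]
      any_goals exact IsSignedSymm.zero _
      exact isSignedSymm_onNil _ _
    · exact isSignedSymm_onOne _ (by simp) (by simp)
    · rcases es with _ | ⟨a, _ | ⟨b, _ | ⟨c, l⟩⟩⟩ <;> simp only [onTwo]
      any_goals exact IsSignedSymm.zero _
      exact isSignedSymm_onNil _ _
  | n + 2 => exact IsSignedSymm.zero _

end FlatCalculus

/-- A homogeneous element of `𝓕 ⊕ 𝓔 ⊕ 𝓗 ⊕ ℝ` together with its type. -/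
inductive Arg (𝓕 𝓔 𝓗 : Type*) where
  | f (x : 𝓕)
  | e (x : 𝓔)
  | h (x : 𝓗)
  | z (r : ℝ)

namespace Arg

variable {𝓕 𝓔 𝓗 : Type*} [AddCommGroup 𝓕] [Module ℝ 𝓕] [AddCommGroup 𝓔]
    [Module ℝ 𝓔] [AddCommGroup 𝓗] [Module ℝ 𝓗]

/-- The underlying element. -/
def val : Arg 𝓕 𝓔 𝓗 → 𝓕 × 𝓔 × 𝓗 × ℝ
  | f x => (x, 0, 0, 0)
  | e x => (0, x, 0, 0)
  | h x => (0, 0, x, 0)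
  | z r => (0, 0, 0, r)

/-- The degree. -/
def deg : Arg 𝓕 𝓔 𝓗 → ℤ
  | f _ => -1
  | e _ => 0
  | h _ => 1
  | z _ => 2

@[simp] theorem deg_f (x : 𝓕) : (f x : Arg 𝓕 𝓔 𝓗).deg = -1 := rfl
@[simp] theorem deg_e (x : 𝓔) : (e x : Arg 𝓕 𝓔 𝓗).deg = 0 := rfl
@[simp] theorem deg_h (x : 𝓗) : (h x : Arg 𝓕 𝓔 𝓗).deg = 1 := rfl
@[simp] theorem deg_z (x : ℝ) : (z x : Arg 𝓕 𝓔 𝓗).deg = 2 := rfl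

/-- The sign of the exchange of two arguments. -/
def sgn (x y : Arg 𝓕 𝓔 𝓗) : ℝ := (-1 : ℝ) ^ (x.deg * y.deg + 1)

theorem sgn_comm (x y : Arg 𝓕 𝓔 𝓗) : sgn x y = sgn y x := by rw [sgn, mul_comm, sgn]

section

variable (a a' : 𝓕) (b b' : 𝓔) (c c' : 𝓗) (r r' : ℝ)

@[simp] theorem sgn_ff : sgn (f a : Arg 𝓕 𝓔 𝓗) (f a') = 1 := by norm_num [sgn, deg]
@[simp] theorem sgn_fe : sgn (f a : Arg 𝓕 𝓔 𝓗) (e b) = -1 := by norm_num [sgn, deg]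
@[simp] theorem sgn_fh : sgn (f a : Arg 𝓕 𝓔 𝓗) (h c) = 1 := by norm_num [sgn, deg]
@[simp] theorem sgn_fz : sgn (f a : Arg 𝓕 𝓔 𝓗) (z r) = -1 := by norm_num [sgn, deg]
@[simp] theorem sgn_ef : sgn (e b : Arg 𝓕 𝓔 𝓗) (f a) = -1 := by norm_num [sgn, deg]
@[simp] theorem sgn_ee : sgn (e b : Arg 𝓕 𝓔 𝓗) (e b') = -1 := by norm_num [sgn, deg]
@[simp] theorem sgn_eh : sgn (e b : Arg 𝓕 𝓔 𝓗) (h c) = -1 := by norm_num [sgn, deg]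
@[simp] theorem sgn_ez : sgn (e b : Arg 𝓕 𝓔 𝓗) (z r) = -1 := by norm_num [sgn, deg]
@[simp] theorem sgn_hf : sgn (h c : Arg 𝓕 𝓔 𝓗) (f a) = 1 := by norm_num [sgn, deg]
@[simp] theorem sgn_he : sgn (h c : Arg 𝓕 𝓔 𝓗) (e b) = -1 := by norm_num [sgn, deg]
@[simp] theorem sgn_hh : sgn (h c : Arg 𝓕 𝓔 𝓗) (h c') = 1 := by norm_num [sgn, deg]
@[simp] theorem sgn_hz : sgn (h c : Arg 𝓕 𝓔 𝓗) (z r) = -1 := by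
  norm_num [sgn, deg, show (2 : ℤ) + 1 = 3 from rfl]
@[simp] theorem sgn_zf : sgn (z r : Arg 𝓕 𝓔 𝓗) (f a) = -1 := by norm_num [sgn, deg]
@[simp] theorem sgn_ze : sgn (z r : Arg 𝓕 𝓔 𝓗) (e b) = -1 := by norm_num [sgn, deg]
@[simp] theorem sgn_zh : sgn (z r : Arg 𝓕 𝓔 𝓗) (h c) = -1 := by norm_num [sgn, deg]
@[simp] theorem sgn_zz : sgn (z r : Arg 𝓕 𝓔 𝓗) (z r') = -1 := by norm_num [sgn, deg]

end

end Arg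

/-! ### The grading in degrees -1 to 2. -/

section Graded

variable (𝓕 𝓔 𝓗 : Type*) [AddCommGroup 𝓕] [Module ℝ 𝓕] [AddCommGroup 𝓔]
    [Module ℝ 𝓔] [AddCommGroup 𝓗] [Module ℝ 𝓗]

/-- The grading of `𝓕 ⊕ 𝓔 ⊕ 𝓗 ⊕ ℝ` in degrees `-1, 0, 1, 2`. -/
def gradedPart (k : ℤ) : Submodule ℝ (𝓕 × 𝓔 × 𝓗 × ℝ) where
  carrier := {l | (k ≠ -1 → l.1 = 0) ∧ (k ≠ 0 → l.2.1 = 0) ∧ (k ≠ 1 → l.2.2.1 = 0) ∧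
    (k ≠ 2 → l.2.2.2 = 0)}
  add_mem' := by
    rintro a b ⟨h1, h2, h3, h4⟩ ⟨k1, k2, k3, k4⟩
    refine ⟨fun h => ?_, fun h => ?_, fun h => ?_, fun h => ?_⟩
    · simp [h1 h, k1 h]
    · simp [h2 h, k2 h]
    · simp [h3 h, k3 h]
    · simp [h4 h, k4 h]
  zero_mem' := by simp
  smul_mem' := by
    rintro c a ⟨h1, h2, h3, h4⟩
    refine ⟨fun h => ?_, fun h => ?_, fun h => ?_, fun h => ?_⟩
    · simp [h1 h]
    · simp [h2 h]
    · simp [h3 h]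
    · simp [h4 h]

variable {𝓕 𝓔 𝓗}

theorem mem_gradedPart {k : ℤ} {l : 𝓕 × 𝓔 × 𝓗 × ℝ} : l ∈ gradedPart 𝓕 𝓔 𝓗 k ↔
    (k ≠ -1 → l.1 = 0) ∧ (k ≠ 0 → l.2.1 = 0) ∧ (k ≠ 1 → l.2.2.1 = 0) ∧ (k ≠ 2 → l.2.2.2 = 0) :=
  Iff.rfl

theorem Arg.val_mem (a : Arg 𝓕 𝓔 𝓗) : a.val ∈ gradedPart 𝓕 𝓔 𝓗 a.deg := by
  cases a <;> simp [mem_gradedPart, Arg.val, Arg.deg]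

theorem eq_zero_or_exists_arg {k : ℤ} {l : 𝓕 × 𝓔 × 𝓗 × ℝ} (hl : l ∈ gradedPart 𝓕 𝓔 𝓗 k) :
    l = 0 ∨ ∃ a : Arg 𝓕 𝓔 𝓗, a.val = l ∧ a.deg = k := by
  obtain ⟨f, e, h, r⟩ := l
  obtain ⟨h1, h2, h3, h4⟩ := hl
  by_cases k1 : k = -1
  · subst k1; exact .inr ⟨.f f, by simp_all [Arg.val], rfl⟩
  by_cases k2 : k = 0
  · subst k2; exact .inr ⟨.e e, by simp_all [Arg.val], rfl⟩
  by_cases k3 : k = 1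
  · subst k3; exact .inr ⟨.h h, by simp_all [Arg.val], rfl⟩
  by_cases k4 : k = 2
  · subst k4; exact .inr ⟨.z r, by simp_all [Arg.val], rfl⟩
  · left; simp_all

theorem gradedPart_isInternal : DirectSum.IsInternal (gradedPart 𝓕 𝓔 𝓗) := by
  classical
  let c1 : 𝓕 →+ gradedPart 𝓕 𝓔 𝓗 (-1) :=
    { toFun := fun x => ⟨(x, 0, 0, 0), Arg.val_mem (.f x)⟩
      map_zero' := rfl
      map_add' := fun x y => by ext <;> simp }
  let c2 : 𝓔 →+ gradedPart 𝓕 𝓔 𝓗 0 :=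
    { toFun := fun x => ⟨(0, x, 0, 0), Arg.val_mem (.e x)⟩
      map_zero' := rfl
      map_add' := fun x y => by ext <;> simp }
  let c3 : 𝓗 →+ gradedPart 𝓕 𝓔 𝓗 1 :=
    { toFun := fun x => ⟨(0, 0, x, 0), Arg.val_mem (.h x)⟩
      map_zero' := rfl
      map_add' := fun x y => by ext <;> simp }
  let c4 : ℝ →+ gradedPart 𝓕 𝓔 𝓗 2 :=
    { toFun := fun x => ⟨(0, 0, 0, x), Arg.val_mem (.z x)⟩
      map_zero' := rfl
      map_add' := fun x y => by ext <;> simp }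
  let o := DirectSum.of (fun k => gradedPart 𝓕 𝓔 𝓗 k)
  let φ : (𝓕 × 𝓔 × 𝓗 × ℝ) →+ DirectSum ℤ (fun k => gradedPart 𝓕 𝓔 𝓗 k) :=
    AddMonoidHom.coprod ((o (-1)).comp c1) (AddMonoidHom.coprod ((o 0).comp c2)
      (AddMonoidHom.coprod ((o 1).comp c3) ((o 2).comp c4)))
  -- On homogeneous elements `φ` is the inclusion into the direct sum, so it is a left inverse of
  -- the canonical map.
  have hφ : ∀ k (w : gradedPart 𝓕 𝓔 𝓗 k), φ w = o k w := by
    rintro k ⟨w, hw⟩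
    rcases eq_zero_or_exists_arg hw with rfl | ⟨a, rfl, rfl⟩
    · rw [map_zero]; symm; exact map_zero _
    · cases a <;> simp only [φ, Arg.val, AddMonoidHom.coprod_apply, map_zero, zero_add, add_zero] <;>
        rfl
  refine ⟨?_, ?_⟩
  · have : Function.LeftInverse φ (DirectSum.coeAddMonoidHom (gradedPart 𝓕 𝓔 𝓗)) := by
      intro x
      have : φ.comp (DirectSum.coeAddMonoidHom (gradedPart 𝓕 𝓔 𝓗)) = AddMonoidHom.id _ := by
        ext k w : 2
        simpa using hφ k w
      exact DFunLike.congr_fun this x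
    exact this.injective
  · rintro ⟨f, e, h, r⟩
    refine ⟨φ (f, e, h, r), ?_⟩
    simp only [φ, AddMonoidHom.coprod_apply, AddMonoidHom.comp_apply, map_add, o]
    erw [DirectSum.coeAddMonoidHom_of, DirectSum.coeAddMonoidHom_of, DirectSum.coeAddMonoidHom_of,
      DirectSum.coeAddMonoidHom_of]
    simp [c1, c2, c3, c4]

end Graded

/-! ### Brackets defined by sorting the arguments. -/

namespace FlatCalculus

variable {𝓕 𝓔 𝓗 : Type*} [AddCommGroup 𝓕] [Module ℝ 𝓕] [AddCommGroup 𝓔]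
    [Module ℝ 𝓔] [AddCommGroup 𝓗] [Module ℝ 𝓗] (Q : FlatCalculus 𝓕 𝓔 𝓗)

/-- The brackets as functions of lists: the arguments are sorted one after the other into
vector fields, multiples of `μ_0`, sections and functions. -/
def go : List (𝓕 × 𝓔 × 𝓗 × ℝ) → List 𝓗 → ℕ → List 𝓔 → List 𝓕 → 𝓕 × 𝓔 × 𝓗 × ℝ
  | [], hs, n, es, fs => Q.base hs n es fs
  | x :: xs, hs, n, es, fs =>
      -- Each sign moves the new entry to its place in the order vector fields, `μ_0`, sections,
      -- functions. A vector field passes `μ_0` and sections with a sign and functions without;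
      -- `μ_0` passes sections and functions with a sign; a section passes functions with a sign; a
      -- function already stands at the end.
      (-1 : ℝ) ^ (n + es.length) • go xs (hs ++ [x.2.2.1]) n es fs +
      ((-1 : ℝ) ^ (es.length + fs.length) * x.2.2.2) • go xs hs (n + 1) es fs +
      (-1 : ℝ) ^ fs.length • go xs hs n (es ++ [x.2.1]) fs +
      go xs hs n es (fs ++ [x.1])

theorem go_h (xs : List (𝓕 × 𝓔 × 𝓗 × ℝ)) (n : ℕ) (es : List 𝓔) (fs : List 𝓕) :
    IsSignedSymm 1 (fun hs => Q.go xs hs n es fs) := by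
  induction xs generalizing n es fs with
  | nil => exact Q.base_h n es fs
  | cons x xs ih =>
    exact .fun_add (.fun_add (.fun_add (.const_smul _ (.append _ (ih _ _ _)))
      (.const_smul _ (ih _ _ _))) (.const_smul _ (ih _ _ _))) (ih _ _ _)

theorem go_e (xs : List (𝓕 × 𝓔 × 𝓗 × ℝ)) (hs : List 𝓗) (n : ℕ) (fs : List 𝓕) :
    IsSignedSymm (-1) (fun es => Q.go xs hs n es fs) := by
  induction xs generalizing n hs fs with
  | nil => exact Q.base_e hs n fs
  | cons x xs ih =>
    exact .fun_add (.fun_add (.fun_add (.length_smul (fun k => (-1 : ℝ) ^ (n + k)) (ih _ _ _))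
      (.length_smul (fun k => (-1 : ℝ) ^ (k + fs.length) * x.2.2.2) (ih _ _ _)))
      (.const_smul _ (.append _ (ih _ _ _)))) (ih _ _ _)

theorem go_f (xs : List (𝓕 × 𝓔 × 𝓗 × ℝ)) (hs : List 𝓗) (n : ℕ) (es : List 𝓔) :
    IsSignedSymm 1 (fun fs => Q.go xs hs n es fs) := by
  induction xs generalizing n hs es with
  | nil => exact Q.base_f hs n es
  | cons x xs ih =>
    exact .fun_add (.fun_add (.fun_add (.const_smul _ (ih _ _ _))
      (.length_smul (fun k => (-1 : ℝ) ^ (es.length + k) * x.2.2.2) (ih _ _ _)))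
      (.length_smul (fun k => (-1 : ℝ) ^ k) (ih _ _ _))) (.append _ (ih _ _ _))

theorem go_set_add (xs : List (𝓕 × 𝓔 × 𝓗 × ℝ)) (i : ℕ) (hi : i < xs.length)
    (x y : 𝓕 × 𝓔 × 𝓗 × ℝ) (hs : List 𝓗) (n : ℕ) (es : List 𝓔) (fs : List 𝓕) :
    Q.go (xs.set i (x + y)) hs n es fs =
      Q.go (xs.set i x) hs n es fs + Q.go (xs.set i y) hs n es fs := by
  induction xs generalizing i hs n es fs with
  | nil => simp at hi
  | cons w xs ih =>
    cases i with
    | zero =>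
      simp only [List.set_cons_zero, go, Prod.fst_add, Prod.snd_add, (Q.go_h _ _ _ _).snoc_add,
        (Q.go_e _ _ _ _).snoc_add, (Q.go_f _ _ _ _).snoc_add]
      module
    | succ i =>
      simp only [List.set_cons_succ, go, ih i (by simpa using hi)]
      module

theorem go_set_smul (xs : List (𝓕 × 𝓔 × 𝓗 × ℝ)) (i : ℕ) (hi : i < xs.length)
    (c : ℝ) (x : 𝓕 × 𝓔 × 𝓗 × ℝ) (hs : List 𝓗) (n : ℕ) (es : List 𝓔) (fs : List 𝓕) :
    Q.go (xs.set i (c • x)) hs n es fs = c • Q.go (xs.set i x) hs n es fs := by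
  induction xs generalizing i hs n es fs with
  | nil => simp at hi
  | cons w xs ih =>
    cases i with
    | zero =>
      simp only [List.set_cons_zero, go, Prod.smul_fst, Prod.smul_snd, (Q.go_h _ _ _ _).snoc_smul,
        (Q.go_e _ _ _ _).snoc_smul, (Q.go_f _ _ _ _).snoc_smul, smul_eq_mul]
      module
    | succ i =>
      simp only [List.set_cons_succ, go, ih i (by simpa using hi)]
      module

theorem ofFn_update {α : Type*} {n : ℕ} [DecidableEq (Fin n)] (l : Fin n → α) (i : Fin n) (x : α) :
    List.ofFn (Function.update l i x) = (List.ofFn l).set i x := by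
  apply List.ext_getElem
  · simp
  · intro k h1 h2
    rw [List.getElem_set]
    simp only [List.getElem_ofFn, Function.update_apply]
    by_cases h : i.val = k
    · simp [← h]
    · rw [if_neg (fun h' => h (by rw [← h'])), if_neg h]

/-- The brackets of the extended algebra. -/
def mu : Brackets (𝓕 × 𝓔 × 𝓗 × ℝ) := fun n =>
  { toFun := fun l => Q.go (List.ofFn l) [] 0 [] []
    map_update_add' := fun l i x y => by
      rw [ofFn_update, ofFn_update, ofFn_update, Q.go_set_add _ _ (by simp)]
    map_update_smul' := fun l i c x => by
      rw [ofFn_update, ofFn_update, Q.go_set_smul _ _ (by simp)] }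

theorem mu_apply (n : ℕ) (l : Fin n → 𝓕 × 𝓔 × 𝓗 × ℝ) :
    Q.mu n l = Q.go (List.ofFn l) [] 0 [] [] := rfl

variable (xs : List (𝓕 × 𝓔 × 𝓗 × ℝ)) (hs : List 𝓗) (n : ℕ) (es : List 𝓔) (fs : List 𝓕)

@[simp] theorem go_nil : Q.go [] hs n es fs = Q.base hs n es fs := rfl

@[simp] theorem go_cons_f (x : 𝓕) :
    Q.go ((Arg.f x).val :: xs) hs n es fs = Q.go xs hs n es (fs ++ [x]) := by
  simp [go, Arg.val, (Q.go_h _ _ _ _).snoc_zero, (Q.go_e _ _ _ _).snoc_zero]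

@[simp] theorem go_cons_e (x : 𝓔) : Q.go ((Arg.e x).val :: xs) hs n es fs =
    (-1 : ℝ) ^ fs.length • Q.go xs hs n (es ++ [x]) fs := by
  simp [go, Arg.val, (Q.go_h _ _ _ _).snoc_zero, (Q.go_f _ _ _ _).snoc_zero]

@[simp] theorem go_cons_h (x : 𝓗) : Q.go ((Arg.h x).val :: xs) hs n es fs =
    (-1 : ℝ) ^ (n + es.length) • Q.go xs (hs ++ [x]) n es fs := by
  simp [go, Arg.val, (Q.go_e _ _ _ _).snoc_zero, (Q.go_f _ _ _ _).snoc_zero]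

@[simp] theorem go_cons_z (r : ℝ) : Q.go ((Arg.z r).val :: xs) hs n es fs =
    ((-1 : ℝ) ^ (es.length + fs.length) * r) • Q.go xs hs (n + 1) es fs := by
  simp [go, Arg.val, (Q.go_e _ _ _ _).snoc_zero, (Q.go_f _ _ _ _).snoc_zero,
    (Q.go_h _ _ _ _).snoc_zero]

theorem go_cons_zero : Q.go (0 :: xs) hs n es fs = 0 := by
  simp [go, (Q.go_e _ _ _ _).snoc_zero, (Q.go_f _ _ _ _).snoc_zero,
    (Q.go_h _ _ _ _).snoc_zero]

theorem go_cons_smul (c : ℝ) (x : 𝓕 × 𝓔 × 𝓗 × ℝ) : Q.go ((c • x) :: xs) hs n es fs =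
    c • Q.go (x :: xs) hs n es fs := by
  simpa using Q.go_set_smul (x :: xs) 0 (by simp) c x hs n es fs

theorem go_of_two_le {n : ℕ} (hn : 2 ≤ n) : Q.go xs hs n es fs = 0 := by
  induction xs generalizing hs n es fs with
  | nil => exact Q.base_of_two_le hs hn es fs
  | cons w xs ih => simp [go, ih _ _ _ hn, ih _ _ _ (Nat.le_succ_of_le hn)]

/-- For entries of different types both orders lead to the same sorted lists, and the signs
collected differ by the Koszul sign. For equal types this is the symmetry of `go` in the
corresponding list, and with two entries of type `z` both sides vanish. -/
theorem go_swap (x y : Arg 𝓕 𝓔 𝓗) : Q.go (x.val :: y.val :: xs) hs n es fs =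
    Arg.sgn x y • Q.go (y.val :: x.val :: xs) hs n es fs := by
  cases x <;> cases y <;>
    simp only [go_cons_f, go_cons_e, go_cons_h, go_cons_z, Arg.sgn_ff, Arg.sgn_fe, Arg.sgn_fh,
      Arg.sgn_fz, Arg.sgn_ef, Arg.sgn_ee, Arg.sgn_eh, Arg.sgn_ez, Arg.sgn_hf, Arg.sgn_he,
      Arg.sgn_hh, Arg.sgn_hz, Arg.sgn_zf, Arg.sgn_ze, Arg.sgn_zh, Arg.sgn_zz, List.append_assoc,
      List.cons_append, List.nil_append, List.length_append, List.length_cons, List.length_nil,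
      smul_smul]
  case f.f x y => exact (Q.go_f _ _ _ _).swap _ _ _ _
  case h.h x y => rw [(Q.go_h _ _ _ _).swap, smul_smul]; congr 1; ring
  case e.e x y => rw [(Q.go_e _ _ _ _).swap, smul_smul]; congr 1; ring
  case z.z x y => simp [Q.go_of_two_le (n := n + 1 + 1)]
  all_goals congr 1; simp only [pow_add, pow_one, pow_zero]; ring

theorem go_append_swap (pre : List (𝓕 × 𝓔 × 𝓗 × ℝ)) (x y : Arg 𝓕 𝓔 𝓗) :
    Q.go (pre ++ x.val :: y.val :: xs) hs n es fs =
      Arg.sgn x y • Q.go (pre ++ y.val :: x.val :: xs) hs n es fs := by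
  induction pre generalizing hs n es fs with
  | nil => exact Q.go_swap _ _ _ _ _ _ _
  | cons w pre ih => simp only [List.cons_append, go, ih]; module

end FlatCalculus

/-! ## The homotopy expression as a recursion over lists -/

section SignedSplit

variable {Y W : Type*} [AddCommGroup W] [Module ℝ W]

/-- Signed sum of `F A' B'` over all ways of distributing the entries of a list, in order, over the
ends of `A` and `B`: every entry moved to `B` contributes `-1`, and every entry moved to `A` is
exchanged with the entries of `B` that precede it. -/
def signedSplit (sg : Y → Y → ℝ) (F : List Y → List Y → W) : List Y → List Y → List Y → W
  | A, B, [] => F A B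
  | A, B, x :: xs => (B.map fun b => sg b x).prod • signedSplit sg F (A ++ [x]) B xs -
      signedSplit sg F A (B ++ [x]) xs

theorem ofFn_orderEmbOfFin {α : Type*} {n : ℕ} (a : Fin n → α) (S : Finset (Fin n)) :
    List.ofFn (fun i => a (S.orderEmbOfFin rfl i)) = (S.sort (· ≤ ·)).map a := by
  apply List.ext_getElem
  · simp
  · intro i h1 h2
    simp [Finset.orderEmbOfFin_apply]

/-- Subsets are sorted by whether they contain `0`, that is, by the bracket which receives the first
argument. -/
theorem sum_finset_fin_succ {n : ℕ} (G : Finset (Fin (n + 1)) → W) :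
    ∑ S, G S = ∑ S : Finset (Fin n),
      (G (insert 0 (S.map (Fin.succEmb n))) + G (S.map (Fin.succEmb n))) := by
  classical
  have h0 : (0 : Fin (n + 1)) ∉ Finset.univ.map (Fin.succEmb n) := by simp
  have hu : (Finset.univ : Finset (Fin (n + 1))) =
      insert 0 (Finset.univ.map (Fin.succEmb n)) := by
    ext i; cases i using Fin.cases <;> simp
  have key : ∀ G' : Finset (Fin (n + 1)) → W,
      ∑ S ∈ (Finset.univ.map (Fin.succEmb n)).powerset, G' S =
        ∑ S : Finset (Fin n), G' (S.map (Fin.succEmb n)) := by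
    intro G'
    symm
    apply Finset.sum_bij (fun S _ => S.map (Fin.succEmb n))
    · intro S _; rw [Finset.mem_powerset]; exact Finset.map_subset_map.2 (Finset.subset_univ _)
    · intro S _ T _ h; exact Finset.map_injective _ h
    · intro T hT
      rw [Finset.mem_powerset, Finset.subset_map_iff] at hT
      obtain ⟨S, -, rfl⟩ := hT
      exact ⟨S, Finset.mem_univ _, rfl⟩
    · intro S _; rfl
  calc ∑ S, G S = ∑ S ∈ (Finset.univ : Finset (Fin (n + 1))).powerset, G S := by
        rw [Finset.powerset_univ]
    _ = _ := by
        rw [hu, Finset.sum_powerset_insert h0, key, key, add_comm, ← Finset.sum_add_distrib]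

theorem compl_map_succEmb {n : ℕ} (S : Finset (Fin n)) :
    (S.map (Fin.succEmb n))ᶜ = insert 0 (Sᶜ.map (Fin.succEmb n)) := by
  ext i; cases i using Fin.cases <;> simp

theorem compl_insert_map_succEmb {n : ℕ} (S : Finset (Fin n)) :
    (insert 0 (S.map (Fin.succEmb n)))ᶜ = Sᶜ.map (Fin.succEmb n) := by
  ext i; cases i using Fin.cases <;> simp

theorem sort_map_succEmb {n : ℕ} (S : Finset (Fin n)) :
    (S.map (Fin.succEmb n)).sort (· ≤ ·) = (S.sort (· ≤ ·)).map Fin.succ := by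
  exact (Finset.map_sort (Fin.succEmb n) S (· ≤ ·) (· ≤ ·) (by simp)).symm

theorem sort_insert_map_succEmb {n : ℕ} (S : Finset (Fin n)) :
    (insert 0 (S.map (Fin.succEmb n))).sort (· ≤ ·) = 0 :: (S.sort (· ≤ ·)).map Fin.succ := by
  rw [Finset.sort_insert _ (by simp) (by simp), sort_map_succEmb]

/-- The Koszul sign is a product over inversions, so peeling off the first argument separates the
inversions it takes part in, which occur only when it lies in the complement. The accumulated `B`
requires the extra factor for inversions between entries of `B` and the entries of `S` still to
come; it is trivial for `B = []`. -/
theorem sum_eq_signedSplit (sg : Y → Y → ℝ) (F : List Y → List Y → W) {n : ℕ} (a : Fin n → Y)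
    (A B : List Y) :
    ∑ S : Finset (Fin n), ((∏ s ∈ S, (B.map fun b => sg b (a s)).prod) *
      (∏ r ∈ Sᶜ, ∏ s ∈ S, if r < s then sg (a r) (a s) else 1) * (-1 : ℝ) ^ Sᶜ.card) •
        F (A ++ (S.sort (· ≤ ·)).map a) (B ++ (Sᶜ.sort (· ≤ ·)).map a) =
      signedSplit sg F A B (List.ofFn a) := by
  induction n generalizing A B with
  | zero =>
    rw [Finset.sum_eq_single ∅ (by intro S _ h; exact absurd (Subsingleton.elim _ _) h)
      (fun h => absurd (Finset.mem_univ _) h)]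
    have : (∅ : Finset (Fin 0))ᶜ = ∅ := rfl
    simp [signedSplit, this]
  | succ n ih =>
    rw [sum_finset_fin_succ, List.ofFn_succ, signedSplit, ← ih, ← ih, Finset.smul_sum,
      ← Finset.sum_sub_distrib]
    refine Finset.sum_congr rfl fun S _ => ?_
    rw [compl_map_succEmb, compl_insert_map_succEmb, sort_insert_map_succEmb,
      sort_insert_map_succEmb, sort_map_succEmb, sort_map_succEmb, sub_eq_add_neg]
    congr 1
    · have h0 : (0 : Fin (n + 1)) ∉ S.map (Fin.succEmb n) := by simp
      rw [smul_smul]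
      simp only [Finset.prod_insert h0, Finset.prod_map, Finset.card_map, Fin.coe_succEmb,
        List.map_cons, List.map_map, Fin.succ_lt_succ_iff, Fin.not_lt_zero, if_false, one_mul]
      simp only [List.append_assoc, List.cons_append, List.nil_append]
      congr 1
      ring
    · rw [Finset.prod_insert (by simp), Finset.card_insert_of_notMem (by simp), ← neg_smul]
      simp only [Finset.prod_map, Finset.card_map, Finset.prod_insert, Fin.coe_succEmb,
        List.map_cons, List.map_map, Fin.succ_lt_succ_iff, Fin.succ_pos, if_true, List.map_append,
        List.prod_append, Finset.prod_mul_distrib, List.map_nil, List.prod_cons, List.prod_nil,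
        mul_one, List.append_assoc, List.cons_append, List.nil_append]
      congr 1
      ring

end SignedSplit

/-- The zero vector lies in every degree, including those outside -1 to 2, so its prescribed degree
need not come from an `Arg`. It is split off because multilinear expressions vanish there. -/
theorem homog_cases {𝓕 𝓔 𝓗 : Type*} [AddCommGroup 𝓕] [Module ℝ 𝓕] [AddCommGroup 𝓔]
    [Module ℝ 𝓔] [AddCommGroup 𝓗] [Module ℝ 𝓗] {n : ℕ} {deg : Fin n → ℤ}
    {l : Fin n → 𝓕 × 𝓔 × 𝓗 × ℝ} (h : ∀ i, l i ∈ gradedPart 𝓕 𝓔 𝓗 (deg i)) :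
    (∃ i, l i = 0) ∨ ∃ a : Fin n → Arg 𝓕 𝓔 𝓗, l = (fun i => (a i).val) ∧
      deg = fun i => (a i).deg := by
  by_cases h0 : ∃ i, l i = 0
  · exact .inl h0
  · right
    push Not at h0
    have := fun i => (eq_zero_or_exists_arg (h i)).resolve_left (h0 i)
    choose a ha hd using this
    exact ⟨a, funext fun i => (ha i).symm, funext fun i => (hd i).symm⟩

/-- Translates the exchange of neighbouring indices into the exchange of neighbouring list entries.
-/
theorem ofFn_swap {α : Type*} {n : ℕ} (l : Fin n → α) (r s : Fin n) (h : s.val = r.val + 1) :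
    ∃ pre suf, pre.length = r.val ∧ List.ofFn l = pre ++ l r :: l s :: suf ∧
      List.ofFn (fun i => l (Equiv.swap r s i)) = pre ++ l s :: l r :: suf := by
  obtain ⟨s, hs⟩ := s
  simp only at h
  subst h
  refine ⟨(List.ofFn l).take r, (List.ofFn l).drop (r + 2), by simp, ?_, ?_⟩
  · apply List.ext_getElem
    · simp; omega
    · intro i h1 h2
      simp only [List.length_ofFn] at h1
      rw [List.getElem_append]
      split_ifs with hi
      · simp
      · simp only [List.length_take, List.length_ofFn] at hi ⊢
        have hm : min r.val n = r.val := by omega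
        rcases Nat.lt_or_ge i (r + 1) with h3 | h3
        · obtain rfl : i = r := by omega
          simp [hm]
        rcases Nat.lt_or_ge i (r + 2) with h4 | h4
        · obtain rfl : i = r + 1 := by omega
          simp [hm]
        · obtain ⟨j, rfl⟩ := Nat.exists_eq_add_of_le h4
          have : r.val + 2 + j - r.val = j + 2 := by omega
          simp [hm, this]
  · apply List.ext_getElem
    · simp; omega
    · intro i h1 h2
      simp only [List.length_ofFn] at h1
      rw [List.getElem_append]
      split_ifs with hi
      · simp only [List.getElem_ofFn, List.getElem_take]
        simp at hi
        rw [Equiv.swap_apply_of_ne_of_ne] <;> rw [Ne, Fin.ext_iff] <;> simp <;> omega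
      · simp only [List.length_take, List.length_ofFn, List.getElem_ofFn] at hi ⊢
        have hm : min r.val n = r.val := by omega
        rcases Nat.lt_or_ge i (r + 1) with h3 | h3
        · obtain rfl : i = r := by omega
          simp [hm]
        rcases Nat.lt_or_ge i (r + 2) with h4 | h4
        · obtain rfl : i = r + 1 := by omega
          simp [hm]
        · obtain ⟨j, rfl⟩ := Nat.exists_eq_add_of_le h4
          have : r.val + 2 + j - r.val = j + 2 := by omega
          rw [Equiv.swap_apply_of_ne_of_ne]
          · simp [hm, this]
          · rw [Ne, Fin.ext_iff]; simp; omega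
          · rw [Ne, Fin.ext_iff]; simp; omega

/-! ### Degree and antisymmetry of the constructed brackets. -/

namespace FlatCalculus

variable {𝓕 𝓔 𝓗 : Type*} [AddCommGroup 𝓕] [Module ℝ 𝓕] [AddCommGroup 𝓔]
    [Module ℝ 𝓔] [AddCommGroup 𝓗] [Module ℝ 𝓗] (Q : FlatCalculus 𝓕 𝓔 𝓗)

theorem mu_args {n : ℕ} (a : Fin n → Arg 𝓕 𝓔 𝓗) :
    Q.mu n (fun i => (a i).val) = Q.go ((List.ofFn a).map Arg.val) [] 0 [] [] := by
  rw [mu_apply, List.map_ofFn]; rfl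

section Mem

variable {X W : Type*} [AddCommGroup W] [Module ℝ W] (S : Submodule ℝ W)

theorem onNil_mem {l : List X} {w : W} (h : l = [] → w ∈ S) : onNil l w ∈ S := by
  rcases l with _ | ⟨x, l⟩
  · exact h rfl
  · exact S.zero_mem

theorem onOne_mem {l : List X} {T : X → W} (h : l.length = 1 → ∀ x, T x ∈ S) :
    onOne l T ∈ S := by
  rcases l with _ | ⟨x, _ | ⟨y, l⟩⟩
  · exact S.zero_mem
  · exact h rfl x
  · exact S.zero_mem

theorem onTwo_mem {l : List X} {T : X → X → W} (h : l.length = 2 → ∀ x y, T x y ∈ S) :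
    onTwo l T ∈ S := by
  by_cases hl : l.length = 2
  · obtain ⟨x, y, rfl⟩ := List.length_eq_two.1 hl
    exact h rfl x y
  · rw [onTwo_of_ne hl]; exact S.zero_mem

theorem onThree_mem {l : List X} {T : X → X → X → W} (h : l.length = 3 → ∀ x y z, T x y z ∈ S) :
    onThree l T ∈ S := by
  by_cases hl : l.length = 3
  · obtain ⟨x, y, z, rfl⟩ := List.length_eq_three.1 hl
    exact h rfl x y z
  · rw [onThree_of_ne hl]; exact S.zero_mem

theorem onFour_mem {l : List X} {T : X → X → X → X → W}
    (h : l.length = 4 → ∀ x y z u, T x y z u ∈ S) : onFour l T ∈ S := by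
  by_cases hl : l.length = 4
  · match l, hl with
    | [x, y, z, u], _ => exact h rfl x y z u
  · rw [onFour_of_ne hl]; exact S.zero_mem

end Mem

/-- Degree `2 - n` means that an argument of degree `k` contributes `k - 1` to a constant 2: nothing
for a vector field, 1 for `μ_0`, -1 for a section and -2 for a function. -/
theorem base_mem (hs : List 𝓗) (n : ℕ) (es : List 𝓔) (fs : List 𝓕) :
    Q.base hs n es fs ∈ gradedPart 𝓕 𝓔 𝓗 (n - 2 * fs.length - es.length + 2) := by
  match n with
  | 0 =>
    refine add_mem (add_mem (add_mem (add_mem (add_mem ?_ ?_) ?_) ?_) ?_) ?_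
    · refine onNil_mem _ fun _ => onNil_mem _ fun h => onNil_mem _ fun h' => ?_
      simp [mem_gradedPart, h, h']
    · refine onNil_mem _ fun _ => onNil_mem _ fun h => onOne_mem _ fun h' _ => ?_
      simp [mem_gradedPart, h, h']
    · refine onNil_mem _ fun _ => onTwo_mem _ fun h _ _ => onNil_mem _ fun h' => ?_
      simp [mem_gradedPart, h, h']
    · refine onNil_mem _ fun _ => onOne_mem _ fun h _ => onOne_mem _ fun h' _ => ?_
      simp [mem_gradedPart, h, h']
    · refine onNil_mem _ fun _ => onThree_mem _ fun h _ _ _ => onNil_mem _ fun h' => ?_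
      simp [mem_gradedPart, h, h']
    · refine onOne_mem _ fun h _ => onNil_mem _ fun h' => ?_
      simp [mem_gradedPart, h, h']
  | 1 =>
    refine add_mem (add_mem (add_mem (add_mem (add_mem ?_ ?_) ?_) ?_) ?_) ?_
    · refine onNil_mem _ fun _ => onOne_mem _ fun h _ => onOne_mem _ fun h' _ => ?_
      simp [mem_gradedPart, h, h']
    · refine onNil_mem _ fun _ => onNil_mem _ fun h => onTwo_mem _ fun h' _ _ => ?_
      simp [mem_gradedPart, h, h']
    · refine onNil_mem _ fun _ => onThree_mem _ fun h _ _ _ => onNil_mem _ fun h' => ?_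
      simp [mem_gradedPart, h, h']
    · refine onNil_mem _ fun _ => onFour_mem _ fun h _ _ _ _ => onNil_mem _ fun h' => ?_
      simp [mem_gradedPart, h, h']
    · refine onNil_mem _ fun h => onOne_mem _ fun h' _ => ?_
      simp [mem_gradedPart, h, h']
    · refine onTwo_mem _ fun h _ _ => onNil_mem _ fun h' => ?_
      simp [mem_gradedPart, h, h']
  | n + 2 => exact Submodule.zero_mem _

theorem go_mem (L : List (Arg 𝓕 𝓔 𝓗)) (hs : List 𝓗) (n : ℕ) (es : List 𝓔) (fs : List 𝓕) :
    Q.go (L.map Arg.val) hs n es fs ∈ gradedPart 𝓕 𝓔 𝓗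
      (n - 2 * fs.length - es.length + 2 + (L.map fun a => a.deg - 1).sum) := by
  induction L generalizing hs n es fs with
  | nil => simpa using Q.base_mem hs n es fs
  | cons a L ih =>
    cases a
    · simp only [List.map_cons, go_cons_f, Arg.deg_f, List.sum_cons]
      convert ih hs n es _ using 2
      simp; ring
    · simp only [List.map_cons, go_cons_e, Arg.deg_e, List.sum_cons]
      refine Submodule.smul_mem _ _ ?_
      convert ih hs n _ fs using 2
      simp; ring
    · simp only [List.map_cons, go_cons_h, Arg.deg_h, List.sum_cons]
      refine Submodule.smul_mem _ _ ?_
      convert ih _ n es fs using 2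
      simp
    · simp only [List.map_cons, go_cons_z, Arg.deg_z, List.sum_cons]
      refine Submodule.smul_mem _ _ ?_
      convert ih hs (n + 1) es fs using 2
      simp; ring

theorem mu_isGradedAntisymmetric : IsGradedAntisymmetric (gradedPart 𝓕 𝓔 𝓗) Q.mu where
  grading := gradedPart_isInternal
  degree n deg l hl := by
    rcases homog_cases hl with ⟨i, hi⟩ | ⟨a, rfl, rfl⟩
    · rw [(Q.mu n).map_coord_zero i hi]; exact Submodule.zero_mem _
    · rw [mu_args]
      convert Q.go_mem (List.ofFn a) [] 0 [] [] using 2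
      rw [List.map_ofFn, List.sum_ofFn]
      simp [Finset.sum_sub_distrib]
      ring
  antisymm n deg l hl r s hrs := by
    rcases homog_cases hl with ⟨i, hi⟩ | ⟨a, rfl, rfl⟩
    · rw [(Q.mu n).map_coord_zero i hi, (Q.mu n).map_coord_zero (Equiv.swap r s i) (by simpa),
        smul_zero]
    · obtain ⟨pre, suf, -, h1, h2⟩ := ofFn_swap a r s hrs
      rw [Q.mu_args (fun i => a (Equiv.swap r s i)), Q.mu_args a, h1, h2, List.map_append,
        List.map_append, List.map_cons, List.map_cons, List.map_cons, List.map_cons,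
        go_append_swap, Arg.sgn_comm]
      rfl

/-- A composition of two brackets on typed arguments. -/
def comp (A B : List (Arg 𝓕 𝓔 𝓗)) : 𝓕 × 𝓔 × 𝓗 × ℝ :=
  Q.go (Q.go (A.map Arg.val) [] 0 [] [] :: B.map Arg.val) [] 0 [] []

/-- The homotopy expression on typed arguments. -/
def jacList (L : List (Arg 𝓕 𝓔 𝓗)) : 𝓕 × 𝓔 × 𝓗 × ℝ :=
  signedSplit Arg.sgn Q.comp [] [] L

theorem homotopyJacobi_args {n : ℕ} (a : Fin n → Arg 𝓕 𝓔 𝓗) :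
    homotopyJacobi Q.mu n (fun i => (a i).deg) (fun i => (a i).val) = Q.jacList (List.ofFn a) := by
  rw [jacList, ← sum_eq_signedSplit, homotopyJacobi]
  refine Finset.sum_congr rfl fun S _ => ?_
  have h : ∀ S : Finset (Fin n), List.ofFn (fun i => (a (S.orderEmbOfFin rfl i)).val) =
      ((S.sort (· ≤ ·)).map a).map Arg.val := by
    intro S
    rw [← ofFn_orderEmbOfFin, List.map_ofFn]; rfl
  congr 1
  · simp [koszulSign, Arg.sgn]
  · rw [mu_apply, mu_apply, List.ofFn_succ]
    simp only [Fin.cons_zero, Fin.cons_succ, h, comp, List.nil_append]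

theorem homotopyJacobi_of_zero {n : ℕ} (deg : Fin n → ℤ) (l : Fin n → 𝓕 × 𝓔 × 𝓗 × ℝ) (i : Fin n)
    (hi : l i = 0) : homotopyJacobi Q.mu n deg l = 0 := by
  refine Finset.sum_eq_zero fun S _ => ?_
  by_cases hS : i ∈ S
  · have h1 : i ∈ Set.range (S.orderEmbOfFin rfl) := by simpa using hS
    obtain ⟨j, hj⟩ := h1
    rw [(Q.mu S.card).map_coord_zero j (by rw [hj, hi]), (Q.mu _).map_coord_zero 0 (by simp),
      smul_zero]
  · have h1 : i ∈ Set.range (Sᶜ.orderEmbOfFin rfl) := by simpa using hS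
    obtain ⟨j, hj⟩ := h1
    rw [(Q.mu _).map_coord_zero j.succ (by rw [Fin.cons_succ, hj, hi]), smul_zero]

end FlatCalculus

/-- Permutations are generated by exchanges of neighbours. The prefix is generalised because the
`cons` case of `List.Perm` moves the common head into it. -/
theorem List.Perm.induct_adjacent {Y : Type*} {P : List Y → Prop}
    (h : ∀ a b x y, P (a ++ x :: y :: b) → P (a ++ y :: x :: b)) {L L' : List Y}
    (p : L.Perm L') : P L → P L' := by
  suffices H : ∀ pre, P (pre ++ L) → P (pre ++ L') from H []
  induction p with
  | nil => exact fun _ => id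
  | cons x _ ih =>
    intro pre hp
    have := ih (pre ++ [x]) (by simpa using hp)
    simpa using this
  | swap x y l => exact fun pre hp => h pre l y x hp
  | trans _ _ ih1 ih2 => exact fun pre hp => ih2 pre (ih1 pre hp)

section

variable {𝓕 𝓔 𝓗 : Type*} [AddCommGroup 𝓕] [Module ℝ 𝓕] [AddCommGroup 𝓔]
    [Module ℝ 𝓔] [AddCommGroup 𝓗] [Module ℝ 𝓗]

theorem Arg.sgn_mul_self (x y : Arg 𝓕 𝓔 𝓗) : sgn x y * sgn x y = 1 := by
  cases x <;> cases y <;> simp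

theorem Arg.exists_perm_sorted (L : List (Arg 𝓕 𝓔 𝓗)) :
    ∃ (hs : List 𝓗) (zs : List ℝ) (es : List 𝓔) (fs : List 𝓕),
      L.Perm (hs.map Arg.h ++ (zs.map Arg.z ++ (es.map Arg.e ++ fs.map Arg.f))) := by
  induction L with
  | nil => exact ⟨[], [], [], [], .nil⟩
  | cons a L ih =>
    obtain ⟨hs, zs, es, fs, ih⟩ := ih
    cases a with
    | f x =>
      refine ⟨hs, zs, es, x :: fs, (ih.cons _).trans ?_⟩
      rw [← List.append_assoc, ← List.append_assoc, ← List.append_assoc, ← List.append_assoc]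
      exact List.perm_middle.symm
    | e x =>
      refine ⟨hs, zs, x :: es, fs, (ih.cons _).trans ?_⟩
      have := (List.perm_middle (a := e x) (l₁ := hs.map Arg.h ++ zs.map Arg.z)
        (l₂ := es.map Arg.e ++ fs.map Arg.f)).symm
      rwa [List.append_assoc, List.append_assoc] at this
    | h x => exact ⟨x :: hs, zs, es, fs, ih.cons _⟩
    | z x =>
      refine ⟨hs, x :: zs, es, fs, (ih.cons _).trans ?_⟩
      rw [List.map_cons, List.cons_append]
      exact List.perm_middle.symm

theorem eq_zero_of_mem_gradedPart {k k' : ℤ} (hk : k ≠ k') {w : 𝓕 × 𝓔 × 𝓗 × ℝ}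
    (h : w ∈ gradedPart 𝓕 𝓔 𝓗 k) (h' : w ∈ gradedPart 𝓕 𝓔 𝓗 k') : w = 0 := by
  rcases eq_zero_or_exists_arg h with h0 | ⟨a, rfl, rfl⟩
  · exact h0
  · obtain ⟨h1, h2, h3, h4⟩ := h'
    cases a
    · ext <;> simp_all [Arg.val, eq_comm]
    · ext <;> simp_all [Arg.val, eq_comm]
    · ext <;> simp_all [Arg.val, eq_comm]
    · ext <;> simp_all [Arg.val, eq_comm]

theorem eq_zero_of_mem_gradedPart_out {k : ℤ} (hk : k < -1 ∨ 2 < k) {w : 𝓕 × 𝓔 × 𝓗 × ℝ}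
    (h : w ∈ gradedPart 𝓕 𝓔 𝓗 k) : w = 0 := by
  rcases eq_zero_or_exists_arg h with h0 | ⟨a, -, ha⟩
  · exact h0
  · exfalso
    cases a <;> simp only [Arg.deg] at ha <;> omega

end

/-! ### Exchange of arguments in, and degree of, the homotopy expressions. -/

namespace FlatCalculus

variable {𝓕 𝓔 𝓗 : Type*} [AddCommGroup 𝓕] [Module ℝ 𝓕] [AddCommGroup 𝓔]
    [Module ℝ 𝓔] [AddCommGroup 𝓗] [Module ℝ 𝓗] (Q : FlatCalculus 𝓕 𝓔 𝓗)

theorem comp_swap_left (A A' B : List (Arg 𝓕 𝓔 𝓗)) (x y : Arg 𝓕 𝓔 𝓗) :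
    Q.comp (A ++ x :: y :: A') B = Arg.sgn x y • Q.comp (A ++ y :: x :: A') B := by
  simp only [comp, List.map_append, List.map_cons, go_append_swap _ _ _ _ _ _ _ x y, go_cons_smul]

theorem comp_swap_right (A B B' : List (Arg 𝓕 𝓔 𝓗)) (x y : Arg 𝓕 𝓔 𝓗) :
    Q.comp A (B ++ x :: y :: B') = Arg.sgn x y • Q.comp A (B ++ y :: x :: B') := by
  simp only [comp, List.map_append, List.map_cons, ← List.cons_append,
    go_append_swap _ _ _ _ _ _ _ x y]

theorem signedSplit_swap_left (A A' B L : List (Arg 𝓕 𝓔 𝓗)) (x y : Arg 𝓕 𝓔 𝓗) :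
    signedSplit Arg.sgn Q.comp (A ++ x :: y :: A') B L =
      Arg.sgn x y • signedSplit Arg.sgn Q.comp (A ++ y :: x :: A') B L := by
  induction L generalizing A' B with
  | nil => exact Q.comp_swap_left _ _ _ _ _
  | cons w L ih =>
    simp only [signedSplit, List.append_assoc, List.cons_append, ih]; module

theorem signedSplit_swap_right (A B B' L : List (Arg 𝓕 𝓔 𝓗)) (x y : Arg 𝓕 𝓔 𝓗) :
    signedSplit Arg.sgn Q.comp A (B ++ x :: y :: B') L =
      Arg.sgn x y • signedSplit Arg.sgn Q.comp A (B ++ y :: x :: B') L := by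
  induction L generalizing A B' with
  | nil => exact Q.comp_swap_right _ _ _ _ _
  | cons w L ih =>
    simp only [signedSplit, List.append_assoc, List.cons_append, ih, List.map_append,
      List.map_cons, List.prod_append, List.prod_cons]; module

/-- If both neighbours land in the same bracket, the sign is the antisymmetry of that bracket. If
they are separated, the two mixed terms trade places, and exactly one of them carries the factor
`sgn x y`, whose square is one. -/
theorem signedSplit_swap (A B pre L : List (Arg 𝓕 𝓔 𝓗)) (x y : Arg 𝓕 𝓔 𝓗) :
    signedSplit Arg.sgn Q.comp A B (pre ++ x :: y :: L) =
      Arg.sgn x y • signedSplit Arg.sgn Q.comp A B (pre ++ y :: x :: L) := by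
  induction pre generalizing A B with
  | nil =>
    simp only [signedSplit, List.nil_append, List.append_assoc, List.cons_append, List.map_append,
      List.map_cons, List.map_nil, List.prod_append, List.prod_cons, List.prod_nil, mul_one]
    rw [Q.signedSplit_swap_left A [] B L x y, Q.signedSplit_swap_right A B [] L x y,
      Arg.sgn_comm y x]
    have := Arg.sgn_mul_self x y
    simp only [smul_sub, smul_smul]
    have h2 : ∀ p : ℝ, Arg.sgn x y * (p * Arg.sgn x y) = p := fun p => by
      rw [mul_left_comm, this, mul_one]
    rw [h2]
    module
  | cons w pre ih => simp only [signedSplit, List.cons_append, ih]; module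

theorem jacList_swap (pre L : List (Arg 𝓕 𝓔 𝓗)) (x y : Arg 𝓕 𝓔 𝓗) :
    Q.jacList (pre ++ x :: y :: L) = Arg.sgn x y • Q.jacList (pre ++ y :: x :: L) :=
  Q.signedSplit_swap _ _ _ _ _ _

theorem jacList_eq_zero_of_perm {L L' : List (Arg 𝓕 𝓔 𝓗)} (p : L.Perm L')
    (h : Q.jacList L = 0) : Q.jacList L' = 0 :=
  p.induct_adjacent (P := fun L => Q.jacList L = 0) (fun a b x y h' => by
    rw [Q.jacList_swap, h', smul_zero]) h

theorem go_append_smul (pre xs : List (𝓕 × 𝓔 × 𝓗 × ℝ)) (c : ℝ) (x : 𝓕 × 𝓔 × 𝓗 × ℝ)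
    (hs : List 𝓗) (n : ℕ) (es : List 𝓔) (fs : List 𝓕) :
    Q.go (pre ++ (c • x) :: xs) hs n es fs = c • Q.go (pre ++ x :: xs) hs n es fs := by
  induction pre generalizing hs n es fs with
  | nil => exact Q.go_cons_smul _ _ _ _ _ _ _
  | cons w pre ih => simp only [List.cons_append, go, ih]; module

theorem val_z (r : ℝ) : (Arg.z r : Arg 𝓕 𝓔 𝓗).val = r • (Arg.z 1 : Arg 𝓕 𝓔 𝓗).val := by
  simp [Arg.val]

theorem comp_z_left (A A' B : List (Arg 𝓕 𝓔 𝓗)) (r : ℝ) :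
    Q.comp (A ++ .z r :: A') B = r • Q.comp (A ++ .z 1 :: A') B := by
  simp only [comp, List.map_append, List.map_cons, val_z r, go_append_smul, go_cons_smul]

theorem comp_z_right (A B B' : List (Arg 𝓕 𝓔 𝓗)) (r : ℝ) :
    Q.comp A (B ++ .z r :: B') = r • Q.comp A (B ++ .z 1 :: B') := by
  simp only [comp, List.map_append, List.map_cons, val_z r, ← List.cons_append, go_append_smul]

theorem signedSplit_z_left (A A' B L : List (Arg 𝓕 𝓔 𝓗)) (r : ℝ) :
    signedSplit Arg.sgn Q.comp (A ++ .z r :: A') B L =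
      r • signedSplit Arg.sgn Q.comp (A ++ .z 1 :: A') B L := by
  induction L generalizing A' B with
  | nil => exact Q.comp_z_left _ _ _ _
  | cons w L ih => simp only [signedSplit, List.append_assoc, List.cons_append, ih]; module

theorem signedSplit_z_right (A B B' L : List (Arg 𝓕 𝓔 𝓗)) (r : ℝ) :
    signedSplit Arg.sgn Q.comp A (B ++ .z r :: B') L =
      r • signedSplit Arg.sgn Q.comp A (B ++ .z 1 :: B') L := by
  induction L generalizing A B' with
  | nil => exact Q.comp_z_right _ _ _ _
  | cons w L ih =>
    have : Arg.sgn (.z r) w = Arg.sgn (.z 1) w := rfl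
    simp only [signedSplit, List.append_assoc, List.cons_append, ih, List.map_append,
      List.map_cons, this]; module

/-- Coefficients of `μ_0` come out of the expression, so the relations need only be checked on `μ_0`
itself. -/
theorem jacList_z (pre L : List (Arg 𝓕 𝓔 𝓗)) (r : ℝ) :
    Q.jacList (pre ++ .z r :: L) = r • Q.jacList (pre ++ .z 1 :: L) := by
  suffices H : ∀ A B, signedSplit Arg.sgn Q.comp A B (pre ++ .z r :: L) =
      r • signedSplit Arg.sgn Q.comp A B (pre ++ .z 1 :: L) from H [] []
  induction pre with
  | nil =>
    intro A B
    have : ∀ x, Arg.sgn x (.z r) = Arg.sgn x (.z 1 : Arg 𝓕 𝓔 𝓗) := fun x => rfl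
    simp only [List.nil_append, signedSplit, this, Q.signedSplit_z_left A [] B L r,
      Q.signedSplit_z_right A B [] L r]
    module
  | cons w pre ih => intro A B; simp only [signedSplit, List.cons_append, ih]; module

/-- As `μ_0` is even, exchanging two copies of it changes the sign of the expression, which
therefore equals its own negative. -/
theorem jacList_zz (pre L : List (Arg 𝓕 𝓔 𝓗)) (r r' : ℝ) :
    Q.jacList (pre ++ .z r :: .z r' :: L) = 0 := by
  have h1 := Q.jacList_swap pre L (.z 1) (.z 1)
  have h2 : Q.jacList (pre ++ .z 1 :: .z 1 :: L) = 0 := by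
    rw [Arg.sgn_zz, neg_one_smul] at h1
    have h3 := eq_neg_iff_add_eq_zero.1 h1
    rw [← two_smul ℝ] at h3
    exact (smul_eq_zero_iff_right two_ne_zero).1 h3
  have h3 := Q.jacList_z (pre ++ [.z 1]) L r'
  simp only [List.append_assoc, List.cons_append, List.nil_append] at h3
  rw [jacList_z, h3, h2, smul_zero, smul_zero]

theorem comp_mem (A B : List (Arg 𝓕 𝓔 𝓗)) : Q.comp A B ∈ gradedPart 𝓕 𝓔 𝓗
    (3 + (A.map fun a => a.deg - 1).sum + (B.map fun a => a.deg - 1).sum) := by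
  have h := Q.go_mem A [] 0 [] []
  rcases eq_zero_or_exists_arg h with h0 | ⟨a, h1, h2⟩
  · rw [comp, h0, go_cons_zero]; exact Submodule.zero_mem _
  · rw [comp, ← h1]
    rw [show a.val :: B.map Arg.val = (a :: B).map Arg.val from rfl]
    convert Q.go_mem (a :: B) [] 0 [] [] using 2
    simp only [List.map_cons, List.sum_cons, h2]
    simp; ring

theorem signedSplit_mem (A B L : List (Arg 𝓕 𝓔 𝓗)) :
    signedSplit Arg.sgn Q.comp A B L ∈ gradedPart 𝓕 𝓔 𝓗
      (3 + (A.map fun a => a.deg - 1).sum + (B.map fun a => a.deg - 1).sum +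
        (L.map fun a => a.deg - 1).sum) := by
  induction L generalizing A B with
  | nil => simpa [signedSplit] using Q.comp_mem A B
  | cons w L ih =>
    refine sub_mem (Submodule.smul_mem _ _ ?_) ?_
    · convert ih (A ++ [w]) B using 2; simp; ring
    · convert ih A (B ++ [w]) using 2; simp; ring

theorem jacList_mem (L : List (Arg 𝓕 𝓔 𝓗)) :
    Q.jacList L ∈ gradedPart 𝓕 𝓔 𝓗 (3 + (L.map fun a => a.deg - 1).sum) := by
  simpa [jacList] using Q.signedSplit_mem [] [] L

theorem base_mem_one {hs : List 𝓗} (h : hs ≠ []) (n : ℕ) (es : List 𝓔) (fs : List 𝓕) :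
    Q.base hs n es fs ∈ gradedPart 𝓕 𝓔 𝓗 1 := by
  match n with
  | 0 =>
    refine add_mem (add_mem (add_mem (add_mem (add_mem ?_ ?_) ?_) ?_) ?_) ?_
    any_goals exact onNil_mem _ fun h' => absurd h' h
    refine onOne_mem _ fun h _ => onNil_mem _ fun h' => ?_
    simp [mem_gradedPart]
  | 1 =>
    refine add_mem (add_mem (add_mem (add_mem (add_mem ?_ ?_) ?_) ?_) ?_) ?_
    iterate 4 exact onNil_mem _ fun h' => absurd h' h
    · refine onNil_mem _ fun h => onOne_mem _ fun h' _ => ?_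
      simp [mem_gradedPart]
    · refine onTwo_mem _ fun h _ _ => onNil_mem _ fun h' => ?_
      simp [mem_gradedPart]
  | n + 2 => exact Submodule.zero_mem _

theorem go_mem_one (L : List (Arg 𝓕 𝓔 𝓗)) (hs : List 𝓗) (h : hs ≠ [] ∨ ∃ x, .h x ∈ L) (n : ℕ)
    (es : List 𝓔) (fs : List 𝓕) :
    Q.go (L.map Arg.val) hs n es fs ∈ gradedPart 𝓕 𝓔 𝓗 1 := by
  induction L generalizing hs n es fs with
  | nil => exact Q.base_mem_one (by simpa using h) _ _ _
  | cons a L ih =>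
    cases a
    · simp only [List.map_cons, go_cons_f]
      exact ih _ (by simpa using h) _ _ _
    · simp only [List.map_cons, go_cons_e]
      exact Submodule.smul_mem _ _ (ih _ (by simpa using h) _ _ _)
    · simp only [List.map_cons, go_cons_h]
      exact Submodule.smul_mem _ _ (ih _ (.inl (by simp)) _ _ _)
    · simp only [List.map_cons, go_cons_z]
      exact Submodule.smul_mem _ _ (ih _ (by simpa using h) _ _ _)

/-- Brackets with a vector field among the arguments are vector fields. If the inner bracket
receives it, its value is again a vector field fed to the outer one, so the value has degree 1 in
either case. Together with `jacList_mem` this kills all types of the wrong total degree. -/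
theorem signedSplit_mem_one (A B L : List (Arg 𝓕 𝓔 𝓗)) (h : ∃ x, .h x ∈ A ++ B ++ L) :
    signedSplit Arg.sgn Q.comp A B L ∈ gradedPart 𝓕 𝓔 𝓗 1 := by
  induction L generalizing A B with
  | nil =>
    obtain ⟨x, hx⟩ := h
    rw [List.append_nil, List.mem_append] at hx
    rcases hx with hx | hx
    · rcases eq_zero_or_exists_arg (Q.go_mem_one A [] (.inr ⟨x, hx⟩) 0 [] []) with h0 | ⟨b, h3, h4⟩
      · rw [signedSplit, comp, h0, go_cons_zero]; exact Submodule.zero_mem _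
      · rw [signedSplit, comp, ← h3]
        cases b <;> simp at h4
        exact Q.go_mem_one (.h _ :: B) [] (.inr ⟨_, List.mem_cons_self⟩) _ _ _
    · rcases eq_zero_or_exists_arg (Q.go_mem A [] 0 [] []) with h0 | ⟨a, h1, h2⟩
      · rw [signedSplit, comp, h0, go_cons_zero]; exact Submodule.zero_mem _
      · rw [signedSplit, comp, ← h1]
        exact Q.go_mem_one (a :: B) [] (.inr ⟨x, by simp [hx]⟩) _ _ _
  | cons w L ih =>
    obtain ⟨x, hx⟩ := h
    refine sub_mem (Submodule.smul_mem _ _ (ih _ _ ⟨x, ?_⟩)) (ih _ _ ⟨x, ?_⟩)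
    · simp at hx ⊢; tauto
    · simp at hx ⊢; tauto

end FlatCalculus

/-! ### Homotopy expressions with vector fields inserted. -/

namespace FlatCalculus

variable {𝓕 𝓔 𝓗 : Type*} [AddCommGroup 𝓕] [Module ℝ 𝓕] [AddCommGroup 𝓔]
    [Module ℝ 𝓔] [AddCommGroup 𝓗] [Module ℝ 𝓗] (Q : FlatCalculus 𝓕 𝓔 𝓗)

section

variable (xs : List (𝓕 × 𝓔 × 𝓗 × ℝ)) (hs : List 𝓗) (n : ℕ) (es : List 𝓔) (fs : List 𝓕)

/-- This and the next three lemmas repeat `go_cons_f` and its companions for explicit tuples, the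
form in which values of an inner bracket appear. -/
theorem go_tuple_f (x : 𝓕) :
    Q.go ((x, 0, 0, 0) :: xs) hs n es fs = Q.go xs hs n es (fs ++ [x]) := Q.go_cons_f _ _ _ _ _ _

theorem go_tuple_e (x : 𝓔) : Q.go ((0, x, 0, 0) :: xs) hs n es fs =
    (-1 : ℝ) ^ fs.length • Q.go xs hs n (es ++ [x]) fs := Q.go_cons_e _ _ _ _ _ _

theorem go_tuple_h (x : 𝓗) : Q.go ((0, 0, x, 0) :: xs) hs n es fs =
    (-1 : ℝ) ^ (n + es.length) • Q.go xs (hs ++ [x]) n es fs := Q.go_cons_h _ _ _ _ _ _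

theorem go_tuple_z (r : ℝ) : Q.go ((0, 0, 0, r) :: xs) hs n es fs =
    ((-1 : ℝ) ^ (es.length + fs.length) * r) • Q.go xs hs (n + 1) es fs := Q.go_cons_z _ _ _ _ _ _

theorem go_map_h (A : List 𝓗) : Q.go ((A.map Arg.h).map Arg.val ++ xs) hs n es fs =
    (((-1 : ℝ) ^ (n + es.length)) ^ A.length) • Q.go xs (hs ++ A) n es fs := by
  induction A generalizing hs with
  | nil => simp
  | cons x A ih =>
    simp only [List.map_cons, List.cons_append, go_cons_h, ih, List.append_assoc,
      List.nil_append, List.length_cons, smul_smul]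
    congr 1; ring

theorem go_map_h' (A : List 𝓗) : Q.go ((A.map Arg.h).map Arg.val) hs n es fs =
    (((-1 : ℝ) ^ (n + es.length)) ^ A.length) • Q.base (hs ++ A) n es fs := by
  simpa using Q.go_map_h [] hs n es fs A

end

theorem prod_sgn_h_h (B : List 𝓗) (x : 𝓗) :
    ((B.map Arg.h).map fun b => Arg.sgn b (.h x : Arg 𝓕 𝓔 𝓗)).prod = 1 := by
  induction B with
  | nil => rfl
  | cons b B ih => simp only [List.map_cons, List.prod_cons, ih, Arg.sgn_hh, mul_one]

theorem prod_sgn_h_f (B : List 𝓗) (x : 𝓕) :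
    ((B.map Arg.h).map fun b => Arg.sgn b (.f x : Arg 𝓕 𝓔 𝓗)).prod = 1 := by
  induction B with
  | nil => rfl
  | cons b B ih => simp only [List.map_cons, List.prod_cons, ih, Arg.sgn_hf, mul_one]

theorem prod_sgn_h_e (B : List 𝓗) (x : 𝓔) :
    ((B.map Arg.h).map fun b => Arg.sgn b (.e x : Arg 𝓕 𝓔 𝓗)).prod = (-1) ^ B.length := by
  induction B with
  | nil => simp
  | cons b B ih =>
    simp only [List.map_cons, List.prod_cons, ih, Arg.sgn_he, List.length_cons]; ring

theorem prod_sgn_h_z (B : List 𝓗) (x : ℝ) :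
    ((B.map Arg.h).map fun b => Arg.sgn b (.z x : Arg 𝓕 𝓔 𝓗)).prod = (-1) ^ B.length := by
  induction B with
  | nil => simp
  | cons b B ih =>
    simp only [List.map_cons, List.prod_cons, ih, Arg.sgn_hz, List.length_cons]; ring

/-- Leading vector fields commute without sign, so distributing them costs no Koszul factor; each
one sent to the outer bracket only contributes the -1 of `(-1)^k`. -/
theorem jacList_map_h (hs : List 𝓗) (T : List (Arg 𝓕 𝓔 𝓗)) :
    Q.jacList (hs.map Arg.h ++ T) = splitSum (fun A B => (-1 : ℝ) ^ B.length •
      signedSplit Arg.sgn Q.comp (A.map Arg.h) (B.map Arg.h) T) [] [] hs := by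
  suffices H : ∀ A B, signedSplit Arg.sgn Q.comp (A.map Arg.h) (B.map Arg.h) (hs.map Arg.h ++ T) =
      (-1 : ℝ) ^ B.length • splitSum (fun A B => (-1 : ℝ) ^ B.length •
        signedSplit Arg.sgn Q.comp (A.map Arg.h) (B.map Arg.h) T) A B hs by
    simpa [jacList] using H [] []
  induction hs with
  | nil =>
    intro A B
    simp only [List.map_nil, List.nil_append, splitSum, smul_smul, ← mul_pow]
    simp
  | cons x hs ih =>
    intro A B
    have h1 := ih (A ++ [x]) B
    have h2 := ih A (B ++ [x])
    rw [List.map_append] at h1 h2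
    simp only [List.map_cons, List.map_nil] at h1 h2
    simp only [List.map_cons, List.cons_append, signedSplit, splitSum, prod_sgn_h_h, h1, h2,
      List.length_append, List.length_cons, List.length_nil, pow_succ]
    module

/-- Terms are of two kinds. Where the inner bracket admits no vector field, all of them
differentiate the outer value `w`. The remaining terms `G` see genuinely distributed vector fields
and are later summed by the Leibniz rule. -/
theorem jacList_map_h_of_eq {T : List (Arg 𝓕 𝓔 𝓗)} {w : 𝓗} {G : List 𝓗 → List 𝓗 → 𝓗}
    (H : ∀ A B : List 𝓗, (-1 : ℝ) ^ B.length •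
      signedSplit Arg.sgn Q.comp (A.map Arg.h) (B.map Arg.h) T =
      onNil A (0, 0, Q.pd B w, 0) + (0, 0, G A B, 0)) (hs : List 𝓗) :
    Q.jacList (hs.map Arg.h ++ T) = (0, 0, Q.pd hs w + splitSum G [] [] hs, 0) := by
  let φ : 𝓗 →+ 𝓕 × 𝓔 × 𝓗 × ℝ :=
    { toFun := fun v => (0, 0, v, 0)
      map_zero' := rfl
      map_add' := fun x y => by simp }
  have h2 := splitSum_map φ G [] [] hs
  simp only [jacList_map_h, H, splitSum_add]
  rw [splitSum_of_left fun A B hA => onNil_of_ne (by simpa using hA) _]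
  erw [h2]
  simp [φ]

/-- The Lie bracket of vector fields in flat coordinates. -/
def lie (u v : 𝓗) : 𝓗 := Q.pd [u] v - Q.pd [v] u

theorem lie_neg_left (u v : 𝓗) : Q.lie (-u) v = -Q.lie u v := by
  have h := (Q.pd_symm v).smul [] [] (-1) u
  simp only [List.nil_append, neg_smul, one_smul] at h
  rw [lie, lie, h, map_neg]; abel

theorem pd_lie (hs : List 𝓗) (u v : 𝓗) : Q.pd hs (Q.lie u v) =
    splitSum (fun A B => Q.pd (Q.pd A u :: B) v - Q.pd (Q.pd A v :: B) u) [] [] hs := by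
  have := splitSum_smul (-1) (fun A B => Q.pd (Q.pd A v :: B) u) [] [] hs
  simp only [neg_one_smul] at this
  simp only [sub_eq_add_neg, splitSum_add, this, lie, map_add, map_neg, pd_leibniz]

/-- Two terms survive: `D f` inserted into the anchor bracket, and the nullary bracket `μ_0`
inserted next to `f`, which produces `grad f`. In both the vector fields stay outside. -/
theorem jacList_f (hs : List 𝓗) (f : 𝓕) : Q.jacList (hs.map Arg.h ++ [.f f]) =
    (0, 0, Q.pd hs (Q.rho (Q.D f) - Q.grad f), 0) := by
  have H : ∀ A B : List 𝓗, (-1 : ℝ) ^ B.length •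
      signedSplit Arg.sgn Q.comp (A.map Arg.h) (B.map Arg.h) [.f f] =
      onNil A (0, 0, Q.pd B (Q.rho (Q.D f) - Q.grad f), 0) + (0, 0, (fun _ _ => 0) A B, 0) := by
    intro A B
    -- The signs depend on `B` only through the parity of its length, and the brackets without
    -- vector fields contribute inside only for `A = []`; four cases therefore suffice.
    rcases neg_one_pow_eq_or ℝ B.length with hB | hB <;> rcases A with _ | ⟨x, A⟩ <;>
    simp [signedSplit, comp, go_map_h, go_map_h', prod_sgn_h_f, prod_sgn_h_e, prod_sgn_h_z, base,
      onOne, onTwo, onThree, onFour, go_tuple_f, go_tuple_e, go_tuple_h, go_tuple_z,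
      go_cons_zero, go_cons_smul, hB, -List.map_map]
    any_goals rfl
    abel
  rw [jacList_map_h_of_eq Q H, splitSum_of_left (by simp), add_zero]

/-- If the sections are separated, the inner bracket is `pd A (ρ a)` and the outer one
differentiates `ρ b` along it, or with `a` and `b` exchanged. By `pd_lie` the sum over distributions
is the derivative of `[ρ a, ρ b]`. The nullary bracket supplies `SC a b`. -/
theorem jacList_ee (hs : List 𝓗) (a b : 𝓔) : Q.jacList (hs.map Arg.h ++ [.e a, .e b]) =
    (0, 0, Q.pd hs (Q.rho (Q.br a b) - Q.lie (Q.rho a) (Q.rho b) + Q.SC a b), 0) := by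
  have H : ∀ A B : List 𝓗, (-1 : ℝ) ^ B.length •
      signedSplit Arg.sgn Q.comp (A.map Arg.h) (B.map Arg.h) [.e a, .e b] =
      onNil A (0, 0, Q.pd B (Q.rho (Q.br a b) + Q.SC a b), 0) +
      (0, 0, (fun A B => (-1 : ℝ) • (Q.pd (Q.pd A (Q.rho a) :: B) (Q.rho b) -
        Q.pd (Q.pd A (Q.rho b) :: B) (Q.rho a))) A B, 0) := by
    intro A B
    rcases neg_one_pow_eq_or ℝ B.length with hB | hB <;> rcases A with _ | ⟨x, A⟩ <;>
    simp [signedSplit, comp, go_map_h, go_map_h', prod_sgn_h_f, prod_sgn_h_e, prod_sgn_h_z, base,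
      onOne, onTwo, onThree, onFour, go_tuple_f, go_tuple_e, go_tuple_h, go_tuple_z,
      go_cons_zero, go_cons_smul, hB, -List.map_map]
    all_goals abel
  rw [jacList_map_h_of_eq Q H, splitSum_smul, ← pd_lie, ← map_smul, ← map_add]
  congr 4; module

theorem jacList_zef (hs : List 𝓗) (a : 𝓔) (f : 𝓕) :
    Q.jacList (hs.map Arg.h ++ [.z 1, .e a, .f f]) =
    (0, 0, Q.pd hs (Q.rho (Q.q a f) + Q.grad (Q.pr a (Q.D f)) - Q.lie (Q.rho a) (Q.grad f) +
      Q.SC a (Q.D f)), 0) := by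
  have H : ∀ A B : List 𝓗, (-1 : ℝ) ^ B.length •
      signedSplit Arg.sgn Q.comp (A.map Arg.h) (B.map Arg.h) [.z 1, .e a, .f f] =
      onNil A (0, 0, Q.pd B (Q.rho (Q.q a f) + Q.grad (Q.pr a (Q.D f)) + Q.SC a (Q.D f)), 0) +
      (0, 0, (fun A B => (-1 : ℝ) • (Q.pd (Q.pd A (Q.rho a) :: B) (Q.grad f) -
        Q.pd (Q.pd A (Q.grad f) :: B) (Q.rho a))) A B, 0) := by
    intro A B
    rcases neg_one_pow_eq_or ℝ B.length with hB | hB <;> rcases A with _ | ⟨x, A⟩ <;>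
    simp [signedSplit, comp, go_map_h, go_map_h', prod_sgn_h_f, prod_sgn_h_e, prod_sgn_h_z, base,
      onOne, onTwo, onThree, onFour, go_tuple_f, go_tuple_e, go_tuple_h, go_tuple_z,
      go_cons_zero, go_cons_smul, hB, -List.map_map]
    all_goals try rw [Q.SC_skew a, map_neg]
    all_goals abel
  rw [jacList_map_h_of_eq Q H, splitSum_smul, ← pd_lie, ← map_smul, ← map_add]
  congr 4; module

/-- The nullary bracket does not contribute here, since it would create a second `μ_0`. The Lie
brackets arise from all splittings in which one section is separated from `μ_0` and the other two.
-/
theorem jacList_zeee (hs : List 𝓗) (a b c : 𝓔) :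
    Q.jacList (hs.map Arg.h ++ [.z 1, .e a, .e b, .e c]) =
    (0, 0, Q.pd hs (Q.rho (Q.s a b c) - Q.grad (Q.N a b c) -
      (Q.SC (Q.br a b) c + Q.SC (Q.br b c) a + Q.SC (Q.br c a) b) -
      (Q.lie (Q.SC a b) (Q.rho c) + Q.lie (Q.SC b c) (Q.rho a) + Q.lie (Q.SC c a) (Q.rho b))),
      0) := by
  have H : ∀ A B : List 𝓗, (-1 : ℝ) ^ B.length •
      signedSplit Arg.sgn Q.comp (A.map Arg.h) (B.map Arg.h) [.z 1, .e a, .e b, .e c] =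
      onNil A (0, 0, Q.pd B (Q.rho (Q.s a b c) - Q.grad (Q.N a b c) -
        (Q.SC (Q.br a b) c + Q.SC (Q.br b c) a - Q.SC (Q.br a c) b)), 0) +
      (0, 0, (fun A B =>
        (-1 : ℝ) • ((Q.pd (Q.pd A (Q.SC a b) :: B) (Q.rho c) -
          Q.pd (Q.pd A (Q.rho c) :: B) (Q.SC a b)) +
        (Q.pd (Q.pd A (Q.SC b c) :: B) (Q.rho a) -
          Q.pd (Q.pd A (Q.rho a) :: B) (Q.SC b c))) +
        (Q.pd (Q.pd A (Q.SC a c) :: B) (Q.rho b) -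
          Q.pd (Q.pd A (Q.rho b) :: B) (Q.SC a c))) A B, 0) := by
    intro A B
    rcases neg_one_pow_eq_or ℝ B.length with hB | hB <;> rcases A with _ | ⟨x, A⟩ <;>
    simp [signedSplit, comp, go_map_h, go_map_h', prod_sgn_h_f, prod_sgn_h_e, prod_sgn_h_z, base,
      onOne, onTwo, onThree, onFour, go_tuple_f, go_tuple_e, go_tuple_h, go_tuple_z,
      go_cons_zero, go_cons_smul, hB, -List.map_map]
    all_goals abel
  rw [jacList_map_h_of_eq Q H, splitSum_add, splitSum_smul, splitSum_add, ← pd_lie, ← pd_lie,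
    ← pd_lie, Q.br_skew c a, Q.SC_skew c a]
  simp only [← map_smul, ← map_add]
  congr 4
  simp only [lie_neg_left, map_neg, LinearMap.neg_apply]
  simp only [lie]
  module

end FlatCalculus

/-! ### Consequences of the compatibility of bracket, form and anchor. -/

namespace FlatCalculus

variable {𝓕 𝓔 𝓗 : Type*} [AddCommGroup 𝓕] [Module ℝ 𝓕] [AddCommGroup 𝓔]
    [Module ℝ 𝓔] [AddCommGroup 𝓗] [Module ℝ 𝓗] (Q : FlatCalculus 𝓕 𝓔 𝓗)

theorem N_neg (a b c : 𝓔) : Q.N (-a) b c = -Q.N a b c := by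
  simpa using Q.N_smul (-1) a b c

theorem N_sub (a a' b c : 𝓔) : Q.N (a - a') b c = Q.N a b c - Q.N a' b c := by
  rw [sub_eq_add_neg, N_add, N_neg, sub_eq_add_neg]

theorem N_cycle (a b c : 𝓔) : Q.N a b c = Q.N b c a := by
  rw [N_swap_left, N_swap_right, neg_neg]

/-- The anchor is compatible with the derivation and with the brackets up to the strong constraint,
and the form is compatible with the bracket. -/
structure IsCompatible : Prop where
  rho_D : ∀ f, Q.rho (Q.D f) = Q.grad f
  rho_br : ∀ a b, Q.rho (Q.br a b) = Q.lie (Q.rho a) (Q.rho b) - Q.SC a b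
  -- Axiom 3 with `ρ(c)f` written as `2⟨Df,c⟩`.
  compat : ∀ a b c, Q.pr (Q.br c a + Q.D (Q.pr c a)) b + Q.pr a (Q.br c b + Q.D (Q.pr c b)) =
    (2 : ℝ) • Q.pr (Q.D (Q.pr a b)) c

/-- By `compat` the expression `⟨[[a,b]],c⟩` is totally antisymmetric up to derivatives of pairings.
Comparing it with its cyclic average `N` through two instances of `compat` isolates these
derivatives. -/
theorem IsCompatible.pr_br {Q : FlatCalculus 𝓕 𝓔 𝓗} (hQ : Q.IsCompatible) (a b c : 𝓔) : Q.pr (Q.br a b) c =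
    Q.N a b c + Q.pr (Q.D (Q.pr b c)) a - Q.pr (Q.D (Q.pr a c)) b := by
  have h1 := hQ.compat a b c
  have h2 := hQ.compat b c a
  simp only [N, map_add, LinearMap.add_apply, Q.br_skew c b, Q.br_skew b a, Q.br_skew c a,
    Q.pr_symm c, Q.pr_symm b a, map_neg, LinearMap.neg_apply, Q.pr_symm a (Q.D _), Q.pr_symm b (Q.D _), Q.pr_symm b (Q.br _ _), Q.pr_symm a (Q.br _ _)] at h1 h2 ⊢
  linear_combination (norm := module) (1 / 3 : ℝ) • h1 + (2 / 3 : ℝ) • h2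

theorem IsCompatible.N_D {Q : FlatCalculus 𝓕 𝓔 𝓗} (hQ : Q.IsCompatible) (g : 𝓕) (a b : 𝓔) : Q.N (Q.D g) a b =
    Q.pr (Q.br a b) (Q.D g) + Q.pr b (Q.D (Q.pr a (Q.D g))) - Q.pr a (Q.D (Q.pr b (Q.D g))) := by
  rw [hQ.pr_br, ← Q.N_cycle (Q.D g), Q.pr_symm (Q.D _) a, Q.pr_symm (Q.D _) b]
  abel

theorem IsCompatible.pr_q {Q : FlatCalculus 𝓕 𝓔 𝓗} (hQ : Q.IsCompatible) (a c : 𝓔) (f : 𝓕) : Q.pr (Q.q a f) c =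
    Q.N a (Q.D f) c + Q.pr (Q.D (Q.pr (Q.D f) c)) a - Q.pr (Q.D (Q.pr a c)) (Q.D f) -
      Q.pr (Q.D (Q.pr a (Q.D f))) c := by
  rw [q, map_sub, LinearMap.sub_apply, hQ.pr_br]

/-- The relation for four sections, solved for the bracket with `μ_0`. Applying `pr_br` to the outer
and then to the inner bracket of `⟨[[[[x,y]],z]],w⟩` leaves iterated derivatives of pairings, which
cancel in the antisymmetric combination, so that only `N` and its derivatives remain. -/
theorem IsCompatible.t_eq {Q : FlatCalculus 𝓕 𝓔 𝓗} (hQ : Q.IsCompatible) (a b c e : 𝓔) : Q.t a b c e =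
    Q.pr c (Q.D (Q.N a b e)) - Q.pr e (Q.D (Q.N a b c)) - Q.pr b (Q.D (Q.N a c e)) +
      Q.pr a (Q.D (Q.N b c e)) - Q.N (Q.br a b) c e + Q.N (Q.br a c) b e - Q.N (Q.br a e) b c -
      Q.N (Q.br b c) a e + Q.N (Q.br b e) a c - Q.N (Q.br c e) a b := by
  have h : ∀ x y z w, Q.pr (Q.br (Q.br x y) z) w = Q.N (Q.br x y) z w +
      Q.pr (Q.D (Q.pr z w)) (Q.br x y) - Q.pr (Q.D (Q.N x y w)) z -
      Q.pr (Q.D (Q.pr (Q.D (Q.pr y w)) x)) z + Q.pr (Q.D (Q.pr (Q.D (Q.pr x w)) y)) z := by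
    intro x y z w
    rw [hQ.pr_br (Q.br x y), hQ.pr_br x y w]
    simp only [map_add, map_sub, LinearMap.add_apply, LinearMap.sub_apply]
    abel
  simp only [t, s, jac, map_sub, map_add, LinearMap.add_apply, LinearMap.sub_apply, h]
  -- Only explicit instances of the symmetries are used, which put the arguments in the order a, b,
  -- c, e; as general rewriting rules they would loop.
  simp only [Q.br_skew b a, Q.br_skew c a, Q.br_skew e a, Q.br_skew c b, Q.br_skew e b, Q.br_skew e c, Q.pr_symm b a, Q.pr_symm c a, Q.pr_symm e a, Q.pr_symm c b, Q.pr_symm e b, Q.pr_symm e c, map_neg, N_neg, LinearMap.neg_apply,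
    Q.pr_symm a (Q.D _), Q.pr_symm b (Q.D _), Q.pr_symm c (Q.D _), Q.pr_symm e (Q.D _)]
  simp only [Q.N_swap_right (Q.br _ _) b a, Q.N_swap_right (Q.br _ _) c a, Q.N_swap_right (Q.br _ _) e a, Q.N_swap_right (Q.br _ _) c b, Q.N_swap_right (Q.br _ _) e b, Q.N_swap_right (Q.br _ _) e c,
    Q.N_swap_left b a c, Q.N_swap_left b a e, Q.N_swap_left c a b, Q.N_swap_left c a e, Q.N_swap_left e a b, Q.N_swap_left e a c, Q.N_swap_left c b a, Q.N_swap_left c b e, Q.N_swap_left e b a, Q.N_swap_left e b c, Q.N_swap_left e c a, Q.N_swap_left e c b, map_neg, LinearMap.neg_apply,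
   Q.N_swap_right c b a, Q.N_swap_right e b a, Q.N_swap_right b c a, Q.N_swap_right e c a, Q.N_swap_right b e a, Q.N_swap_right c e a, Q.N_swap_right a c b, Q.N_swap_right e c b, Q.N_swap_right a e b, Q.N_swap_right c e b, Q.N_swap_right a e c, Q.N_swap_right b e c]
  module

/-- Needs no compatibility: the nullary bracket contributes `q a f`, and `q` is exactly what cancels
the other terms. The brackets `s` and `r` play the same role for three sections and for two
functions. -/
theorem jacList_ef0 (a : 𝓔) (f : 𝓕) : Q.jacList [.e a, .f f] = 0 := by
  simp only [jacList, signedSplit, comp, List.map_cons, List.map_nil, List.nil_append,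
    List.cons_append, List.prod_cons, List.prod_nil, go_cons_e, go_cons_f, go_cons_z, go_cons_h,
    List.length_nil, List.length_cons, pow_zero, one_smul, Arg.sgn_ee, Arg.sgn_ef, Arg.sgn_ez,
    Arg.sgn_fe, Arg.sgn_ff, Arg.sgn_fz, Arg.sgn_ze, Arg.sgn_zf, go_nil, base, onNil, onOne, onTwo,
    onThree, onFour, add_zero, zero_add, go_tuple_f, go_tuple_e, go_tuple_h, go_tuple_z,
    go_cons_zero, go_cons_smul, smul_zero, sub_zero, zero_sub, mul_one, mul_neg, neg_neg, pow_one,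
    neg_smul, pow_succ, Prod.smul_mk, Prod.mk_add_mk, Prod.mk_sub_mk, Prod.neg_mk, neg_zero,
    one_mul, neg_mul, neg_add_rev, neg_sub]
  have : Q.D (Q.pr a (Q.D f)) - (-Q.br (Q.D f) a - Q.q a f) = 0 := by
    rw [q, Q.br_skew a]; abel
  rw [this]; rfl

theorem jacList_eee (a b c : 𝓔) :
    Q.jacList [.e a, .e b, .e c] = (0, Q.D (Q.N a b c) - Q.jac a b c - Q.s a b c, 0, 0) := by
  simp only [jacList, signedSplit, comp, List.map_cons, List.map_nil, List.nil_append,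
    List.cons_append, List.prod_cons, List.prod_nil, go_cons_e, go_cons_f, go_cons_z, go_cons_h,
    List.length_nil, List.length_cons, pow_zero, one_smul, Arg.sgn_ee, Arg.sgn_ef, Arg.sgn_ez,
    Arg.sgn_fe, Arg.sgn_ff, Arg.sgn_fz, Arg.sgn_ze, Arg.sgn_zf, go_nil, base, onNil, onOne, onTwo,
    onThree, onFour, add_zero, zero_add, go_tuple_f, go_tuple_e, go_tuple_h, go_tuple_z,
    go_cons_zero, go_cons_smul, smul_zero, sub_zero, zero_sub, mul_one, mul_neg, neg_neg, pow_one,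
    neg_smul, pow_succ, Prod.smul_mk, Prod.mk_add_mk, Prod.mk_sub_mk, Prod.neg_mk, neg_zero,
    one_mul, neg_mul, neg_add_rev, neg_sub]
  have : Q.D (Q.N a b c) - Q.br (Q.br a b) c - -Q.br (Q.br a c) b -
      (Q.br (Q.br b c) a - -Q.s a b c) = Q.D (Q.N a b c) - Q.jac a b c - Q.s a b c := by
    simp only [jac, Q.br_skew c a, map_neg, LinearMap.neg_apply]; abel
  rw [this]

theorem jacList_ff0 (f g : 𝓕) : Q.jacList [.f f, .f g] = 0 := by
  simp only [jacList, signedSplit, comp, List.map_cons, List.map_nil, List.nil_append,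
    List.cons_append, List.prod_cons, List.prod_nil, go_cons_e, go_cons_f, go_cons_z, go_cons_h,
    List.length_nil, List.length_cons, pow_zero, one_smul, Arg.sgn_ee, Arg.sgn_ef, Arg.sgn_ez,
    Arg.sgn_fe, Arg.sgn_ff, Arg.sgn_fz, Arg.sgn_ze, Arg.sgn_zf, go_nil, base, onNil, onOne, onTwo,
    onThree, onFour, add_zero, zero_add, go_tuple_f, go_tuple_e, go_tuple_h, go_tuple_z,
    go_cons_zero, go_cons_smul, smul_zero, sub_zero, zero_sub, mul_one, mul_neg, neg_neg, pow_one,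
    neg_smul, pow_succ, Prod.smul_mk, Prod.mk_add_mk, Prod.mk_sub_mk, Prod.neg_mk, neg_zero,
    one_mul, neg_mul, neg_add_rev, neg_sub]
  have : -Q.pr (Q.D f) (Q.D g) - (Q.pr (Q.D g) (Q.D f) - Q.r f g) = 0 := by
    rw [r, Q.pr_symm (Q.D g)]; module
  rw [this]; rfl

/-- In `q (Df) g + q (Dg) f` the brackets cancel by skewness, and the two derivatives of `⟨Df,Dg⟩`
match the factor 2 in `r`. -/
theorem jacList_zff0 (f g : 𝓕) : Q.jacList [.z 1, .f f, .f g] = 0 := by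
  simp only [jacList, signedSplit, comp, List.map_cons, List.map_nil, List.nil_append,
    List.cons_append, List.prod_cons, List.prod_nil, go_cons_e, go_cons_f, go_cons_z, go_cons_h,
    List.length_nil, List.length_cons, pow_zero, one_smul, Arg.sgn_ee, Arg.sgn_ef, Arg.sgn_ez,
    Arg.sgn_fe, Arg.sgn_ff, Arg.sgn_fz, Arg.sgn_ze, Arg.sgn_zf, go_nil, base, onNil, onOne, onTwo,
    onThree, onFour, add_zero, zero_add, go_tuple_f, go_tuple_e, go_tuple_h, go_tuple_z,
    go_cons_zero, go_cons_smul, smul_zero, sub_zero, zero_sub, mul_one, mul_neg, neg_neg, pow_one,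
    neg_smul, pow_succ, Prod.smul_mk, Prod.mk_add_mk, Prod.mk_sub_mk, Prod.neg_mk, neg_zero,
    one_mul, neg_mul, neg_add_rev, neg_sub]
  have : Q.D (Q.r f g) - (-Q.q (Q.D f) g - Q.q (Q.D g) f) = 0 := by
    rw [q, q, r, map_smul, Q.pr_symm (Q.D g), Q.br_skew (Q.D g)]; module
  rw [this]; rfl

/-! ### The relations of a compatible calculus without vector fields -/

namespace IsCompatible

variable {Q : FlatCalculus 𝓕 𝓔 𝓗}

theorem jacList_eef0 (hQ : Q.IsCompatible) (a b : 𝓔) (f : 𝓕) :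
    Q.jacList [.e a, .e b, .f f] = 0 := by
  simp only [jacList, signedSplit, comp, List.map_cons, List.map_nil, List.nil_append,
    List.cons_append, List.prod_cons, List.prod_nil, go_cons_e, go_cons_f, go_cons_z, go_cons_h,
    List.length_nil, List.length_cons, pow_zero, one_smul, Arg.sgn_ee, Arg.sgn_ef, Arg.sgn_ez,
    Arg.sgn_fe, Arg.sgn_ff, Arg.sgn_fz, Arg.sgn_ze, Arg.sgn_zf, go_nil, base, onNil, onOne, onTwo,
    onThree, onFour, add_zero, zero_add, go_tuple_f, go_tuple_e, go_tuple_h, go_tuple_z,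
    go_cons_zero, go_cons_smul, smul_zero, sub_zero, zero_sub, mul_one, mul_neg, neg_neg, pow_one,
    neg_smul, pow_succ, Prod.smul_mk, Prod.mk_add_mk, Prod.mk_sub_mk, Prod.neg_mk, neg_zero,
    one_mul, neg_mul, neg_add_rev, neg_sub]
  have : -Q.pr (Q.br a b) (Q.D f) - Q.pr b (Q.D (Q.pr a (Q.D f))) -
      (-Q.pr a (Q.D (Q.pr b (Q.D f))) - Q.N (Q.D f) a b) = 0 := by
    rw [hQ.N_D]; abel
  rw [this]; rfl

theorem jacList_eeee0 (hQ : Q.IsCompatible) (a b c e : 𝓔) :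
    Q.jacList [.e a, .e b, .e c, .e e] = 0 := by
  simp only [jacList, signedSplit, comp, List.map_cons, List.map_nil, List.nil_append,
    List.cons_append, List.prod_cons, List.prod_nil, go_cons_e, go_cons_f, go_cons_z, go_cons_h,
    List.length_nil, List.length_cons, pow_zero, one_smul, Arg.sgn_ee, Arg.sgn_ef, Arg.sgn_ez,
    Arg.sgn_fe, Arg.sgn_ff, Arg.sgn_fz, Arg.sgn_ze, Arg.sgn_zf, go_nil, base, onNil, onOne, onTwo,
    onThree, onFour, add_zero, zero_add, go_tuple_f, go_tuple_e, go_tuple_h, go_tuple_z,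
    go_cons_zero, go_cons_smul, smul_zero, sub_zero, zero_sub, mul_one, mul_neg, neg_neg, pow_one,
    neg_smul, pow_succ, Prod.smul_mk, Prod.mk_add_mk, Prod.mk_sub_mk, Prod.neg_mk, neg_zero,
    one_mul, neg_mul, neg_add_rev, neg_sub]
  rw [hQ.t_eq]
  refine (Prod.ext ?_ rfl)
  dsimp only [Prod.fst_zero]
  abel

/-- The derivative `D` of the identity `N_D` cancels the gradient terms; the double brackets cancel
by skewness. -/
theorem jacList_zeef0 (hQ : Q.IsCompatible) (a b : 𝓔) (f : 𝓕) :
    Q.jacList [.z 1, .e a, .e b, .f f] = 0 := by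
  simp only [jacList, signedSplit, comp, List.map_cons, List.map_nil, List.nil_append,
    List.cons_append, List.prod_cons, List.prod_nil, go_cons_e, go_cons_f, go_cons_z, go_cons_h,
    List.length_nil, List.length_cons, pow_zero, one_smul, Arg.sgn_ee, Arg.sgn_ef, Arg.sgn_ez,
    Arg.sgn_fe, Arg.sgn_ff, Arg.sgn_fz, Arg.sgn_ze, Arg.sgn_zf, go_nil, base, onNil, onOne, onTwo,
    onThree, onFour, add_zero, zero_add, go_tuple_f, go_tuple_e, go_tuple_h, go_tuple_z,
    go_cons_zero, go_cons_smul, smul_zero, sub_zero, zero_sub, mul_one, mul_neg, neg_neg, pow_one,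
    neg_smul, pow_succ, Prod.smul_mk, Prod.mk_add_mk, Prod.mk_sub_mk, Prod.neg_mk, neg_zero,
    one_mul, neg_mul, neg_add_rev, neg_sub]
  refine Prod.ext rfl (Prod.ext ?_ rfl)
  dsimp only [Prod.snd_zero, Prod.fst_zero]
  have h := congrArg Q.D (hQ.N_D f a b)
  simp only [map_add, map_sub] at h
  simp only [q, s, jac, map_add, map_sub, LinearMap.add_apply, LinearMap.sub_apply, h,
    Q.br_skew b (Q.D _), Q.br_skew a (Q.D _), map_neg, LinearMap.neg_apply]
  abel

theorem jacList_zeeee0 (hQ : Q.IsCompatible) (a b c e : 𝓔) :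
    Q.jacList [.z 1, .e a, .e b, .e c, .e e] = 0 := by
  simp only [jacList, signedSplit, comp, List.map_cons, List.map_nil, List.nil_append,
    List.cons_append, List.prod_cons, List.prod_nil, go_cons_e, go_cons_f, go_cons_z, go_cons_h,
    List.length_nil, List.length_cons, pow_zero, one_smul, Arg.sgn_ee, Arg.sgn_ef, Arg.sgn_ez,
    Arg.sgn_fe, Arg.sgn_ff, Arg.sgn_fz, Arg.sgn_ze, Arg.sgn_zf, go_nil, base, onNil, onOne, onTwo,
    onThree, onFour, add_zero, zero_add, go_tuple_f, go_tuple_e, go_tuple_h, go_tuple_z,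
    go_cons_zero, go_cons_smul, smul_zero, sub_zero, zero_sub, mul_one, mul_neg, neg_neg, pow_one,
    neg_smul, pow_succ, Prod.smul_mk, Prod.mk_add_mk, Prod.mk_sub_mk, Prod.neg_mk, neg_zero,
    one_mul, neg_mul, neg_add_rev, neg_sub]
  refine Prod.ext rfl (Prod.ext ?_ rfl)
  dsimp only [Prod.snd_zero, Prod.fst_zero]
  simp only [hQ.t_eq, q, s, jac, map_add, map_sub, LinearMap.add_apply, LinearMap.sub_apply,
    Q.br_skew a (Q.D _), Q.br_skew b (Q.D _), Q.br_skew c (Q.D _), Q.br_skew e (Q.D _)]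
  simp only [Q.br_skew b a, Q.br_skew c a, Q.br_skew e a, Q.br_skew c b, Q.br_skew e b, Q.br_skew e c, map_neg, LinearMap.neg_apply,
    Q.br_skew a (Q.br _ _), Q.br_skew b (Q.br _ _), Q.br_skew c (Q.br _ _), Q.br_skew e (Q.br _ _),
    Q.br_skew (Q.br c e) (Q.br a b), Q.br_skew (Q.br b e) (Q.br a c),
    Q.br_skew (Q.br b c) (Q.br a e)]
  abel

theorem jacList_zeff0 (hQ : Q.IsCompatible) (a : 𝓔) (f g : 𝓕) :
    Q.jacList [.z 1, .e a, .f f, .f g] = 0 := by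
  simp only [jacList, signedSplit, comp, List.map_cons, List.map_nil, List.nil_append,
    List.cons_append, List.prod_cons, List.prod_nil, go_cons_e, go_cons_f, go_cons_z, go_cons_h,
    List.length_nil, List.length_cons, pow_zero, one_smul, Arg.sgn_ee, Arg.sgn_ef, Arg.sgn_ez,
    Arg.sgn_fe, Arg.sgn_ff, Arg.sgn_fz, Arg.sgn_ze, Arg.sgn_zf, go_nil, base, onNil, onOne, onTwo,
    onThree, onFour, add_zero, zero_add, go_tuple_f, go_tuple_e, go_tuple_h, go_tuple_z,
    go_cons_zero, go_cons_smul, smul_zero, sub_zero, zero_sub, mul_one, mul_neg, neg_neg, pow_one,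
    neg_smul, pow_succ, Prod.smul_mk, Prod.mk_add_mk, Prod.mk_sub_mk, Prod.neg_mk, neg_zero,
    one_mul, neg_mul, neg_add_rev, neg_sub]
  refine Prod.ext ?_ rfl
  dsimp only [Prod.fst_zero]
  rw [hQ.pr_q, hQ.pr_q, r, r, r, Q.N_swap_right a (Q.D g), Q.pr_symm (Q.D g) (Q.D f), map_smul,
    map_smul, Q.pr_symm (Q.D (Q.pr (Q.D f) (Q.D g))) a]
  module

theorem jacList_zeeef0 (hQ : Q.IsCompatible) (a b c : 𝓔) (f : 𝓕) :
    Q.jacList [.z 1, .e a, .e b, .e c, .f f] = 0 := by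
  simp only [jacList, signedSplit, comp, List.map_cons, List.map_nil, List.nil_append,
    List.cons_append, List.prod_cons, List.prod_nil, go_cons_e, go_cons_f, go_cons_z, go_cons_h,
    List.length_nil, List.length_cons, pow_zero, one_smul, Arg.sgn_ee, Arg.sgn_ef, Arg.sgn_ez,
    Arg.sgn_fe, Arg.sgn_ff, Arg.sgn_fz, Arg.sgn_ze, Arg.sgn_zf, go_nil, base, onNil, onOne, onTwo,
    onThree, onFour, add_zero, zero_add, go_tuple_f, go_tuple_e, go_tuple_h, go_tuple_z,
    go_cons_zero, go_cons_smul, smul_zero, sub_zero, zero_sub, mul_one, mul_neg, neg_neg, pow_one,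
    neg_smul, pow_succ, Prod.smul_mk, Prod.mk_add_mk, Prod.mk_sub_mk, Prod.neg_mk, neg_zero,
    one_mul, neg_mul, neg_add_rev, neg_sub]
  refine Prod.ext ?_ rfl
  dsimp only [Prod.fst_zero]
  simp only [hQ.t_eq, q, N_sub, r, s, jac, map_sub, map_add, LinearMap.add_apply,
    LinearMap.sub_apply, Q.N_swap_left (Q.br _ _) (Q.D f), hQ.N_D, Q.pr_symm (Q.D f) (Q.D _),
    Q.br_skew a (Q.D _), Q.br_skew b (Q.D _), Q.br_skew c (Q.D _), N_neg]
  simp only [Q.br_skew c a, map_neg, LinearMap.neg_apply]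
  module

/-- After `t_eq` and `N_D` only `N`, brackets and pairings with derivatives of `N` are left. Once
the arguments are ordered, the terms cancel without any Jacobi identity for `br`. -/
theorem jacList_zeeeee0 (hQ : Q.IsCompatible) (a b c e u : 𝓔) :
    Q.jacList [.z 1, .e a, .e b, .e c, .e e, .e u] = 0 := by
  simp only [jacList, signedSplit, comp, List.map_cons, List.map_nil, List.nil_append,
    List.cons_append, List.prod_cons, List.prod_nil, go_cons_e, go_cons_f, go_cons_z, go_cons_h,
    List.length_nil, List.length_cons, pow_zero, one_smul, Arg.sgn_ee, Arg.sgn_ef, Arg.sgn_ez,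
    Arg.sgn_fe, Arg.sgn_ff, Arg.sgn_fz, Arg.sgn_ze, Arg.sgn_zf, go_nil, base, onNil, onOne, onTwo,
    onThree, onFour, add_zero, zero_add, go_tuple_f, go_tuple_e, go_tuple_h, go_tuple_z,
    go_cons_zero, go_cons_smul, smul_zero, sub_zero, zero_sub, mul_one, mul_neg, neg_neg, pow_one,
    neg_smul, pow_succ, Prod.smul_mk, Prod.mk_add_mk, Prod.mk_sub_mk, Prod.neg_mk, neg_zero,
    one_mul, neg_mul, neg_add_rev, neg_sub]
  refine Prod.ext ?_ rfl
  dsimp only [Prod.fst_zero]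
  simp only [hQ.t_eq, s, N_sub, hQ.N_D, jac, N_add, map_add, map_sub, LinearMap.add_apply]
  simp only [Q.br_skew b a, Q.br_skew c a, Q.br_skew e a, Q.br_skew u a, Q.br_skew c b, Q.br_skew e b, Q.br_skew u b, Q.br_skew e c, Q.br_skew u c, Q.br_skew u e, map_neg, LinearMap.neg_apply, N_neg]
  simp only [Q.N_swap_left (Q.br c e) (Q.br a b),
    Q.N_swap_left (Q.br c u) (Q.br a b),
    Q.N_swap_left (Q.br e u) (Q.br a b),
    Q.N_swap_left (Q.br b e) (Q.br a c),
    Q.N_swap_left (Q.br b u) (Q.br a c),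
    Q.N_swap_left (Q.br e u) (Q.br a c),
    Q.N_swap_left (Q.br b c) (Q.br a e),
    Q.N_swap_left (Q.br b u) (Q.br a e),
    Q.N_swap_left (Q.br c u) (Q.br a e),
    Q.N_swap_left (Q.br b c) (Q.br a u),
    Q.N_swap_left (Q.br b e) (Q.br a u),
    Q.N_swap_left (Q.br c e) (Q.br a u),
    Q.N_swap_left (Q.br e u) (Q.br b c),
    Q.N_swap_left (Q.br c u) (Q.br b e),
    Q.N_swap_left (Q.br c e) (Q.br b u)]
  abel

end IsCompatible

end FlatCalculus

/-! ### All homotopy relations of a compatible calculus. -/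

namespace FlatCalculus

variable {𝓕 𝓔 𝓗 : Type*} [AddCommGroup 𝓕] [Module ℝ 𝓕] [AddCommGroup 𝓔]
    [Module ℝ 𝓔] [AddCommGroup 𝓗] [Module ℝ 𝓗] (Q : FlatCalculus 𝓕 𝓔 𝓗)

theorem jacList_e0 (a : 𝓔) : Q.jacList [.e a] = 0 := by
  simp only [jacList, signedSplit, comp, List.map_cons, List.map_nil, List.nil_append,
    List.cons_append, List.prod_cons, List.prod_nil, go_cons_e, go_cons_f, go_cons_z, go_cons_h,
    List.length_nil, List.length_cons, pow_zero, one_smul, Arg.sgn_ee, Arg.sgn_ef, Arg.sgn_ez,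
    Arg.sgn_fe, Arg.sgn_ff, Arg.sgn_fz, Arg.sgn_ze, Arg.sgn_zf, go_nil, base, onNil, onOne, onTwo,
    onThree, onFour, add_zero, zero_add, go_tuple_f, go_tuple_e, go_tuple_h, go_tuple_z,
    go_cons_zero, go_cons_smul, smul_zero, sub_zero, zero_sub, mul_one, mul_neg, neg_neg, pow_one,
    neg_smul, pow_succ, Prod.smul_mk, Prod.mk_add_mk, Prod.mk_sub_mk, Prod.neg_mk, neg_zero,
    one_mul, neg_mul, neg_add_rev, neg_sub]

theorem jacList_zf0 (f : 𝓕) : Q.jacList [.z 1, .f f] = 0 := by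
  simp only [jacList, signedSplit, comp, List.map_cons, List.map_nil, List.nil_append,
    List.cons_append, List.prod_cons, List.prod_nil, go_cons_e, go_cons_f, go_cons_z, go_cons_h,
    List.length_nil, List.length_cons, pow_zero, one_smul, Arg.sgn_ee, Arg.sgn_ef, Arg.sgn_ez,
    Arg.sgn_fe, Arg.sgn_ff, Arg.sgn_fz, Arg.sgn_ze, Arg.sgn_zf, go_nil, base, onNil, onOne, onTwo,
    onThree, onFour, add_zero, zero_add, go_tuple_f, go_tuple_e, go_tuple_h, go_tuple_z,
    go_cons_zero, go_cons_smul, smul_zero, sub_zero, zero_sub, mul_one, mul_neg, neg_neg, pow_one,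
    neg_smul, pow_succ, Prod.smul_mk, Prod.mk_add_mk, Prod.mk_sub_mk, Prod.neg_mk, neg_zero,
    one_mul, neg_mul, neg_add_rev, neg_sub]

theorem jacList_zee0 (a b : 𝓔) : Q.jacList [.z 1, .e a, .e b] = 0 := by
  simp only [jacList, signedSplit, comp, List.map_cons, List.map_nil, List.nil_append,
    List.cons_append, List.prod_cons, List.prod_nil, go_cons_e, go_cons_f, go_cons_z, go_cons_h,
    List.length_nil, List.length_cons, pow_zero, one_smul, Arg.sgn_ee, Arg.sgn_ef, Arg.sgn_ez,
    Arg.sgn_fe, Arg.sgn_ff, Arg.sgn_fz, Arg.sgn_ze, Arg.sgn_zf, go_nil, base, onNil, onOne, onTwo,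
    onThree, onFour, add_zero, zero_add, go_tuple_f, go_tuple_e, go_tuple_h, go_tuple_z,
    go_cons_zero, go_cons_smul, smul_zero, sub_zero, zero_sub, mul_one, mul_neg, neg_neg, pow_one,
    neg_smul, pow_succ, Prod.smul_mk, Prod.mk_add_mk, Prod.mk_sub_mk, Prod.neg_mk, neg_zero,
    one_mul, neg_mul, neg_add_rev, neg_sub]

theorem pd_cons_sub (u v w : 𝓗) : Q.pd [u - v] w = Q.pd [u] w - Q.pd [v] w := by
  have h1 := (Q.pd_symm w).add [] [] u (-v)
  have h2 := (Q.pd_symm w).smul [] [] (-1) v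
  simp only [List.nil_append, neg_smul, one_smul] at h1 h2
  rw [sub_eq_add_neg, h1, h2, sub_eq_add_neg]

theorem lie_sub_left (u v w : 𝓗) : Q.lie (u - v) w = Q.lie u w - Q.lie v w := by
  rw [lie, lie, lie, pd_cons_sub, map_sub]; abel

/-- By the Leibniz rule the directional derivatives along `u` and `v` differ from `pd [v, u] w` and
`pd [u, v] w` by first-order terms. The second-order terms agree by symmetry, so `lie u v` acts as a
commutator, and the Jacobi identity is formal. -/
theorem lie_lie (u v w : 𝓗) : Q.lie (Q.lie u v) w = Q.pd [u] (Q.pd [v] w) -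
    Q.pd [v] (Q.pd [u] w) - Q.pd [w] (Q.pd [u] v) + Q.pd [w] (Q.pd [v] u) := by
  have h1 := Q.pd_leibniz [u] v w
  have h2 := Q.pd_leibniz [v] u w
  have h3 := (Q.pd_symm w).swap [] [] u v
  simp only [splitSum, List.nil_append, pd_nil, one_smul] at h1 h2 h3
  rw [h1, h2, h3, lie, lie, pd_cons_sub, map_sub]
  abel

theorem lie_jacobi (u v w : 𝓗) :
    Q.lie (Q.lie u v) w + Q.lie (Q.lie v w) u + Q.lie (Q.lie w u) v = 0 := by
  simp only [lie_lie]; abel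

theorem sum_deg_sorted (hs : List 𝓗) (zs : List ℝ) (es : List 𝓔) (fs : List 𝓕) :
    ((hs.map Arg.h ++ (zs.map Arg.z ++ (es.map Arg.e ++ fs.map Arg.f)) : List (Arg 𝓕 𝓔 𝓗)).map
      fun a => a.deg - 1).sum = (zs.length : ℤ) - es.length - 2 * fs.length := by
  simp [Function.comp_def]
  ring

namespace IsCompatible

variable {Q : FlatCalculus 𝓕 𝓔 𝓗}

theorem jacList_f (hQ : Q.IsCompatible) (hs : List 𝓗) (f : 𝓕) :
    Q.jacList (hs.map Arg.h ++ [.f f]) = 0 := by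
  rw [FlatCalculus.jacList_f, hQ.rho_D, sub_self, map_zero]; rfl

theorem jacList_ee (hQ : Q.IsCompatible) (hs : List 𝓗) (a b : 𝓔) :
    Q.jacList (hs.map Arg.h ++ [.e a, .e b]) = 0 := by
  rw [FlatCalculus.jacList_ee, hQ.rho_br, sub_sub_cancel_left, neg_add_cancel, map_zero]; rfl

theorem jacList_zef (hQ : Q.IsCompatible) (hs : List 𝓗) (a : 𝓔) (f : 𝓕) :
    Q.jacList (hs.map Arg.h ++ [.z 1, .e a, .f f]) = 0 := by
  have h : Q.rho (Q.q a f) + Q.grad (Q.pr a (Q.D f)) - Q.lie (Q.rho a) (Q.grad f) +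
      Q.SC a (Q.D f) = 0 := by
    rw [q, map_sub, hQ.rho_br, hQ.rho_D, hQ.rho_D]; abel
  rw [FlatCalculus.jacList_zef, h, map_zero]; rfl

/-- Expressing the anchors of brackets through `lie` and `SC` cancels every `SC` and leaves minus
the Jacobiator of the vector fields `ρ a`, `ρ b`, `ρ c`. -/
theorem jacList_zeee (hQ : Q.IsCompatible) (hs : List 𝓗) (a b c : 𝓔) :
    Q.jacList (hs.map Arg.h ++ [.z 1, .e a, .e b, .e c]) = 0 := by
  have h : Q.rho (Q.s a b c) - Q.grad (Q.N a b c) -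
      (Q.SC (Q.br a b) c + Q.SC (Q.br b c) a + Q.SC (Q.br c a) b) -
      (Q.lie (Q.SC a b) (Q.rho c) + Q.lie (Q.SC b c) (Q.rho a) + Q.lie (Q.SC c a) (Q.rho b)) =
      -(Q.lie (Q.lie (Q.rho a) (Q.rho b)) (Q.rho c) + Q.lie (Q.lie (Q.rho b) (Q.rho c)) (Q.rho a) +
        Q.lie (Q.lie (Q.rho c) (Q.rho a)) (Q.rho b)) := by
    simp only [s, jac, map_sub, map_add, hQ.rho_br, hQ.rho_D, lie_sub_left]; abel
  rw [FlatCalculus.jacList_zeee, h, lie_jacobi, neg_zero, map_zero]; rfl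

/-- The value lies in degree 1 and also in the degree counted from the arguments. If these differ it
vanishes; otherwise only `f`, `ee`, `μ_0 ef` and `μ_0 eee` remain besides the vector fields. -/
theorem jacList_sorted_h (hQ : Q.IsCompatible) {hs : List 𝓗} (hne : hs ≠ []) (zs : List ℝ)
    (hz : zs = [] ∨ zs = [1]) (es : List 𝓔) (fs : List 𝓕) :
    Q.jacList (hs.map Arg.h ++ (zs.map Arg.z ++ (es.map Arg.e ++ fs.map Arg.f))) = 0 := by
  have h1 := Q.signedSplit_mem_one [] []
    (hs.map Arg.h ++ (zs.map Arg.z ++ (es.map Arg.e ++ fs.map Arg.f))) (by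
      obtain ⟨x, hx⟩ := List.exists_mem_of_ne_nil _ hne
      exact ⟨x, by simp [hx]⟩)
  by_cases hd : (3 : ℤ) + (zs.length - es.length - 2 * fs.length) = 1
  · rcases hz with rfl | rfl <;> rcases fs with _ | ⟨f, _ | ⟨g, fs⟩⟩ <;>
      rcases es with _ | ⟨a, _ | ⟨b, _ | ⟨c, _ | ⟨e, es⟩⟩⟩⟩ <;>
      simp only [List.map_cons, List.map_nil, List.cons_append, List.nil_append] <;>
      first
      | (exfalso; simp only [List.length_cons, List.length_nil] at hd; omega)
      | with_reducible exact hQ.jacList_f _ _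
      | with_reducible exact hQ.jacList_ee _ _ _
      | with_reducible exact hQ.jacList_zef _ _ _
      | with_reducible exact hQ.jacList_zeee _ _ _ _
  · have h2 := Q.jacList_mem (hs.map Arg.h ++ (zs.map Arg.z ++ (es.map Arg.e ++ fs.map Arg.f)))
    rw [sum_deg_sorted] at h2
    exact eq_zero_of_mem_gradedPart hd h2 h1

/-- The degree must lie between -1 and 2. Since sections and functions lower it by 1 and 2 and there
is at most one `μ_0`, only the finitely many listed types survive. -/
theorem jacList_sorted_nil (hQ : Q.IsCompatible) (zs : List ℝ)
    (hz : zs = [] ∨ zs = [1]) (es : List 𝓔) (fs : List 𝓕) :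
    Q.jacList (zs.map Arg.z ++ (es.map Arg.e ++ fs.map Arg.f)) = 0 := by
  by_cases hd : (3 : ℤ) + (zs.length - es.length - 2 * fs.length) < -1 ∨
      2 < (3 : ℤ) + (zs.length - es.length - 2 * fs.length)
  · have h2 := Q.jacList_mem (([] : List 𝓗).map Arg.h ++
      (zs.map Arg.z ++ (es.map Arg.e ++ fs.map Arg.f)))
    rw [sum_deg_sorted] at h2
    exact eq_zero_of_mem_gradedPart_out hd h2
  · have h1 := hQ.jacList_f []
    have h2 := hQ.jacList_ee []
    have h3 := hQ.jacList_zef []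
    have h4 := hQ.jacList_zeee []
    have h5 : ∀ a b c, Q.jacList [.e a, .e b, .e c] = 0 := fun a b c =>
      (Q.jacList_eee a b c).trans (by rw [s, sub_self]; rfl)
    simp only [List.map_nil, List.nil_append] at h1 h2 h3 h4
    rcases hz with rfl | rfl <;> rcases fs with _ | ⟨f, _ | ⟨g, _ | ⟨g', fs⟩⟩⟩ <;>
      rcases es with _ | ⟨a, _ | ⟨b, _ | ⟨c, _ | ⟨e, _ | ⟨u, _ | ⟨v, es⟩⟩⟩⟩⟩⟩ <;>
      simp only [List.map_cons, List.map_nil, List.cons_append, List.nil_append] <;>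
      first
      | (exfalso; simp only [List.length_cons, List.length_nil] at hd; omega)
      | with_reducible exact Q.jacList_e0 _
      | with_reducible exact h1 _
      | with_reducible exact h2 _ _
      | with_reducible exact Q.jacList_ef0 _ _
      | with_reducible exact Q.jacList_ff0 _ _
      | with_reducible exact h5 _ _ _
      | with_reducible exact hQ.jacList_eef0 _ _ _
      | with_reducible exact hQ.jacList_eeee0 _ _ _ _
      | with_reducible exact Q.jacList_zf0 _
      | with_reducible exact Q.jacList_zee0 _ _
      | with_reducible exact h3 _ _
      | with_reducible exact h4 _ _ _
      | with_reducible exact Q.jacList_zff0 _ _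
      | with_reducible exact hQ.jacList_zeef0 _ _ _
      | with_reducible exact hQ.jacList_zeeee0 _ _ _ _
      | with_reducible exact hQ.jacList_zeff0 _ _ _
      | with_reducible exact hQ.jacList_zeeef0 _ _ _ _
      | with_reducible exact hQ.jacList_zeeeee0 _ _ _ _ _

theorem jacList_eq_zero (hQ : Q.IsCompatible) (L : List (Arg 𝓕 𝓔 𝓗)) : Q.jacList L = 0 := by
  obtain ⟨hs, zs, es, fs, p⟩ := Arg.exists_perm_sorted L
  refine Q.jacList_eq_zero_of_perm p.symm ?_
  have H : ∀ zs : List ℝ, zs = [] ∨ zs = [1] →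
      Q.jacList (hs.map Arg.h ++ (zs.map Arg.z ++ (es.map Arg.e ++ fs.map Arg.f))) = 0 := by
    intro zs hz
    rcases eq_or_ne hs [] with rfl | hne
    · exact hQ.jacList_sorted_nil zs hz es fs
    · exact hQ.jacList_sorted_h hne zs hz es fs
  rcases zs with _ | ⟨r, _ | ⟨r', zs⟩⟩
  · exact H [] (.inl rfl)
  · have h := H [1] (.inr rfl)
    simp only [List.map_cons, List.map_nil, List.cons_append, List.nil_append] at h ⊢
    rw [Q.jacList_z, h, smul_zero]
  · exact Q.jacList_zz _ _ _ _

/-- The extended algebra of a compatible calculus is an `L_∞`-algebra. -/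
theorem isLInfinityAlgebra (hQ : Q.IsCompatible) :
    IsLInfinityAlgebra (gradedPart 𝓕 𝓔 𝓗) Q.mu where
  toIsGradedAntisymmetric := Q.mu_isGradedAntisymmetric
  jacobi n deg l hl := by
    rcases homog_cases hl with ⟨i, hi⟩ | ⟨a, rfl, rfl⟩
    · exact Q.homotopyJacobi_of_zero deg l i hi
    · rw [Q.homotopyJacobi_args]; exact hQ.jacList_eq_zero _

end IsCompatible

end FlatCalculus

/-! ## Uniqueness of the brackets -/

theorem Brackets.congr_ofFn {W : Type*} [AddCommGroup W] [Module ℝ W] (μ : Brackets W) {n n' : ℕ}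
    {l : Fin n → W} {l' : Fin n' → W} (h : List.ofFn l = List.ofFn l') : μ n l = μ n' l' := by
  obtain rfl : n = n' := by simpa using congrArg List.length h
  rw [List.ofFn_injective h]

theorem countP_ofFn {α : Type*} {n : ℕ} (l : Fin n → α) (p : α → Prop) [DecidablePred p] :
    (List.ofFn l).countP p = (Finset.univ.filter fun i => p (l i)).card := by
  induction n with
  | zero => simp
  | succ n ih =>
    rw [List.ofFn_succ, List.countP_cons, ih, Fin.card_filter_univ_succ]
    by_cases h : p (l 0) <;> simp [h, add_comm]

section Uniqueness

variable {𝓕 𝓔 𝓗 : Type*} [AddCommGroup 𝓕] [Module ℝ 𝓕] [AddCommGroup 𝓔]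
    [Module ℝ 𝓔] [AddCommGroup 𝓗] [Module ℝ 𝓗]

/-- The canonical order of arguments. -/
def sortedArgs (hs : List 𝓗) (zs : List ℝ) (es : List 𝓔) (fs : List 𝓕) : List (Arg 𝓕 𝓔 𝓗) :=
  hs.map Arg.h ++ (zs.map Arg.z ++ (es.map Arg.e ++ fs.map Arg.f))

theorem argType_of_perm {n : ℕ} {a : Fin n → Arg 𝓕 𝓔 𝓗} {hs : List 𝓗} {zs : List ℝ} {es : List 𝓔}
    {fs : List 𝓕} (p : (List.ofFn a).Perm (sortedArgs hs zs es fs)) :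
    BracketBundle.argType (fun i => (a i).deg) =
      (fs.length, es.length, hs.length, zs.length) := by
  have h : ∀ k : ℤ, (Finset.univ.filter fun i => (a i).deg = k).card =
      (sortedArgs hs zs es fs).countP fun x => x.deg = k := by
    intro k
    rw [← p.countP_eq, countP_ofFn]
  simp only [BracketBundle.argType, h, sortedArgs, List.countP_append, List.countP_map,
    Function.comp_def, Arg.deg_f, Arg.deg_e, Arg.deg_h, Arg.deg_z]
  simp

/-- Multilinearity expands each argument into its four homogeneous components, and antisymmetry,
whose signs are invertible, sorts them. -/
theorem eq_of_eq_on_sorted {μ ν : Brackets (𝓕 × 𝓔 × 𝓗 × ℝ)}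
    (hμ : IsGradedAntisymmetric (gradedPart 𝓕 𝓔 𝓗) μ)
    (hν : IsGradedAntisymmetric (gradedPart 𝓕 𝓔 𝓗) ν)
    (h : ∀ (n : ℕ) (a : Fin n → Arg 𝓕 𝓔 𝓗) (hs : List 𝓗) (zs : List ℝ) (es : List 𝓔)
      (fs : List 𝓕), (∀ r ∈ zs, r = 1) → List.ofFn a = sortedArgs hs zs es fs →
        μ n (fun i => (a i).val) = ν n (fun i => (a i).val)) : μ = ν := by
  have key : ∀ (n : ℕ) (a : Fin n → Arg 𝓕 𝓔 𝓗), (∀ i r, a i = .z r → r = 1) →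
      μ n (fun i => (a i).val) = ν n (fun i => (a i).val) := by
    intro n a ha
    obtain ⟨hs, zs, es, fs, p⟩ := Arg.exists_perm_sorted (List.ofFn a)
    have hz : ∀ r ∈ zs, r = 1 := by
      intro r hr
      have h1 : Arg.z r ∈ List.ofFn a := by rw [p.mem_iff]; simp [hr]
      obtain ⟨i, hi⟩ := (List.mem_ofFn).1 h1
      exact ha i r hi
    refine p.symm.induct_adjacent (P := fun L => ∀ (n : ℕ) (a : Fin n → Arg 𝓕 𝓔 𝓗),
      List.ofFn a = L → μ n (fun i => (a i).val) = ν n (fun i => (a i).val)) ?_ ?_ n a rfl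
    · intro u v x y ih n a hl
      have hlen : n = u.length + (v.length + 2) := by
        have := congrArg List.length hl
        simpa using this
      have hsr := ofFn_swap a ⟨u.length, by omega⟩ ⟨u.length + 1, by omega⟩ rfl
      set r : Fin n := ⟨u.length, by omega⟩
      set s : Fin n := ⟨u.length + 1, by omega⟩
      obtain ⟨pre, suf, h0, h1, h2⟩ := hsr
      rw [hl] at h1
      obtain ⟨rfl, h3⟩ := List.append_inj h1 h0.symm
      simp only [List.cons.injEq] at h3
      obtain ⟨hy, hx, rfl⟩ := h3
      rw [← hy, ← hx] at h2
      have h4 := ih n _ h2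
      have h5 := hμ.antisymm n _ _ (fun i => (a i).val_mem) r s rfl
      have h6 := hν.antisymm n _ _ (fun i => (a i).val_mem) r s rfl
      rw [h5, h6] at h4
      exact smul_right_injective (𝓕 × 𝓔 × 𝓗 × ℝ) (zpow_ne_zero _ (by norm_num)) h4
    · intro n a hl
      exact h n a hs zs es fs hz hl
  funext n
  refine MultilinearMap.ext fun l => ?_
  -- Only the `μ_0`-component needs a coefficient: it is scaled out so that the argument becomes
  -- `μ_0` itself, on which the values are prescribed.
  let c : Fin n → Fin 4 → ℝ := fun i => ![1, 1, 1, (l i).2.2.2]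
  let v : Fin n → Fin 4 → Arg 𝓕 𝓔 𝓗 := fun i => ![.f (l i).1, .e (l i).2.1, .h (l i).2.2.1, .z 1]
  have hl : l = fun i => ∑ j, c i j • (v i j).val := by
    funext i
    simp [Fin.sum_univ_four, c, v, Arg.val]
  have hexp : ∀ κ : MultilinearMap ℝ (fun _ : Fin n => 𝓕 × 𝓔 × 𝓗 × ℝ) (𝓕 × 𝓔 × 𝓗 × ℝ),
      κ l = ∑ k : Fin n → Fin 4, (∏ i, c i (k i)) • κ fun i => (v i (k i)).val := by
    intro κ
    conv_lhs => rw [hl]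
    rw [MultilinearMap.map_sum]
    exact Finset.sum_congr rfl fun k _ =>
      MultilinearMap.map_smul_univ κ (fun i => c i (k i)) fun i => (v i (k i)).val
  rw [hexp, hexp]
  refine Finset.sum_congr rfl fun k _ => ?_
  rw [key]
  intro i r
  generalize k i = j
  fin_cases j <;> simp [v, eq_comm]

end Uniqueness

/-! ### Values of the brackets in canonical order. -/

namespace FlatCalculus

variable {𝓕 𝓔 𝓗 : Type*} [AddCommGroup 𝓕] [Module ℝ 𝓕] [AddCommGroup 𝓔]
    [Module ℝ 𝓔] [AddCommGroup 𝓗] [Module ℝ 𝓗] (Q : FlatCalculus 𝓕 𝓔 𝓗)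

/-- In canonical order no argument passes a later type, so every sign in `go` has exponent zero. -/
theorem go_sorted (hs : List 𝓗) (zs : List ℝ) (hz : ∀ r ∈ zs, r = 1) (es : List 𝓔) (fs : List 𝓕) :
    Q.go ((sortedArgs hs zs es fs).map Arg.val) [] 0 [] [] = Q.base hs zs.length es fs := by
  have hf : ∀ fs fs' : List 𝓕, ∀ n, Q.go ((fs.map Arg.f).map Arg.val) hs n es fs' =
      Q.base hs n es (fs' ++ fs) := by
    intro fs
    induction fs with
    | nil => simp
    | cons f fs ih => intro fs' n; simp only [List.map_cons, go_cons_f, ih]; simp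
  have he : ∀ es' es'' : List 𝓔, ∀ n, es'' ++ es' = es →
      Q.go ((es'.map Arg.e ++ fs.map Arg.f).map Arg.val) hs n es'' [] = Q.base hs n es fs := by
    intro es'
    induction es' with
    | nil =>
      intro es'' n h
      rw [List.append_nil] at h
      subst h
      simpa using hf fs [] n
    | cons e es' ih =>
      intro es'' n h
      simp only [List.map_cons, List.cons_append, go_cons_e, List.length_nil, pow_zero, one_smul]
      exact ih _ _ (by simpa using h)
  have hzz : ∀ zs : List ℝ, (∀ r ∈ zs, r = 1) → ∀ n,
      Q.go ((zs.map Arg.z ++ (es.map Arg.e ++ fs.map Arg.f)).map Arg.val) hs n [] [] =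
        Q.base hs (n + zs.length) es fs := by
    intro zs
    induction zs with
    | nil => intro _ n; simpa using he es [] n rfl
    | cons r zs ih =>
      intro hz n
      simp only [List.map_cons, List.cons_append, go_cons_z, List.length_nil, hz r (by simp),
        add_zero, pow_zero, mul_one, one_smul]
      rw [ih (fun r hr => hz r (by simp [hr]))]
      congr 1
      simp; ring
  rw [sortedArgs, List.map_append, go_map_h]
  simpa using hzz zs hz 0

theorem mu_sorted {n : ℕ} {a : Fin n → Arg 𝓕 𝓔 𝓗} {hs : List 𝓗} {zs : List ℝ} {es : List 𝓔}
    {fs : List 𝓕} (hz : ∀ r ∈ zs, r = 1) (h : List.ofFn a = sortedArgs hs zs es fs) :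
    Q.mu n (fun i => (a i).val) = Q.base hs zs.length es fs := by
  rw [mu_args, h, Q.go_sorted hs zs hz]

theorem base_eq_zero {hs : List 𝓗} {n : ℕ} {es : List 𝓔} {fs : List 𝓕}
    (h : (fs.length, es.length, hs.length, n) ∉ BracketBundle.listedTypes) :
    Q.base hs n es fs = 0 := by
  -- Vanishing is membership in `⊥`, so the case distinctions used for the grading apply again.
  suffices H : Q.base hs n es fs ∈ (⊥ : Submodule ℝ (𝓕 × 𝓔 × 𝓗 × ℝ)) by simpa using H
  match n with
  | 0 =>
    refine add_mem (add_mem (add_mem (add_mem (add_mem ?_ ?_) ?_) ?_) ?_) ?_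
    · refine onNil_mem _ fun h1 => onNil_mem _ fun h2 => onNil_mem _ fun h3 => ?_
      exact absurd (by simp [h1, h2, h3, BracketBundle.listedTypes]) h
    · refine onNil_mem _ fun h1 => onNil_mem _ fun h2 => onOne_mem _ fun h3 _ => ?_
      exact absurd (by simp [h1, h2, h3, BracketBundle.listedTypes]) h
    · refine onNil_mem _ fun h1 => onTwo_mem _ fun h2 _ _ => onNil_mem _ fun h3 => ?_
      exact absurd (by simp [h1, h2, h3, BracketBundle.listedTypes]) h
    · refine onNil_mem _ fun h1 => onOne_mem _ fun h2 _ => onOne_mem _ fun h3 _ => ?_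
      exact absurd (by simp [h1, h2, h3, BracketBundle.listedTypes]) h
    · refine onNil_mem _ fun h1 => onThree_mem _ fun h2 _ _ _ => onNil_mem _ fun h3 => ?_
      exact absurd (by simp [h1, h2, h3, BracketBundle.listedTypes]) h
    · refine onOne_mem _ fun h2 _ => onNil_mem _ fun h3 => ?_
      exact absurd (by simp [h2, h3, BracketBundle.listedTypes]) h
  | 1 =>
    refine add_mem (add_mem (add_mem (add_mem (add_mem ?_ ?_) ?_) ?_) ?_) ?_
    · refine onNil_mem _ fun h1 => onOne_mem _ fun h2 _ => onOne_mem _ fun h3 _ => ?_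
      exact absurd (by simp [h1, h2, h3, BracketBundle.listedTypes]) h
    · refine onNil_mem _ fun h1 => onNil_mem _ fun h2 => onTwo_mem _ fun h3 _ _ => ?_
      exact absurd (by simp [h1, h2, h3, BracketBundle.listedTypes]) h
    · refine onNil_mem _ fun h1 => onThree_mem _ fun h2 _ _ _ => onNil_mem _ fun h3 => ?_
      exact absurd (by simp [h1, h2, h3, BracketBundle.listedTypes]) h
    · refine onNil_mem _ fun h1 => onFour_mem _ fun h2 _ _ _ _ => onNil_mem _ fun h3 => ?_
      exact absurd (by simp [h1, h2, h3, BracketBundle.listedTypes]) h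
    · refine onNil_mem _ fun h2 => onOne_mem _ fun h3 _ => ?_
      exact absurd (by simp [h2, h3, BracketBundle.listedTypes]) h
    · refine onTwo_mem _ fun h2 _ _ => onNil_mem _ fun h3 => ?_
      exact absurd (by simp [h2, h3, BracketBundle.listedTypes]) h
  | n + 2 => exact Submodule.zero_mem _

theorem mu_eq_zero_of_not_listed {n : ℕ} {deg : Fin n → ℤ} {l : Fin n → 𝓕 × 𝓔 × 𝓗 × ℝ}
    (hl : ∀ i, l i ∈ gradedPart 𝓕 𝓔 𝓗 (deg i))
    (h : BracketBundle.argType deg ∉ BracketBundle.listedTypes) : Q.mu n l = 0 := by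
  rcases homog_cases hl with ⟨i, hi⟩ | ⟨a, rfl, rfl⟩
  · exact (Q.mu n).map_coord_zero i hi
  · obtain ⟨hs, zs, es, fs, p⟩ := Arg.exists_perm_sorted (List.ofFn a)
    rw [argType_of_perm p] at h
    rw [mu_args]
    refine p.symm.induct_adjacent (P := fun L => Q.go (L.map Arg.val) [] 0 [] [] = 0) ?_ ?_
    · intro u v x y ih
      rw [List.map_append, List.map_cons, List.map_cons] at ih ⊢
      rw [Q.go_append_swap, ih, smul_zero]
    · rcases zs with _ | ⟨r, _ | ⟨r', zs⟩⟩
      · exact (Q.go_sorted hs [] (by simp) es fs).trans (Q.base_eq_zero h)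
      · have h1 := (Q.go_sorted hs [1] (by simp) es fs).trans (Q.base_eq_zero h)
        simp only [sortedArgs, List.map_append, List.map_cons, List.map_nil, val_z r,
          List.cons_append, List.nil_append, go_append_smul] at h1 ⊢
        rw [h1, smul_zero]
      · rw [List.map_append, go_map_h]
        simp [Q.go_of_two_le]

end FlatCalculus

/-! ## Iterated directional derivatives -/

section IteratedDirectional

variable {E G : Type*} [NormedAddCommGroup E] [NormedSpace ℝ E] [NormedAddCommGroup G]
  [NormedSpace ℝ G]

/-- The iterated derivative of `f` in the directions of a list of vectors. -/
def ider : List E → (E → G) → E → G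
  | [], f => f
  | h :: hs, f => fun y => fderiv ℝ (ider hs f) y h

theorem ider_append (a b : List E) (f : E → G) : ider (a ++ b) f = ider a (ider b f) := by
  induction a with
  | nil => rfl
  | cons h a ih => simp only [List.cons_append, ider, ih]

variable {U : Set E} (hU : IsOpen U)
include hU

theorem ContDiffOn.fderiv_apply_vec {f : E → G} (hf : ContDiffOn ℝ ∞ f U) (h : E) :
    ContDiffOn ℝ ∞ (fun y => fderiv ℝ f y h) U :=
  (hf.fderiv_of_isOpen hU (m := ∞) (by simp)).clm_apply contDiffOn_const

theorem ContDiffOn.ider {f : E → G} (hf : ContDiffOn ℝ ∞ f U) (l : List E) :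
    ContDiffOn ℝ ∞ (_root_.ider l f) U := by
  induction l with
  | nil => exact hf
  | cons h l ih => exact ContDiffOn.fderiv_apply_vec hU ih h

theorem ider_congr {f g : E → G} (h : ∀ y ∈ U, f y = g y) (l : List E) :
    ∀ y ∈ U, ider l f y = ider l g y := by
  induction l with
  | nil => exact h
  | cons x l ih =>
    intro y hy
    have : ider l f =ᶠ[𝓝 y] ider l g := by
      filter_upwards [hU.mem_nhds hy] with z hz using ih z hz
    simp only [ider, this.fderiv_eq]

theorem ContDiffOn.differentiableAt_of_isOpen {f : E → G} (hf : ContDiffOn ℝ ∞ f U) {y : E}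
    (hy : y ∈ U) : DifferentiableAt ℝ f y :=
  (hf.contDiffAt (hU.mem_nhds hy)).differentiableAt (by simp)

theorem ider_add {f g : E → G} (hf : ContDiffOn ℝ ∞ f U) (hg : ContDiffOn ℝ ∞ g U) (l : List E) :
    ∀ y ∈ U, ider l (fun y => f y + g y) y = ider l f y + ider l g y := by
  induction l with
  | nil => intro y hy; rfl
  | cons x l ih =>
    intro y hy
    have : ider l (fun y => f y + g y) =ᶠ[𝓝 y] fun y => ider l f y + ider l g y := by
      filter_upwards [hU.mem_nhds hy] with z hz using ih z hz
    simp only [ider, this.fderiv_eq]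
    rw [fderiv_fun_add ((hf.ider hU l).differentiableAt_of_isOpen hU hy)
      ((hg.ider hU l).differentiableAt_of_isOpen hU hy)]
    rfl

theorem ider_const_smul {f : E → G} (hf : ContDiffOn ℝ ∞ f U) (c : ℝ) (l : List E) :
    ∀ y ∈ U, ider l (fun y => c • f y) y = c • ider l f y := by
  induction l with
  | nil => intro y hy; rfl
  | cons x l ih =>
    intro y hy
    have : ider l (fun y => c • f y) =ᶠ[𝓝 y] fun y => c • ider l f y := by
      filter_upwards [hU.mem_nhds hy] with z hz using ih z hz
    simp only [ider, this.fderiv_eq]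
    rw [fderiv_fun_const_smul ((hf.ider hU l).differentiableAt_of_isOpen hU hy)]
    rfl

theorem fderiv_fderiv_comm {f : E → G} (hf : ContDiffOn ℝ ∞ f U) {y : E} (hy : y ∈ U) (u v : E) :
    fderiv ℝ (fun z => fderiv ℝ f z u) y v = fderiv ℝ (fun z => fderiv ℝ f z v) y u := by
  have h1 : DifferentiableAt ℝ (fderiv ℝ f) y :=
    (hf.fderiv_of_isOpen hU (m := ∞) (by simp)).differentiableAt_of_isOpen hU hy
  have h2 : IsSymmSndFDerivAt ℝ f y :=
    (hf.contDiffAt (hU.mem_nhds hy)).isSymmSndFDerivAt (by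
      simpa using (WithTop.coe_le_coe.2 (le_top : (2 : ℕ∞) ≤ ⊤)))
  rw [fderiv_clm_apply h1 (differentiableAt_const _), fderiv_clm_apply h1 (differentiableAt_const _)]
  simpa using h2 v u

theorem isSignedSymm_ider {f : E → G} (hf : ContDiffOn ℝ ∞ f U) {y : E} (hy : y ∈ U) :
    IsSignedSymm 1 (fun l => ider l f y) where
  add a b x x' := by
    simp only [ider_append, ider, map_add]
    exact ider_add hU (ContDiffOn.fderiv_apply_vec hU (hf.ider hU b) x)
      (ContDiffOn.fderiv_apply_vec hU (hf.ider hU b) x') a y hy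
  smul a b c x := by
    simp only [ider_append, ider, map_smul]
    exact ider_const_smul hU (ContDiffOn.fderiv_apply_vec hU (hf.ider hU b) x) c a y hy
  swap a b x x' := by
    simp only [ider_append, one_smul]
    exact ider_congr hU (fun z hz => fderiv_fderiv_comm hU (hf.ider hU b) hz x' x) a y hy

omit hU in
theorem splitSum_cons_left {Y W : Type*} [AddCommGroup W] (G : List Y → List Y → W) (h : Y)
    (A B l : List Y) : splitSum G (h :: A) B l = splitSum (fun A B => G (h :: A) B) A B l := by
  induction l generalizing A B with
  | nil => rfl
  | cons x l ih => simp only [splitSum, List.cons_append, ih]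

omit hU in
theorem splitSum_cons_right {Y W : Type*} [AddCommGroup W] (G : List Y → List Y → W) (h : Y)
    (A B l : List Y) : splitSum G A (h :: B) l = splitSum (fun A B => G A (h :: B)) A B l := by
  induction l generalizing A B with
  | nil => rfl
  | cons x l ih => simp only [splitSum, List.cons_append, ih]

theorem hasFDerivAt_splitSum {Y : Type*} {G' : List Y → List Y → E → G} {y : E}
    {D : List Y → List Y → E →L[ℝ] G} (hG : ∀ A B, HasFDerivAt (G' A B) (D A B) y)
    (A B l : List Y) :
    HasFDerivAt (fun z => splitSum (fun A B => G' A B z) A B l) (splitSum D A B l) y := by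
  induction l generalizing A B with
  | nil => exact hG A B
  | cons x l ih => exact (ih _ _).add (ih _ _)

omit hU in
theorem splitSum_clm_apply {Y : Type*} (D : List Y → List Y → E →L[ℝ] G) (h : E)
    (A B l : List Y) : splitSum D A B l h = splitSum (fun A B => D A B h) A B l := by
  induction l generalizing A B with
  | nil => rfl
  | cons x l ih => simp only [splitSum, _root_.add_apply, ih]

/-- A further derivative of the derivative of `ider B f` along `ider A g` hits either the direction,
so that it joins `A`, or the function, so that it joins `B` after second derivatives have been
exchanged. -/
theorem ider_leibniz {f : E → G} {g : E → E} (hf : ContDiffOn ℝ ∞ f U) (hg : ContDiffOn ℝ ∞ g U)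
    (l : List E) : ∀ y ∈ U, ider l (fun z => fderiv ℝ f z (g z)) y =
      splitSum (fun A B => ider (ider A g y :: B) f y) [] [] l := by
  induction l with
  | nil => intro y hy; rfl
  | cons h l ih =>
    intro y hy
    have h1 : ider l (fun z => fderiv ℝ f z (g z)) =ᶠ[𝓝 y]
        fun z => splitSum (fun A B => ider (ider A g z :: B) f z) [] [] l := by
      filter_upwards [hU.mem_nhds hy] with z hz using ih z hz
    have h2 : ∀ A B : List E, HasFDerivAt (fun z => ider (ider A g z :: B) f z)
        ((fderiv ℝ (ider B f) y).comp (fderiv ℝ (ider A g) y) +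
          (fderiv ℝ (fderiv ℝ (ider B f)) y).flip (ider A g y)) y := by
      intro A B
      have h3 : DifferentiableAt ℝ (fderiv ℝ (ider B f)) y :=
        ((hf.ider hU B).fderiv_of_isOpen hU (m := ∞) (by simp)).differentiableAt_of_isOpen hU hy
      exact h3.hasFDerivAt.clm_apply
        ((hg.ider hU A).differentiableAt_of_isOpen hU hy).hasFDerivAt
    have h4 := (hasFDerivAt_splitSum hU h2 [] [] l).fderiv
    simp only [ider, h1.fderiv_eq]
    simp only [ider] at h4
    rw [h4, splitSum_clm_apply]
    simp only [splitSum, List.nil_append]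
    -- The new direction is outermost, so it stands in front of all entries that are still to be
    -- distributed.
    rw [splitSum_cons_left, splitSum_cons_right, ← splitSum_add]
    congr 1
    funext A B
    have h3 : DifferentiableAt ℝ (fderiv ℝ (ider B f)) y :=
      ((hf.ider hU B).fderiv_of_isOpen hU (m := ∞) (by simp)).differentiableAt_of_isOpen hU hy
    have h5 := fderiv_fderiv_comm hU (hf.ider hU B) hy (ider A g y) h
    rw [fderiv_clm_apply h3 (differentiableAt_const _)] at h5
    simp only [_root_.add_apply, ContinuousLinearMap.comp_apply]
    congr 1
    refine Eq.trans ?_ h5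
    simp

theorem iteratedFDeriv_eq_ider {f : E → G} (hf : ContDiffOn ℝ ∞ f U) (l : List E) :
    ∀ y ∈ U, iteratedFDeriv ℝ l.length f y l.get = ider l f y := by
  induction l with
  | nil => intro y hy; simp [ider]
  | cons h l ih =>
    intro y hy
    have h1 : ider l f =ᶠ[𝓝 y] fun z => iteratedFDeriv ℝ l.length f z l.get := by
      filter_upwards [hU.mem_nhds hy] with z hz using (ih z hz).symm
    have h2 : DifferentiableAt ℝ (iteratedFDeriv ℝ l.length f) y :=
      ((hf.contDiffAt (hU.mem_nhds hy))).differentiableAt_iteratedFDeriv (by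
        exact_mod_cast WithTop.coe_lt_top _)
    simp only [ider, h1.fderiv_eq, List.length_cons]
    rw [iteratedFDeriv_succ_apply_left, fderiv_continuousMultilinear_apply_const_apply h2]
    rfl

end IteratedDirectional

/-! ## The constant metric -/

section Eta

variable {d : ℕ}

/-- The metric as a continuous bilinear map. -/
def etaL (d : ℕ) : DoubledSpace d →L[ℝ] DoubledSpace d →L[ℝ] ℝ :=
  ∑ A : Fin d ⊕ Fin d, ContinuousLinearMap.smulRight
    (ContinuousLinearMap.proj (R := ℝ) (φ := fun _ : Fin d ⊕ Fin d => ℝ) A)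
    (ContinuousLinearMap.proj (R := ℝ) (φ := fun _ : Fin d ⊕ Fin d => ℝ) A.swap)

theorem etaL_apply (u v : DoubledSpace d) : etaL d u v = eta u v := by
  simp [etaL, eta, _root_.sum_apply]

theorem eta_comm (u v : DoubledSpace d) : eta u v = eta v u := by
  rw [eta, eta, ← Equiv.sum_comp (Equiv.sumComm (Fin d) (Fin d))]
  exact Finset.sum_congr rfl fun A _ => by simp [mul_comm]

theorem eta_single (u : DoubledSpace d) (A : Fin d ⊕ Fin d) :
    eta u (Pi.single A.swap 1) = u A := by
  rw [eta, Finset.sum_eq_single A]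
  · simp
  · intro B _ hB
    rw [Pi.single_eq_of_ne fun h => hB (Sum.swap_leftInverse.injective h)]; simp
  · simp

theorem eta_ext {u v : DoubledSpace d} (h : ∀ w, eta u w = eta v w) : u = v := by
  funext A
  rw [← eta_single u, h, eta_single]

theorem eta_sharp (α : DoubledSpace d →L[ℝ] ℝ) (u : DoubledSpace d) : eta (sharp α) u = α u := by
  rw [eta, ← Equiv.sum_comp (Equiv.sumComm (Fin d) (Fin d))]
  simp only [Equiv.sumComm_apply, sharp, Sum.swap_swap]
  have h := LinearMap.pi_apply_eq_sum_univ (α : DoubledSpace d →ₗ[ℝ] ℝ) u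
  rw [ContinuousLinearMap.coe_coe] at h
  rw [h]
  refine Finset.sum_congr rfl fun A _ => ?_
  rw [smul_eq_mul, mul_comm]
  congr 2
  funext B
  simp [Pi.single_apply, eq_comm]

theorem eq_sharp {α : DoubledSpace d →L[ℝ] ℝ} {v : DoubledSpace d} (h : ∀ u, eta v u = α u) :
    v = sharp α :=
  eta_ext fun w => by rw [h, eta_sharp]

/-- Raising an index, as a continuous linear map. -/
def sharpL (d : ℕ) : (DoubledSpace d →L[ℝ] ℝ) →L[ℝ] DoubledSpace d :=
  ContinuousLinearMap.pi fun B => ContinuousLinearMap.apply ℝ ℝ (Pi.single B.swap 1)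

/-- An isometry of the metric is invertible. -/
theorem exists_equiv_of_isometry {L : DoubledSpace d →L[ℝ] DoubledSpace d}
    (hL : ∀ u v, eta (L u) (L v) = eta u v) :
    ∃ K : DoubledSpace d ≃L[ℝ] DoubledSpace d, (K : DoubledSpace d →L[ℝ] DoubledSpace d) = L := by
  have hinj : Function.Injective (L : DoubledSpace d →ₗ[ℝ] DoubledSpace d) := by
    intro u v h
    refine eta_ext fun w => ?_
    rw [← hL u, ← hL v]
    exact congrArg (fun z => eta z (L w)) h
  exact ⟨(LinearEquiv.ofInjectiveEndo _ hinj).toContinuousLinearEquiv, by ext u; rfl⟩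

/-- Raising an index intertwines the pullback of covectors by an isometry with the inverse isometry
on vectors. This makes `η⁻¹(df)` independent of the coordinates. -/
theorem sharp_comp {K : DoubledSpace d ≃L[ℝ] DoubledSpace d}
    (hK : ∀ u v, eta (K u) (K v) = eta u v) (α : DoubledSpace d →L[ℝ] ℝ) :
    sharp (α.comp (K : DoubledSpace d →L[ℝ] DoubledSpace d)) = K.symm (sharp α) := by
  symm
  apply eq_sharp
  intro u
  rw [← hK, K.apply_symm_apply, eta_sharp]
  rfl

end Eta

/-! ## Vector fields in doubled coordinates -/

section Rep

variable {d : ℕ} {M : Type*} [TopologicalSpace M] [ChartedSpace (DoubledSpace d) M]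

/-- A tangent vector as a vector of the model space. -/
def vec {x : M} (w : TangentSpace 𝓘(ℝ, DoubledSpace d) x) : DoubledSpace d := w

theorem vec_injective (x : M) :
    Function.Injective (vec : TangentSpace 𝓘(ℝ, DoubledSpace d) x → DoubledSpace d) :=
  fun _ _ h => h

section

variable {x : M} (u v : TangentSpace 𝓘(ℝ, DoubledSpace d) x)

theorem vec_add : vec (u + v) = vec u + vec v := rfl
theorem vec_sub : vec (u - v) = vec u - vec v := rfl
theorem vec_neg : vec (-u) = -vec u := rfl
theorem vec_smul (c : ℝ) : vec (c • u) = c • vec u := rfl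

end

/-- The components of a vector field in the coordinates around `x`. -/
def rep (x : M) (v : RawVectorField d M) (y : DoubledSpace d) : DoubledSpace d :=
  VectorField.mpullbackWithin 𝓘(ℝ, DoubledSpace d) 𝓘(ℝ, DoubledSpace d)
    (extChartAt 𝓘(ℝ, DoubledSpace d) x).symm v (Set.range 𝓘(ℝ, DoubledSpace d)) y

/-- The domain of the coordinates around `x`. -/
abbrev coordDomain (d : ℕ) {M : Type*} [TopologicalSpace M] [ChartedSpace (DoubledSpace d) M]
    (x : M) : Set (DoubledSpace d) := (extChartAt 𝓘(ℝ, DoubledSpace d) x).target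

/-- The coordinates of `x`. -/
abbrev coord (d : ℕ) {M : Type*} [TopologicalSpace M] [ChartedSpace (DoubledSpace d) M]
    (x : M) : DoubledSpace d := extChartAt 𝓘(ℝ, DoubledSpace d) x x

theorem isOpen_coordDomain (x : M) : IsOpen (coordDomain d x) := isOpen_extChartAt_target x

theorem coord_mem (x : M) : coord d x ∈ coordDomain d x := mem_extChartAt_target x

variable [IsManifold 𝓘(ℝ, DoubledSpace d) ∞ M]

/-- Pulling back along the inverse chart applies the derivative of the chart, which is the linear
coordinate change of the tangent bundle. -/
theorem rep_apply (x : M) (v : RawVectorField d M) {y : DoubledSpace d} (hy : y ∈ coordDomain d x) :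
    rep x v y = tangentCoordChange 𝓘(ℝ, DoubledSpace d)
      ((extChartAt 𝓘(ℝ, DoubledSpace d) x).symm y) x
      ((extChartAt 𝓘(ℝ, DoubledSpace d) x).symm y)
      (vec (v ((extChartAt 𝓘(ℝ, DoubledSpace d) x).symm y))) := by
  have hs := (extChartAt 𝓘(ℝ, DoubledSpace d) x).map_target hy
  have h1 := mfderiv_extChartAt_comp_mfderivWithin_extChartAt_symm
    (I := 𝓘(ℝ, DoubledSpace d)) hy
  have h2 := mfderivWithin_extChartAt_symm_comp_mfderiv_extChartAt
    (I := 𝓘(ℝ, DoubledSpace d)) hy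
  have h3 := ContinuousLinearMap.inverse_eq h2 h1
  have h4 := mfderiv_chartAt_eq_tangentCoordChange (I := 𝓘(ℝ, DoubledSpace d)) (y := x)
    (x := (extChartAt 𝓘(ℝ, DoubledSpace d) x).symm y) (by simpa using hs)
  rw [← h4, rep, VectorField.mpullbackWithin_apply, h3]
  rfl

theorem rep_coord (x : M) (v : RawVectorField d M) : rep x v (coord d x) = vec (v x) := by
  rw [rep_apply x v (coord_mem x), coord, extChartAt_to_inv]
  exact tangentCoordChange_self (I := 𝓘(ℝ, DoubledSpace d)) (mem_extChartAt_source x)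

end Rep

/-! ## Changes of coordinates -/

section Transition

variable {d : ℕ} {M : Type*} [TopologicalSpace M] [ChartedSpace (DoubledSpace d) M]
  [IsManifold 𝓘(ℝ, DoubledSpace d) ∞ M]

/-- Near a point `z`, the coordinates around `x` and those around `z` differ by an affine map whose
linear part is an isometry. -/
structure IsTransition (x z : M) (K : DoubledSpace d ≃L[ℝ] DoubledSpace d) (b y : DoubledSpace d) :
    Prop where
  mem : K y + b ∈ coordDomain d z
  symm_eq : (extChartAt 𝓘(ℝ, DoubledSpace d) z).symm (K y + b) =
    (extChartAt 𝓘(ℝ, DoubledSpace d) x).symm y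
  rep_eq : ∀ v : RawVectorField d M, rep x v y = K.symm (rep z v (K y + b))

/-- Flatness gives an affine coordinate change near the point. Its derivative is the same isometry
`K` at all nearby points, so the components of every vector field transform by `K` there. -/
theorem exists_transition [IsDoubledManifold d M] (x z : M)
    (hz : z ∈ (extChartAt 𝓘(ℝ, DoubledSpace d) x).source) :
    ∃ (K : DoubledSpace d ≃L[ℝ] DoubledSpace d) (b : DoubledSpace d),
      (∀ u v, eta (K u) (K v) = eta u v) ∧
      K (extChartAt 𝓘(ℝ, DoubledSpace d) x z) + b = coord d z ∧
      ∀ᶠ y in 𝓝 (extChartAt 𝓘(ℝ, DoubledSpace d) x z), IsTransition x z K b y := by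
  have hz' : z ∈ (chartAt (DoubledSpace d) x).source := by simpa using hz
  set p := extChartAt 𝓘(ℝ, DoubledSpace d) x z with hp
  have hpt : p ∈ coordDomain d x := (extChartAt 𝓘(ℝ, DoubledSpace d) x).map_source hz
  have hps : (extChartAt 𝓘(ℝ, DoubledSpace d) x).symm p = z :=
    (extChartAt 𝓘(ℝ, DoubledSpace d) x).left_inv hz
  obtain ⟨L, b, hL, hev⟩ := IsDoubledManifold.flat (d := d) (M := M)
    (chartAt (DoubledSpace d) x) (chart_mem_atlas _ _) (chartAt (DoubledSpace d) z)
    (chart_mem_atlas _ _) p (by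
      have h1 : chartAt (DoubledSpace d) x z ∈ (chartAt (DoubledSpace d) x).target :=
        (chartAt (DoubledSpace d) x).map_source hz'
      have h2 : (chartAt (DoubledSpace d) x).symm (chartAt (DoubledSpace d) x z) = z :=
        (chartAt (DoubledSpace d) x).left_inv hz'
      simp only [OpenPartialHomeomorph.trans_source, OpenPartialHomeomorph.symm_source,
        Set.mem_inter_iff, Set.mem_preimage]
      exact ⟨h1, by rw [hp]; simp [h2]⟩)
  obtain ⟨K, hK⟩ := exists_equiv_of_isometry hL
  have hev' : ∀ᶠ y in 𝓝 p, extChartAt 𝓘(ℝ, DoubledSpace d) z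
      ((extChartAt 𝓘(ℝ, DoubledSpace d) x).symm y) = K y + b := by
    filter_upwards [hev] with y hy
    have h1 : L y = K y := by rw [← hK]; rfl
    rw [← h1, ← hy]
    simp
  refine ⟨K, b, fun u v => ?_, ?_, ?_⟩
  · have h : ∀ u, K u = L u := fun u => by rw [← hK]; rfl
    rw [h, h, hL]
  · rw [← hev'.self_of_nhds, hps]
  · have hs : ∀ᶠ y in 𝓝 p, (extChartAt 𝓘(ℝ, DoubledSpace d) x).symm y ∈
        (extChartAt 𝓘(ℝ, DoubledSpace d) z).source := by
      have hc := continuousAt_extChartAt_symm'' (I := 𝓘(ℝ, DoubledSpace d)) (x := x) hpt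
      refine hc.eventually_mem ?_
      rw [hps]
      exact (isOpen_extChartAt_source z).mem_nhds (mem_extChartAt_source z)
    -- The affine formula must hold in a neighbourhood of each nearby `y`, because it is
    -- differentiated at `y` below.
    filter_upwards [eventually_eventually_nhds.2 hev', hs,
      (isOpen_coordDomain x).mem_nhds hpt] with y h1 h2 h3
    have h4 := h1.self_of_nhds
    have hsx := (extChartAt 𝓘(ℝ, DoubledSpace d) x).map_target h3
    have hmem : K y + b ∈ coordDomain d z := by
      rw [← h4]; exact (extChartAt 𝓘(ℝ, DoubledSpace d) z).map_source h2
    have hsymm : (extChartAt 𝓘(ℝ, DoubledSpace d) z).symm (K y + b) =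
        (extChartAt 𝓘(ℝ, DoubledSpace d) x).symm y := by
      rw [← h4, (extChartAt 𝓘(ℝ, DoubledSpace d) z).left_inv h2]
    refine ⟨hmem, hsymm, fun v => ?_⟩
    rw [K.eq_symm_apply, rep_apply z v hmem, rep_apply x v h3, hsymm]
    set z' := (extChartAt 𝓘(ℝ, DoubledSpace d) x).symm y with hz'
    have h5 : tangentCoordChange 𝓘(ℝ, DoubledSpace d) x z z' =
        (K : DoubledSpace d →L[ℝ] DoubledSpace d) := by
      rw [tangentCoordChange_def, hz', (extChartAt 𝓘(ℝ, DoubledSpace d) x).right_inv h3,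
        ModelWithCorners.range_eq_univ, fderivWithin_univ]
      have h6 : (extChartAt 𝓘(ℝ, DoubledSpace d) z ∘
          (extChartAt 𝓘(ℝ, DoubledSpace d) x).symm) =ᶠ[𝓝 y] fun y => K y + b := h1
      rw [h6.fderiv_eq, fderiv_add_const, K.fderiv]
    have h7 := tangentCoordChange_comp (I := 𝓘(ℝ, DoubledSpace d)) (w := z') (x := x) (y := z)
      (z := z') (v := vec (v z')) ⟨⟨mem_extChartAt_source z', hsx⟩, h2⟩
    rw [h5] at h7
    exact h7

variable [IsDoubledManifold d M]

theorem symm_mem_source {x : M} {y : DoubledSpace d} (hy : y ∈ coordDomain d x) :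
    (extChartAt 𝓘(ℝ, DoubledSpace d) x).symm y ∈ (extChartAt 𝓘(ℝ, DoubledSpace d) x).source :=
  (extChartAt 𝓘(ℝ, DoubledSpace d) x).map_target hy

/-- The transition from the coordinates around `x` to those around the point with coordinates
`y`. -/
theorem exists_transition_symm (x : M) {y : DoubledSpace d} (hy : y ∈ coordDomain d x) :
    ∃ (K : DoubledSpace d ≃L[ℝ] DoubledSpace d) (b : DoubledSpace d),
      (∀ u v, eta (K u) (K v) = eta u v) ∧
      K y + b = coord d ((extChartAt 𝓘(ℝ, DoubledSpace d) x).symm y) ∧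
      ∀ᶠ y' in 𝓝 y, IsTransition x ((extChartAt 𝓘(ℝ, DoubledSpace d) x).symm y) K b y' := by
  have h := exists_transition (d := d) x _ (symm_mem_source hy)
  rwa [(extChartAt 𝓘(ℝ, DoubledSpace d) x).right_inv hy] at h

/-- An affine change has no second derivative, so the chain rule of every order is the plain
transformation of the directions; this is why iterated derivatives of components are tensorial. -/
theorem iteratedFDeriv_affine {E G : Type*} [NormedAddCommGroup E] [NormedSpace ℝ E]
    [NormedAddCommGroup G] [NormedSpace ℝ G] (f : E → G) (K : E ≃L[ℝ] E) (b : E)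
    (T : G ≃L[ℝ] G) (i : ℕ) (y : E) (w : Fin i → E) :
    iteratedFDeriv ℝ i (fun y => T (f (K y + b))) y w =
      T (iteratedFDeriv ℝ i f (K y + b) fun j => K (w j)) := by
  have h1 := T.iteratedFDeriv_comp_left (f := fun y => f (K y + b)) (x := y) (i := i)
  have h2 := K.iteratedFDerivWithin_comp_right (fun y => f (y + b)) (s := Set.univ)
    uniqueDiffOn_univ (x := y) (Set.mem_univ _) i
  have h3 := iteratedFDeriv_comp_add_right (𝕜 := ℝ) (f := f) i b (K y)
  simp only [Function.comp_def] at h1 h2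
  rw [Set.preimage_univ, iteratedFDerivWithin_univ, iteratedFDerivWithin_univ] at h2
  rw [h1, h2]
  simp only [ContinuousLinearMap.compContinuousMultilinearMap_coe, Function.comp_apply,
    ContinuousMultilinearMap.compContinuousLinearMap_apply, h3]
  rfl

/-- `flatDeriv` uses a different chart at every point; by the affine transitions it can be computed
in the single chart around `x`. Smoothness of the result and its further differentiation rest on
this. -/
theorem rep_flatDeriv (x : M) (i : ℕ) (v : RawVectorField d M) (w : Fin i → RawVectorField d M)
    {y : DoubledSpace d} (hy : y ∈ coordDomain d x) :
    rep x (fun z => flatDeriv i v z fun j => w j z) y =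
      iteratedFDeriv ℝ i (rep x v) y fun j => rep x (w j) y := by
  obtain ⟨K, b, hK, hb, hev⟩ := exists_transition_symm x hy
  set z := (extChartAt 𝓘(ℝ, DoubledSpace d) x).symm y with hz
  have h1 : rep x v =ᶠ[𝓝 y] fun y => K.symm (rep z v (K y + b)) := by
    filter_upwards [hev] with y' hy' using hy'.rep_eq v
  have hw : ∀ u : RawVectorField d M, K (rep x u y) = vec (u z) := fun u => by
    rw [hev.self_of_nhds.rep_eq, hb, K.apply_symm_apply, rep_coord]
  rw [(h1.iteratedFDeriv ℝ i).eq_of_nhds, iteratedFDeriv_affine, hev.self_of_nhds.rep_eq, hb, rep_coord]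
  congr 1
  simp only [hw]
  rfl

end Transition

/-! ## Smoothness in coordinates -/

section Smooth

variable {d : ℕ} {M : Type*} [TopologicalSpace M] [ChartedSpace (DoubledSpace d) M]
  [IsManifold 𝓘(ℝ, DoubledSpace d) ∞ M]

theorem contMDiffAt_iff_rep (v : RawVectorField d M) (z : M) :
    ContMDiffAt 𝓘(ℝ, DoubledSpace d) (𝓘(ℝ, DoubledSpace d).prod 𝓘(ℝ, DoubledSpace d)) ∞
      (fun x => TotalSpace.mk' (DoubledSpace d) (E := TangentSpace 𝓘(ℝ, DoubledSpace d)) x (v x)) z ↔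
    ContDiffAt ℝ ∞ (rep z v) (coord d z) := by
  rw [Bundle.contMDiffAt_section]
  set t : M → DoubledSpace d := fun x =>
    (trivializationAt (DoubledSpace d) (TangentSpace 𝓘(ℝ, DoubledSpace d)) z ⟨x, v x⟩).2 with ht
  change ContMDiffAt 𝓘(ℝ, DoubledSpace d) 𝓘(ℝ, DoubledSpace d) ∞ t z ↔ _
  have h1 : ∀ x ∈ (extChartAt 𝓘(ℝ, DoubledSpace d) z).source,
      t x = rep z v (extChartAt 𝓘(ℝ, DoubledSpace d) z x) := by
    intro x hx
    rw [ht]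
    change (trivializationAt (DoubledSpace d) (TangentSpace 𝓘(ℝ, DoubledSpace d)) z ⟨x, v x⟩).2 = _
    rw [rep_apply z v ((extChartAt 𝓘(ℝ, DoubledSpace d) z).map_source hx),
      (extChartAt 𝓘(ℝ, DoubledSpace d) z).left_inv hx, TangentBundle.trivializationAt_apply]
    rfl
  clear_value t
  constructor
  · intro h
    have h2 := (contMDiffAt_iff.1 h).2
    rw [ModelWithCorners.range_eq_univ, contDiffWithinAt_univ] at h2
    have h4 : ContDiffAt ℝ ∞
        (fun y => t ((extChartAt 𝓘(ℝ, DoubledSpace d) z).symm y)) (coord d z) := h2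
    refine h4.congr_of_eventuallyEq ?_
    filter_upwards [(isOpen_coordDomain z).mem_nhds (coord_mem z)] with y hy
    have h3 := h1 _ ((extChartAt 𝓘(ℝ, DoubledSpace d) z).map_target hy)
    rw [(extChartAt 𝓘(ℝ, DoubledSpace d) z).right_inv hy] at h3
    exact h3.symm
  · intro h
    have h2 : ContMDiffAt 𝓘(ℝ, DoubledSpace d) 𝓘(ℝ, DoubledSpace d) ∞
        (fun x => rep z v (extChartAt 𝓘(ℝ, DoubledSpace d) z x)) z := by
      generalize rep z v = r at h ⊢
      have h0 : ContMDiffAt 𝓘(ℝ, DoubledSpace d) 𝓘(ℝ, DoubledSpace d) ∞ r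
        (extChartAt 𝓘(ℝ, DoubledSpace d) z z) := h.contMDiffAt
      exact ContMDiffAt.comp (g := r) z h0 contMDiffAt_extChartAt
    refine h2.congr_of_eventuallyEq ?_
    filter_upwards [(isOpen_extChartAt_source (I := 𝓘(ℝ, DoubledSpace d)) z).mem_nhds
      (mem_extChartAt_source z)] with x hx
    exact h1 x hx

/-- A smooth vector field from its components. -/
def VectorFields.ofRep (v : RawVectorField d M)
    (h : ∀ z : M, ContDiffAt ℝ ∞ (rep z v) (coord d z)) : VectorFields d M where
  toFun := v
  contMDiff_toFun z := (contMDiffAt_iff_rep v z).2 (h z)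

variable [IsDoubledManifold d M]

theorem contDiffOn_rep (x : M) (v : VectorFields d M) :
    ContDiffOn ℝ ∞ (rep x v) (coordDomain d x) := by
  intro y hy
  obtain ⟨K, b, hK, hb, hev⟩ := exists_transition_symm x hy
  set z := (extChartAt 𝓘(ℝ, DoubledSpace d) x).symm y with hz
  have h1 := (contMDiffAt_iff_rep v z).1 (v.contMDiff z)
  have h2 : rep x v =ᶠ[𝓝 y] fun y => K.symm (rep z v (K y + b)) := by
    filter_upwards [hev] with y' hy' using hy'.rep_eq v
  refine (ContDiffAt.congr_of_eventuallyEq ?_ h2).contDiffWithinAt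
  rw [← hb] at h1
  exact K.symm.contDiff.contDiffAt.comp y
    (h1.comp y (K.contDiff.contDiffAt.add contDiffAt_const))

theorem contDiffAt_rep_of_eq {v : RawVectorField d M} {z : M} {g : DoubledSpace d → DoubledSpace d}
    (hg : ContDiffOn ℝ ∞ g (coordDomain d z)) (h : ∀ y ∈ coordDomain d z, rep z v y = g y) :
    ContDiffAt ℝ ∞ (rep z v) (coord d z) := by
  have h1 := (isOpen_coordDomain z).mem_nhds (coord_mem (d := d) z)
  refine (hg.contDiffAt h1).congr_of_eventuallyEq ?_
  filter_upwards [h1] with y hy using h y hy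

theorem rep_add (x : M) (u v : RawVectorField d M) {y : DoubledSpace d}
    (hy : y ∈ coordDomain d x) : rep x (fun z => u z + v z) y = rep x u y + rep x v y := by
  rw [rep_apply x _ hy, rep_apply x _ hy, rep_apply x _ hy]
  exact map_add _ _ _

theorem rep_smul (x : M) (c : M → ℝ) (v : RawVectorField d M) {y : DoubledSpace d}
    (hy : y ∈ coordDomain d x) : rep x (fun z => c z • v z) y =
      c ((extChartAt 𝓘(ℝ, DoubledSpace d) x).symm y) • rep x v y := by
  rw [rep_apply x _ hy, rep_apply x _ hy]
  exact map_smul _ _ _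

theorem rep_sub (x : M) (u v : RawVectorField d M) {y : DoubledSpace d}
    (hy : y ∈ coordDomain d x) : rep x (fun z => u z - v z) y = rep x u y - rep x v y := by
  rw [rep_apply x _ hy, rep_apply x _ hy, rep_apply x _ hy]
  exact map_sub _ _ _

/-- The components of a function in the coordinates around `x`. -/
def frep (x : M) (f : M → ℝ) (y : DoubledSpace d) : ℝ :=
  f ((extChartAt 𝓘(ℝ, DoubledSpace d) x).symm y)

theorem frep_coord (x : M) (f : M → ℝ) : frep x f (coord d x) = f x := by
  rw [frep, coord, extChartAt_to_inv]

theorem contDiffOn_frep (x : M) (f : Functions d M) :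
    ContDiffOn ℝ ∞ (frep x f) (coordDomain d x) :=
  (f.contMDiff.comp_contMDiffOn (contMDiffOn_extChartAt_symm x)).contDiffOn

theorem differential_eq (f : Functions d M) (x : M) (w : TangentSpace 𝓘(ℝ, DoubledSpace d) x) :
    differential f x w = fderiv ℝ (frep x f) (coord d x) (vec w) := by
  rw [differential, (f.contMDiff.mdifferentiableAt (by simp)).mfderiv,
    ModelWithCorners.range_eq_univ, fderivWithin_univ]
  rfl

/-- The differential as a continuous linear form. -/
theorem differential_clm (f : Functions d M) (x : M) :
    differential (d := d) f x = fderiv ℝ (frep x f) (coord d x) :=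
  funext (differential_eq f x)

/-- Here, unlike for `flatDeriv`, the transition has to be an isometry, since an index is raised;
the same holds for `rep_contractDeriv`. -/
theorem rep_etaGrad (x : M) (f : Functions d M) {y : DoubledSpace d} (hy : y ∈ coordDomain d x) :
    rep x (etaGrad f) y = sharp (fderiv ℝ (frep x f) y) := by
  obtain ⟨K, b, hK, hb, hev⟩ := exists_transition_symm x hy
  set z := (extChartAt 𝓘(ℝ, DoubledSpace d) x).symm y with hz
  have h1 : (frep x f) =ᶠ[𝓝 y] fun y => frep z f (K y + b) := by
    filter_upwards [hev] with y' hy'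
    rw [frep, frep, hy'.symm_eq]
  have hd : DifferentiableAt ℝ (frep z f) (K y + b) :=
    (contDiffOn_frep z f).differentiableAt_of_isOpen (isOpen_coordDomain z) hev.self_of_nhds.mem
  have h2 : HasFDerivAt (fun y => frep z f (K y + b))
      ((fderiv ℝ (frep z f) (K y + b)).comp (K : DoubledSpace d →L[ℝ] DoubledSpace d)) y :=
    HasFDerivAt.comp (g := frep z f) y hd.hasFDerivAt (K.hasFDerivAt.add_const b)
  rw [h1.fderiv_eq, h2.fderiv, sharp_comp hK, hev.self_of_nhds.rep_eq, hb, rep_coord, etaGrad,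
    differential_clm]
  rfl

theorem rep_contractDeriv (x : M) (u v : RawVectorField d M) {y : DoubledSpace d}
    (hy : y ∈ coordDomain d x) :
    rep x (contractDeriv u v) y =
      sharp ((etaL d (rep x u y)).comp (fderiv ℝ (rep x v) y)) := by
  apply eq_sharp
  intro w
  obtain ⟨K, b, hK, hb, hev⟩ := exists_transition_symm x hy
  set z := (extChartAt 𝓘(ℝ, DoubledSpace d) x).symm y with hz
  have hw : ∀ u : RawVectorField d M, K (rep x u y) = vec (u z) := fun u => by
    rw [hev.self_of_nhds.rep_eq, hb, K.apply_symm_apply, rep_coord]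
  have hc : vec (contractDeriv u v z) =
      sharp ((etaL d (vec (u z))).comp (fderiv ℝ (rep z v) (coord d z))) := by
    change sharp (fun w => eta (vec (u z)) (iteratedFDeriv ℝ 1 (rep z v) (coord d z) ![w])) = _
    congr 1
    funext w
    rw [ContinuousLinearMap.comp_apply, etaL_apply, iteratedFDeriv_one_apply]
    rfl
  have h1 : rep x v =ᶠ[𝓝 y] fun y => K.symm (rep z v (K y + b)) := by
    filter_upwards [hev] with y' hy' using hy'.rep_eq v
  have h2 : fderiv ℝ (rep x v) y w = K.symm (fderiv ℝ (rep z v) (coord d z) (K w)) := by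
    have h3 := iteratedFDeriv_affine (rep z v) K b K.symm 1 y ![w]
    rw [iteratedFDeriv_one_apply, iteratedFDeriv_one_apply] at h3
    rw [h1.fderiv_eq, ← hb]
    exact h3
  rw [← hK, hw, hc, eta_sharp, ContinuousLinearMap.comp_apply, ContinuousLinearMap.comp_apply,
    etaL_apply, etaL_apply, h2, ← hK (rep x u y), hw, K.apply_symm_apply]

/-- At `x` the derivative of the chart around `x` is the identity, so the bracket of the manifold is
the coordinate bracket of components. -/
theorem mlieBracket_eq (u v : RawVectorField d M) (x : M) :
    VectorField.mlieBracket 𝓘(ℝ, DoubledSpace d) u v x =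
      dirDeriv u v x - dirDeriv v u x := by
  have h : vec (VectorField.mlieBracket 𝓘(ℝ, DoubledSpace d) u v x) =
      VectorField.lieBracketWithin ℝ (rep x u) (rep x v) (Set.univ ∩ Set.univ) (coord d x) := by
    rw [← VectorField.mlieBracketWithin_univ, VectorField.mlieBracketWithin_apply,
      mfderiv_extChartAt_self]
    change (ContinuousLinearMap.id ℝ (DoubledSpace d)).inverse
      (VectorField.lieBracketWithin ℝ (rep x u) (rep x v) (Set.univ ∩ Set.range id)
        (coord d x)) = _
    rw [ContinuousLinearMap.inverse_id, Set.range_id]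
    rfl
  have h2 : ∀ u v : RawVectorField d M, vec (dirDeriv u v x) =
      fderiv ℝ (rep x v) (coord d x) (rep x u (coord d x)) := fun u v => by
    change iteratedFDeriv ℝ 1 (rep x v) (coord d x) ![vec (u x)] = _
    rw [iteratedFDeriv_one_apply, rep_coord]
    rfl
  apply vec_injective
  rw [vec_sub, h, h2, h2, Set.univ_inter, VectorField.lieBracketWithin_univ, VectorField.lieBracket]

end Smooth

theorem splitSum_list_map {X Y W : Type*} [AddCommGroup W] (φ : X → Y) (G : List Y → List Y → W)
    (A B l : List X) :
    splitSum G (A.map φ) (B.map φ) (l.map φ) =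
      splitSum (fun A B => G (A.map φ) (B.map φ)) A B l := by
  induction l generalizing A B with
  | nil => rfl
  | cons x l ih =>
    simp only [List.map_cons, splitSum]
    rw [← ih, ← ih]
    simp only [List.map_append, List.map_cons, List.map_nil]

/-! ## Smooth vector fields built from components -/

section Multilinear

variable {E G : Type*} [NormedAddCommGroup E] [NormedSpace ℝ E] [NormedAddCommGroup G]
  [NormedSpace ℝ G] {U : Set E}

theorem iteratedFDeriv_eq_ider_ofFn (hU : IsOpen U) {f : E → G} (hf : ContDiffOn ℝ ∞ f U) {n : ℕ}
    (w : Fin n → E) {y : E} (hy : y ∈ U) :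
    iteratedFDeriv ℝ n f y w = ider (List.ofFn w) f y := by
  have key : ∀ (l : List E) (n : ℕ) (h : n = l.length) (w : Fin n → E),
      (w = fun i => l.get (Fin.cast h i)) → iteratedFDeriv ℝ n f y w = ider l f y := by
    rintro l n rfl w rfl
    exact iteratedFDeriv_eq_ider hU hf l y hy
  refine key (List.ofFn w) n (by simp) w ?_
  funext i
  simp

set_option synthInstance.maxHeartbeats 100000 in
theorem ContDiffOn.continuousMultilinearMap_apply {n : ℕ}
    {g : E → ContinuousMultilinearMap ℝ (fun _ : Fin n => E) G} {w : Fin n → E → E}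
    (hg : ContDiffOn ℝ ∞ g U) (hw : ∀ i, ContDiffOn ℝ ∞ (w i) U) :
    ContDiffOn ℝ ∞ (fun y => g y fun i => w i y) U := by
  induction n with
  | zero =>
    have h := (continuousMultilinearCurryFin0 ℝ E G).contDiff.comp_contDiffOn (n := ∞) hg
    refine h.congr fun y _ => ?_
    simp only [Function.comp_apply, continuousMultilinearCurryFin0_apply]
    congr 1
    exact Subsingleton.elim _ _
  | succ n ih =>
    have h0 : ContDiff ℝ ∞ (continuousMultilinearCurryLeftEquiv ℝ (fun _ : Fin (n + 1) => E) G) :=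
      LinearIsometryEquiv.contDiff _
    have h1 : ContDiffOn ℝ ∞ (fun y => (g y).curryLeft) U := h0.comp_contDiffOn hg
    have h2 := ih (g := fun y => (g y).curryLeft (w 0 y)) (w := fun i => w i.succ)
      (h1.clm_apply (hw 0)) (fun i => hw i.succ)
    refine h2.congr fun y _ => ?_
    rw [ContinuousMultilinearMap.curryLeft_apply]
    congr 1
    funext i
    refine Fin.cases ?_ (fun j => ?_) i <;> simp

theorem ContDiffOn.iteratedFDeriv_of_isOpen (hU : IsOpen U) {f : E → G} (hf : ContDiffOn ℝ ∞ f U)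
    (n : ℕ) : ContDiffOn ℝ ∞ (iteratedFDeriv ℝ n f) U := fun y hy =>
  ((hf.contDiffAt (hU.mem_nhds hy)).iteratedFDeriv_right (m := ∞) (i := n) le_rfl).contDiffWithinAt

end Multilinear

/-! ### Iterated flat derivatives as smooth vector fields. -/

section Smooth

variable {d : ℕ} {M : Type*} [TopologicalSpace M] [ChartedSpace (DoubledSpace d) M]
  [IsManifold 𝓘(ℝ, DoubledSpace d) ∞ M] [IsDoubledManifold d M]

/-- The components of vector fields at a point. -/
def comps (hs : List (VectorFields d M)) (z : M) : List (DoubledSpace d) :=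
  hs.map fun h : VectorFields d M => vec (h z)

/-- The components of vector fields in the coordinates around `x`. -/
def repList (x : M) (y : DoubledSpace d) (hs : List (VectorFields d M)) : List (DoubledSpace d) :=
  hs.map fun h : VectorFields d M => rep x h y

theorem ofFn_comps (hs : List (VectorFields d M)) (z : M) :
    (List.ofFn fun j => vec (hs.get j z)) = comps hs z :=
  List.ofFn_getElem_eq_map hs fun h : VectorFields d M => vec (h z)

theorem ofFn_repList (x : M) (y : DoubledSpace d) (hs : List (VectorFields d M)) :
    (List.ofFn fun j => rep x (hs.get j) y) = repList x y hs :=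
  List.ofFn_getElem_eq_map hs fun h : VectorFields d M => rep x h y

theorem flatDeriv_eq_ider (v : VectorFields d M) (z : M) {n : ℕ}
    (w : Fin n → TangentSpace 𝓘(ℝ, DoubledSpace d) z) :
    vec (flatDeriv n v z w) = ider (List.ofFn fun j => vec (w j)) (rep z v) (coord d z) :=
  iteratedFDeriv_eq_ider_ofFn (isOpen_coordDomain z) (contDiffOn_rep z v) _ (coord_mem z)

/-- `h_1 ⋯ h_k ∂_1 ⋯ ∂_k v`, as a family of tangent vectors. -/
def iterDerivRaw (hs : List (VectorFields d M)) (v : VectorFields d M) : RawVectorField d M :=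
  fun z => (ider (comps hs z) (rep z v) (coord d z) : DoubledSpace d)

theorem rep_flatDeriv_list (x : M) (hs : List (VectorFields d M)) (v : VectorFields d M)
    {y : DoubledSpace d} (hy : y ∈ coordDomain d x) :
    rep x (iterDerivRaw hs v) y =
      ider (repList x y hs) (rep x v) y := by
  have h1 : iterDerivRaw hs v =
      fun z => flatDeriv hs.length v z fun j => hs.get j z := by
    funext z
    apply vec_injective
    rw [flatDeriv_eq_ider, ofFn_comps]
    rfl
  rw [h1, rep_flatDeriv x hs.length v (fun j => hs.get j) hy,
    iteratedFDeriv_eq_ider_ofFn (isOpen_coordDomain x) (contDiffOn_rep x v) _ hy,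
    ofFn_repList]

/-- `h_1 ⋯ h_k ∂_1 ⋯ ∂_k v` -/
def iterDeriv (hs : List (VectorFields d M)) (v : VectorFields d M) : VectorFields d M :=
  VectorFields.ofRep (iterDerivRaw hs v) fun z => by
    refine contDiffAt_rep_of_eq (g := fun y => ider (repList z y hs) (rep z v) y) ?_
      fun y hy => rep_flatDeriv_list z hs v hy
    have h := ContDiffOn.continuousMultilinearMap_apply
      ((contDiffOn_rep z v).iteratedFDeriv_of_isOpen (isOpen_coordDomain z) hs.length)
      (w := fun i => rep z (hs.get i)) (fun i => contDiffOn_rep z _)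
    refine h.congr fun y hy => ?_
    rw [iteratedFDeriv_eq_ider_ofFn (isOpen_coordDomain z) (contDiffOn_rep z v) _ hy,
      ofFn_repList]

theorem vec_iterDeriv (hs : List (VectorFields d M)) (v : VectorFields d M) (z : M) :
    vec (iterDeriv hs v z) = ider (comps hs z) (rep z v) (coord d z) := rfl

theorem rep_iterDeriv (x : M) (hs : List (VectorFields d M)) (v : VectorFields d M)
    {y : DoubledSpace d} (hy : y ∈ coordDomain d x) :
    rep x (iterDeriv hs v) y = ider (repList x y hs) (rep x v) y :=
  rep_flatDeriv_list x hs v hy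

theorem iterDeriv_ofFn {n : ℕ} (h : Fin n → VectorFields d M) (v : VectorFields d M) (z : M) :
    iterDeriv (List.ofFn h) v z = flatDeriv n v z fun j => h j z := by
  apply vec_injective
  rw [vec_iterDeriv, flatDeriv_eq_ider, comps, List.map_ofFn]
  rfl

/-- `η^{-1}(df)` -/
def etaGradField (f : Functions d M) : VectorFields d M :=
  VectorFields.ofRep (etaGrad f) fun z =>
    contDiffAt_rep_of_eq (g := fun y => sharpL d (fderiv ℝ (frep z f) y))
      ((sharpL d).contDiff.comp_contDiffOn
        ((contDiffOn_frep z f).fderiv_of_isOpen (isOpen_coordDomain z) (by simp)))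
      fun y hy => rep_etaGrad z f hy

/-- `u_C η^{AB} ∂_A v^C ∂_B` -/
def contractField (u v : VectorFields d M) : VectorFields d M :=
  VectorFields.ofRep (contractDeriv u v) fun z =>
    contDiffAt_rep_of_eq
      (g := fun y => sharpL d ((etaL d (rep z u y)).comp (fderiv ℝ (rep z v) y)))
      ((sharpL d).contDiff.comp_contDiffOn
        (((etaL d).contDiff.comp_contDiffOn (contDiffOn_rep z u)).clm_comp
          ((contDiffOn_rep z v).fderiv_of_isOpen (isOpen_coordDomain z) (by simp))))
      fun y hy => rep_contractDeriv z u v hy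

theorem coe_etaGradField (f : Functions d M) : (etaGradField f : RawVectorField d M) = etaGrad f :=
  rfl

theorem coe_contractField (u v : VectorFields d M) :
    (contractField u v : RawVectorField d M) = contractDeriv u v := rfl

theorem vec_etaGrad (f : Functions d M) (z : M) :
    vec (etaGrad (d := d) f z) = sharp (fderiv ℝ (frep z f) (coord d z)) := by
  rw [← rep_coord, rep_etaGrad z f (coord_mem z)]

theorem vec_contractDeriv (u v : RawVectorField d M) (z : M) :
    vec (contractDeriv u v z) =
      sharp ((etaL d (vec (u z))).comp (fderiv ℝ (rep z v) (coord d z))) := by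
  rw [← rep_coord, rep_contractDeriv z u v (coord_mem z), rep_coord]

theorem VectorFields.ext_rep {u v : VectorFields d M}
    (h : ∀ z, vec (u z) = vec (v z)) : u = v :=
  ContMDiffSection.ext fun z => vec_injective z (h z)

theorem eventuallyEq_rep_add (z : M) (u v : VectorFields d M) :
    ∀ y ∈ coordDomain d z, rep z (u + v : VectorFields d M) y = rep z u y + rep z v y :=
  fun _ hy => rep_add z u v hy

theorem eventuallyEq_rep_smul (z : M) (c : ℝ) (v : VectorFields d M) :
    ∀ y ∈ coordDomain d z, rep z (c • v : VectorFields d M) y = c • rep z v y :=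
  fun _ hy => rep_smul z (fun _ => c) v hy

theorem eq_of_forall_mem_fderiv {E G : Type*} [NormedAddCommGroup E] [NormedSpace ℝ E]
    [NormedAddCommGroup G] [NormedSpace ℝ G] {U : Set E} (hU : IsOpen U) {f g : E → G}
    (h : ∀ y ∈ U, f y = g y) {y : E} (hy : y ∈ U) : fderiv ℝ f y = fderiv ℝ g y :=
  Filter.EventuallyEq.fderiv_eq (by filter_upwards [hU.mem_nhds hy] with y hy using h y hy)

theorem differentiableAt_rep (z : M) (v : VectorFields d M) :
    DifferentiableAt ℝ (rep z v) (coord d z) :=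
  (contDiffOn_rep z v).differentiableAt_of_isOpen (isOpen_coordDomain z) (coord_mem z)

theorem differentiableAt_frep (z : M) (f : Functions d M) :
    DifferentiableAt ℝ (frep z f) (coord d z) :=
  (contDiffOn_frep z f).differentiableAt_of_isOpen (isOpen_coordDomain z) (coord_mem z)

theorem fderiv_rep_add (z : M) (u v : VectorFields d M) :
    fderiv ℝ (rep z (u + v : VectorFields d M)) (coord d z) =
      fderiv ℝ (rep z u) (coord d z) + fderiv ℝ (rep z v) (coord d z) := by
  rw [eq_of_forall_mem_fderiv (isOpen_coordDomain z) (eventuallyEq_rep_add z u v) (coord_mem z)]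
  exact fderiv_add (differentiableAt_rep z u) (differentiableAt_rep z v)

theorem fderiv_rep_smul (z : M) (c : ℝ) (v : VectorFields d M) :
    fderiv ℝ (rep z (c • v : VectorFields d M)) (coord d z) =
      c • fderiv ℝ (rep z v) (coord d z) := by
  rw [eq_of_forall_mem_fderiv (isOpen_coordDomain z) (eventuallyEq_rep_smul z c v) (coord_mem z)]
  exact fderiv_const_smul (differentiableAt_rep z v) c

theorem fderiv_frep_add (z : M) (f g : Functions d M) :
    fderiv ℝ (frep z (f + g : Functions d M)) (coord d z) =
      fderiv ℝ (frep z f) (coord d z) + fderiv ℝ (frep z g) (coord d z) :=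
  fderiv_add (differentiableAt_frep z f) (differentiableAt_frep z g)

theorem fderiv_frep_smul (z : M) (c : ℝ) (f : Functions d M) :
    fderiv ℝ (frep z (c • f : Functions d M)) (coord d z) =
      c • fderiv ℝ (frep z f) (coord d z) :=
  fderiv_const_smul (differentiableAt_frep z f) c

/-- The iterated derivative as a linear map of the differentiated field. -/
def iterDerivL (hs : List (VectorFields d M)) : VectorFields d M →ₗ[ℝ] VectorFields d M where
  toFun := iterDeriv hs
  map_add' u v := VectorFields.ext_rep fun z => by
    rw [vec_iterDeriv, ider_congr (isOpen_coordDomain z) (eventuallyEq_rep_add z u v) _ _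
      (coord_mem z), ider_add (isOpen_coordDomain z) (contDiffOn_rep z u) (contDiffOn_rep z v) _ _
      (coord_mem z)]
    rfl
  map_smul' c v := VectorFields.ext_rep fun z => by
    rw [vec_iterDeriv, ider_congr (isOpen_coordDomain z) (eventuallyEq_rep_smul z c v) _ _
      (coord_mem z), ider_const_smul (isOpen_coordDomain z) (contDiffOn_rep z v) _ _ _
      (coord_mem z)]
    rfl

theorem vec_coe_add (u v : VectorFields d M) (z : M) :
    vec ((u + v : VectorFields d M) z) = vec (u z) + vec (v z) := rfl

theorem vec_coe_smul (c : ℝ) (v : VectorFields d M) (z : M) :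
    vec ((c • v : VectorFields d M) z) = c • vec (v z) := rfl

theorem isSignedSymm_iterDeriv (v : VectorFields d M) :
    IsSignedSymm 1 (fun hs => iterDeriv hs v) where
  add a b x y := VectorFields.ext_rep fun z => by
    have h := (isSignedSymm_ider (isOpen_coordDomain z) (contDiffOn_rep z v) (coord_mem z)).add
      (comps a z) (comps b z) (vec (x z)) (vec (y z))
    simpa only [vec_iterDeriv, comps, List.map_append, List.map_cons, vec_coe_add,
      vec_coe_smul] using h
  smul a b c x := VectorFields.ext_rep fun z => by
    have h := (isSignedSymm_ider (isOpen_coordDomain z) (contDiffOn_rep z v) (coord_mem z)).smul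
      (comps a z) (comps b z) c (vec (x z))
    simpa only [vec_iterDeriv, comps, List.map_append, List.map_cons, vec_coe_add,
      vec_coe_smul] using h
  swap a b x y := VectorFields.ext_rep fun z => by
    have h := (isSignedSymm_ider (isOpen_coordDomain z) (contDiffOn_rep z v) (coord_mem z)).swap
      (comps a z) (comps b z) (vec (x z)) (vec (y z))
    simpa only [vec_iterDeriv, comps, List.map_append, List.map_cons, one_smul] using h

/-- The outer derivatives at `z` need the components of the inner derivative in one chart near `z`,
which `rep_iterDeriv` provides; then `ider_leibniz` applies pointwise. -/
theorem iterDeriv_leibniz (hs : List (VectorFields d M)) (u v : VectorFields d M) :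
    iterDeriv hs (iterDeriv [u] v) =
      splitSum (fun A B => iterDeriv (iterDeriv A u :: B) v) [] [] hs := by
  refine VectorFields.ext_rep fun z => ?_
  let φ : VectorFields d M →+ DoubledSpace d :=
    { toFun := fun v => vec (v z), map_zero' := rfl, map_add' := fun _ _ => rfl }
  have h1 : vec (splitSum (fun A B => iterDeriv (iterDeriv A u :: B) v) [] [] hs z) =
      splitSum (fun A B => φ (iterDeriv (iterDeriv A u :: B) v)) [] [] hs :=
    (splitSum_map φ _ _ _ _).symm
  rw [h1, vec_iterDeriv, ider_congr (isOpen_coordDomain z)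
    (g := fun y => fderiv ℝ (rep z v) y (rep z u y)) (fun y hy => rep_iterDeriv z [u] v hy) _ _
    (coord_mem z), ider_leibniz (isOpen_coordDomain z) (contDiffOn_rep z v) (contDiffOn_rep z u) _ _
    (coord_mem z)]
  exact splitSum_list_map (fun h : VectorFields d M => vec (h z)) _ [] [] hs

end Smooth

/-! ## The flat calculus of a bundle with bracket, form and anchor -/

section Smooth

variable {d : ℕ} {M : Type*} [TopologicalSpace M] [ChartedSpace (DoubledSpace d) M]
  [IsManifold 𝓘(ℝ, DoubledSpace d) ∞ M] [IsDoubledManifold d M]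

/-- `½ η^{-1}(df)` as a linear map. -/
def halfEtaGrad : Functions d M →ₗ[ℝ] VectorFields d M where
  toFun f := (1 / 2 : ℝ) • etaGradField f
  map_add' f g := VectorFields.ext_rep fun z => by
    rw [vec_coe_add, vec_coe_smul, vec_coe_smul, vec_coe_smul, coe_etaGradField, coe_etaGradField,
      coe_etaGradField, vec_etaGrad, vec_etaGrad, vec_etaGrad, fderiv_frep_add, ← smul_add]
    rfl
  map_smul' c f := VectorFields.ext_rep fun z => by
    rw [vec_coe_smul, vec_coe_smul, vec_coe_smul, coe_etaGradField, coe_etaGradField, vec_etaGrad,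
      vec_etaGrad, fderiv_frep_smul, smul_comm]
    rfl

/-- `u_C η^{AB} ∂_A v^C ∂_B` as a bilinear map. -/
def contractL : VectorFields d M →ₗ[ℝ] VectorFields d M →ₗ[ℝ] VectorFields d M :=
  LinearMap.mk₂ ℝ contractField
    (fun u u' v => VectorFields.ext_rep fun z => by
      rw [vec_coe_add, coe_contractField, coe_contractField, coe_contractField, vec_contractDeriv,
        vec_contractDeriv, vec_contractDeriv, vec_coe_add, map_add, ContinuousLinearMap.add_comp]
      rfl)
    (fun c u v => VectorFields.ext_rep fun z => by
      rw [vec_coe_smul, coe_contractField, coe_contractField, vec_contractDeriv,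
        vec_contractDeriv, vec_coe_smul, map_smul, ContinuousLinearMap.smul_comp]
      rfl)
    (fun u v v' => VectorFields.ext_rep fun z => by
      rw [vec_coe_add, coe_contractField, coe_contractField, coe_contractField, vec_contractDeriv,
        vec_contractDeriv, vec_contractDeriv, fderiv_rep_add, ContinuousLinearMap.comp_add]
      rfl)
    (fun c u v => VectorFields.ext_rep fun z => by
      rw [vec_coe_smul, coe_contractField, coe_contractField, vec_contractDeriv,
        vec_contractDeriv, fderiv_rep_smul, ContinuousLinearMap.comp_smul]
      rfl)

end Smooth

namespace BracketBundle

variable {d : ℕ} {M : Type*} [TopologicalSpace M] [ChartedSpace (DoubledSpace d) M]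
  [IsManifold 𝓘(ℝ, DoubledSpace d) ∞ M]
  {F : Type*} [NormedAddCommGroup F] [NormedSpace ℝ F]
  {V : M → Type*} [TopologicalSpace (TotalSpace F V)]
  [∀ x, AddCommGroup (V x)] [∀ x, Module ℝ (V x)] [∀ x, TopologicalSpace (V x)]
  [∀ x, IsTopologicalAddGroup (V x)] [∀ x, ContinuousSMul ℝ (V x)]
  [FiberBundle F V] [VectorBundle ℝ F V]
  [ContMDiffVectorBundle ∞ F V 𝓘(ℝ, DoubledSpace d)]
  (A : BracketBundle d M F V)

theorem form_ext {x : M} {v v' : V x} (h : ∀ w, A.form x v w = A.form x v' w) : v = v' := by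
  rw [← sub_eq_zero]
  apply A.form_nondeg
  intro w
  rw [map_sub, _root_.sub_apply, h, sub_self]

theorem rho_apply (a : Sections d F V) (x : M) : A.rho a x = A.anchor x (a x) := rfl

/-- The anchor on sections as a linear map. -/
def rhoL : Sections d F V →ₗ[ℝ] VectorFields d M where
  toFun := A.rho
  map_add' a b := ContMDiffSection.ext fun x => map_add (A.anchor x) (a x) (b x)
  map_smul' c a := ContMDiffSection.ext fun x => map_smul (A.anchor x) c (a x)

/-- The form on sections as a bilinear map. -/
def pairL : Sections d F V →ₗ[ℝ] Sections d F V →ₗ[ℝ] Functions d M :=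
  LinearMap.mk₂ ℝ A.pair
    (fun a b c => ContMDiffMap.ext fun x => by
      change A.form x (a x + b x) (c x) = A.form x (a x) (c x) + A.form x (b x) (c x)
      rw [map_add]; rfl)
    (fun r a c => ContMDiffMap.ext fun x => by
      change A.form x (r • a x) (c x) = r • A.form x (a x) (c x)
      rw [map_smul]; rfl)
    (fun a b c => ContMDiffMap.ext fun x => map_add (A.form x (a x)) (b x) (c x))
    (fun r a c => ContMDiffMap.ext fun x => map_smul (A.form x (a x)) r (c x))

variable [FiniteDimensional ℝ F]

theorem form_D (f : Functions d M) (x : M) (v : V x) :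
    A.form x (A.D f x) v = 1 / 2 * differential f x (A.anchor x v) :=
  (A.exists_D f).choose_spec x v

variable [IsDoubledManifold d M]

/-- `D` as a linear map. -/
def DL : Functions d M →ₗ[ℝ] Sections d F V where
  toFun := A.D
  map_add' f g := ContMDiffSection.ext fun x => A.form_ext fun w => by
    change _ = A.form x (A.D f x + A.D g x) w
    rw [map_add, _root_.add_apply, form_D, form_D, form_D, ← mul_add, differential_eq,
      differential_eq, differential_eq, fderiv_frep_add]
    rfl
  map_smul' c f := ContMDiffSection.ext fun x => A.form_ext fun w => by
    change _ = A.form x (c • A.D f x) w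
    rw [map_smul, _root_.smul_apply, form_D, form_D, differential_eq,
      differential_eq, fderiv_frep_smul, smul_eq_mul, _root_.smul_apply, smul_eq_mul]
    ring

/-- The failure `SC_ρ` of the anchor to be a morphism, as a bilinear map. -/
def SCL : Sections d F V →ₗ[ℝ] Sections d F V →ₗ[ℝ] VectorFields d M :=
  (1 / 2 : ℝ) • contractL.compl₁₂ A.rhoL A.rhoL -
    (1 / 2 : ℝ) • (contractL.compl₁₂ A.rhoL A.rhoL).flip

/-- The flat calculus of a bundle with bracket, form and anchor on a doubled manifold. -/
def calculus : FlatCalculus (Functions d M) (Sections d F V) (VectorFields d M) where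
  pd := iterDerivL
  pd_nil v := VectorFields.ext_rep fun z => rep_coord z v
  pd_symm := isSignedSymm_iterDeriv
  pd_leibniz := iterDeriv_leibniz
  D := A.DL
  br := A.bracket
  br_skew := A.bracket_skew
  pr := A.pairL
  pr_symm a b := ContMDiffMap.ext fun x => A.form_symm x _ _
  rho := A.rhoL
  grad := halfEtaGrad
  SC := A.SCL
  SC_skew a b := by
    simp only [SCL, LinearMap.sub_apply, LinearMap.smul_apply, LinearMap.flip_apply, neg_sub]

theorem coe_SCL (a b : Sections d F V) (x : M) : A.SCL a b x = A.SCrho a b x := rfl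

theorem coe_halfEtaGrad (f : Functions d M) (x : M) :
    halfEtaGrad f x = (1 / 2 : ℝ) • etaGrad (d := d) f x := rfl

theorem coe_iterDeriv_single (u v : VectorFields d M) (x : M) :
    iterDeriv [u] v x = dirDeriv u v x := by
  have h := iterDeriv_ofFn (fun _ : Fin 1 => u) v x
  refine h.trans ?_
  rw [dirDeriv]
  congr 1
  funext i
  fin_cases i
  rfl

theorem coe_lie (u v : VectorFields d M) (x : M) :
    A.calculus.lie u v x = lie (u : RawVectorField d M) v x := by
  rw [lie, mlieBracket_eq, ← coe_iterDeriv_single, ← coe_iterDeriv_single]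
  rfl

end BracketBundle

/-! ## The extended brackets -/

namespace FlatCalculus

variable {𝓕 𝓔 𝓗 : Type*} [AddCommGroup 𝓕] [Module ℝ 𝓕] [AddCommGroup 𝓔]
    [Module ℝ 𝓔] [AddCommGroup 𝓗] [Module ℝ 𝓗] (Q : FlatCalculus 𝓕 𝓔 𝓗)

theorem mu_eq_base {n : ℕ} {l : Fin n → 𝓕 × 𝓔 × 𝓗 × ℝ} (hs : List 𝓗) (zs : List ℝ) (es : List 𝓔)
    (fs : List 𝓕) (hz : ∀ r ∈ zs, r = 1)
    (h : List.ofFn l = (sortedArgs hs zs es fs).map Arg.val) :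
    Q.mu n l = Q.base hs zs.length es fs := by
  rw [Q.mu.congr_ofFn (l' := fun i => ((sortedArgs hs zs es fs).get i).val), Q.mu_sorted hz]
  · exact List.ofFn_get _
  · rw [h]
    exact (List.ofFn_getElem_eq_map _ _).symm

end FlatCalculus

namespace BracketBundle

variable {d : ℕ} {M : Type*} [TopologicalSpace M] [ChartedSpace (DoubledSpace d) M]
  [IsManifold 𝓘(ℝ, DoubledSpace d) ∞ M]
  {F : Type*} [NormedAddCommGroup F] [NormedSpace ℝ F]
  {V : M → Type*} [TopologicalSpace (TotalSpace F V)]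
  [∀ x, AddCommGroup (V x)] [∀ x, Module ℝ (V x)] [∀ x, TopologicalSpace (V x)]
  [∀ x, IsTopologicalAddGroup (V x)] [∀ x, ContinuousSMul ℝ (V x)]
  [FiberBundle F V] [VectorBundle ℝ F V]
  [ContMDiffVectorBundle ∞ F V 𝓘(ℝ, DoubledSpace d)]
  (A : BracketBundle d M F V)
  [FiniteDimensional ℝ F] [IsDoubledManifold d M]

theorem IsVectorField.congr {l : ExtSpace d M F V} {u v : RawVectorField d M}
    (h : IsVectorField l u) (huv : ∀ x, u x = v x) : IsVectorField l v := by
  obtain ⟨w, hw, hu⟩ := h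
  exact ⟨w, hw, fun x => (hu x).trans (huv x)⟩

theorem isVectorField_iterDeriv {l : ExtSpace d M F V} {i : ℕ} (h : Fin i → VectorFields d M)
    (v : VectorFields d M) {w : RawVectorField d M} (hw : ∀ x, v x = w x)
    (hl : l = (0, 0, iterDeriv (List.ofFn h) v, 0)) :
    IsVectorField l (fun x => flatDeriv i w x fun j => h j x) := by
  obtain rfl : (v : RawVectorField d M) = w := funext hw
  exact ⟨_, hl, fun x => iterDeriv_ofFn h v x⟩

theorem ofFn_append_inH {i m : ℕ} (h : Fin i → VectorFields d M)
    (l : Fin m → ExtSpace d M F V) :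
    List.ofFn (Fin.append (fun j => inH (h j)) l) =
      ((List.ofFn h).map Arg.h).map Arg.val ++ List.ofFn l := by
  rw [List.ofFn_fin_append, List.map_map, List.map_ofFn]
  rfl

theorem hasExtendedBrackets_mu : A.HasExtendedBrackets A.calculus.mu where
  mu_curvature := by
    rw [A.calculus.mu_eq_base [] [] [] [] (by simp) (by simp [sortedArgs])]
    simp [FlatCalculus.base, onNil, onOne, onTwo, onThree, onFour, muZero]
  mu_f f := by
    rw [A.calculus.mu_eq_base [] [] [] [f] (by simp) rfl]
    simp [FlatCalculus.base, onNil, onOne, onTwo, onThree, onFour, inE]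
    rfl
  mu_ee a b := by
    rw [A.calculus.mu_eq_base [] [] [a, b] [] (by simp) rfl]
    simp [FlatCalculus.base, onNil, onOne, onTwo, onThree, onFour, inE]
    rfl
  mu_ef a f := by
    rw [A.calculus.mu_eq_base [] [] [a] [f] (by simp) rfl]
    simp [FlatCalculus.base, onNil, onOne, onTwo, onThree, onFour, inF]
    rfl
  mu_eee a b c := by
    rw [A.calculus.mu_eq_base [] [] [a, b, c] [] (by simp) rfl]
    simp [FlatCalculus.base, onNil, onOne, onTwo, onThree, onFour, inF]
    rfl
  mu_0ef a f := by
    rw [A.calculus.mu_eq_base [] [1] [a] [f] (by simp) rfl]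
    simp [FlatCalculus.base, onNil, onOne, onTwo, onThree, onFour, inE]
    rfl
  mu_0ff f g := by
    rw [A.calculus.mu_eq_base [] [1] [] [f, g] (by simp) rfl]
    simp [FlatCalculus.base, onNil, onOne, onTwo, onThree, onFour, inF]
    rfl
  mu_0eee a b c := by
    rw [A.calculus.mu_eq_base [] [1] [a, b, c] [] (by simp) rfl]
    simp [FlatCalculus.base, onNil, onOne, onTwo, onThree, onFour, inE]
    rfl
  mu_0eeee a b c e := by
    rw [A.calculus.mu_eq_base [] [1] [a, b, c, e] [] (by simp) rfl]
    simp [FlatCalculus.base, onNil, onOne, onTwo, onThree, onFour, inF, -one_div]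
    rfl
  mu_he i h e := by
    refine isVectorField_iterDeriv h (A.rho e) (fun _ => rfl) ?_
    rw [A.calculus.mu_eq_base (List.ofFn h) [] [e] [] (by simp)
      (by rw [ofFn_append_inH, sortedArgs, List.map_append]; rfl)]
    generalize List.ofFn h = hs
    cases hs <;> simp [FlatCalculus.base, onNil, onOne, onTwo, onThree, onFour] <;> rfl
  mu_h0f i h f := by
    refine IsVectorField.congr (isVectorField_iterDeriv (w := fun x => halfEtaGrad f x) h
      (halfEtaGrad f) (fun _ => rfl) ?_) ?_
    · rw [A.calculus.mu_eq_base (List.ofFn h) [1] [] [f] (by simp)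
        (by rw [ofFn_append_inH, sortedArgs, List.map_append]; rfl)]
      generalize List.ofFn h = hs
      cases hs <;> simp [FlatCalculus.base, onNil, onOne, onTwo, onThree, onFour] <;> rfl
    · intro x
      rw [← iterDeriv_ofFn, ← coe_etaGradField, ← iterDeriv_ofFn]
      exact DFunLike.congr_fun ((iterDerivL (List.ofFn h)).map_smul (1 / 2 : ℝ) (etaGradField f)) x
  mu_h0ee i h a b := by
    refine isVectorField_iterDeriv h (A.SCL a b) (A.coe_SCL a b) ?_
    rw [A.calculus.mu_eq_base (List.ofFn h) [1] [a, b] [] (by simp)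
      (by rw [ofFn_append_inH, sortedArgs, List.map_append]; rfl)]
    generalize List.ofFn h = hs
    cases hs <;> simp [FlatCalculus.base, onNil, onOne, onTwo, onThree, onFour] <;> rfl
  mu_other n deg l hl h := A.calculus.mu_eq_zero_of_not_listed hl h

theorem IsVectorField.unique {l l' : ExtSpace d M F V} {v : RawVectorField d M}
    (h : IsVectorField l v) (h' : IsVectorField l' v) : l = l' := by
  obtain ⟨u, rfl, hu⟩ := h
  obtain ⟨u', rfl, hu'⟩ := h'
  rw [ContMDiffSection.ext fun x => (hu x).trans (hu' x).symm]

theorem cases_of_mem_listedTypes {a b c z : ℕ} (h : (a, b, c, z) ∈ listedTypes) :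
    (z = 0 ∧ c = 0 ∧ (a = 0 ∧ b = 0 ∨ a = 1 ∧ b = 0 ∨ a = 0 ∧ b = 2 ∨ a = 1 ∧ b = 1 ∨
      a = 0 ∧ b = 3)) ∨
    (z = 1 ∧ c = 0 ∧ (a = 1 ∧ b = 1 ∨ a = 2 ∧ b = 0 ∨ a = 0 ∧ b = 3 ∨ a = 0 ∧ b = 4)) ∨
    (z = 0 ∧ a = 0 ∧ b = 1) ∨ (z = 1 ∧ a = 1 ∧ b = 0) ∨ (z = 1 ∧ a = 0 ∧ b = 2) := by
  simp only [listedTypes, Set.mem_union, Set.mem_insert_iff, Set.mem_singleton_iff,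
    Set.mem_range, Prod.mk.injEq] at h
  rcases h with ((h | ⟨i, h⟩) | ⟨i, h⟩) | ⟨i, h⟩
  · rcases h with h | h | h | h | h | h | h | h | h <;> obtain ⟨rfl, rfl, rfl, rfl⟩ := h <;> simp
  all_goals obtain ⟨rfl, rfl, rfl, rfl⟩ := h; simp

variable {A} in
theorem HasExtendedBrackets.unique {μ ν : Brackets (ExtSpace d M F V)}
    (hμ : A.HasExtendedBrackets μ) (hν : A.HasExtendedBrackets ν)
    (hg : IsGradedAntisymmetric (extGrading d M F V) μ)
    (hg' : IsGradedAntisymmetric (extGrading d M F V) ν) : μ = ν := by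
  refine eq_of_eq_on_sorted hg hg' fun n a hs zs es fs hz ha => ?_
  -- The numbers of arguments agree only propositionally, so tuples are compared through their
  -- lists.
  have hl : ∀ {m : ℕ} (l : Fin m → ExtSpace d M F V),
      List.ofFn l = (sortedArgs hs zs es fs).map Arg.val → μ m l = ν m l →
        μ n (fun i => (a i).val) = ν n (fun i => (a i).val) := by
    intro m l h h1
    have h2 : List.ofFn (fun i => (a i).val) = List.ofFn l := by
      rw [h, ← ha, List.map_ofFn]
      rfl
    rw [μ.congr_ofFn h2, ν.congr_ofFn h2, h1]
  have hh : ∀ {m : ℕ} (l : Fin m → ExtSpace d M F V),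
      List.ofFn l = (zs.map Arg.z ++ (es.map Arg.e ++ fs.map Arg.f)).map Arg.val →
      μ (hs.length + m) (Fin.append (fun j => inH (hs.get j)) l) =
        ν (hs.length + m) (Fin.append (fun j => inH (hs.get j)) l) →
      μ n (fun i => (a i).val) = ν n (fun i => (a i).val) := by
    intro m l h h1
    refine hl _ ?_ h1
    rw [ofFn_append_inH, List.ofFn_get, h, ← List.map_append]
    rfl
  by_cases ht : (fs.length, es.length, hs.length, zs.length) ∈ listedTypes
  swap
  · have h1 : argType (fun i => (a i).deg) ∉ listedTypes := by
      rwa [argType_of_perm (by rw [ha])]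
    rw [hμ.mu_other n (fun i => (a i).deg) _ (fun i => (a i).val_mem) h1,
      hν.mu_other n (fun i => (a i).deg) _ (fun i => (a i).val_mem) h1]
  have hz1 : zs.length = 1 → zs = [1] := fun h => by
    obtain ⟨r, rfl⟩ := List.length_eq_one_iff.1 h
    rw [hz r (by simp)]
  rcases cases_of_mem_listedTypes ht with ⟨h0, h1, h⟩ | ⟨h0, h1, h⟩ | ⟨h0, h1, h2⟩ |
    ⟨h0, h1, h2⟩ | ⟨h0, h1, h2⟩
  · obtain rfl := List.length_eq_zero_iff.1 h0
    obtain rfl := List.length_eq_zero_iff.1 h1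
    rcases h with ⟨h2, h3⟩ | ⟨h2, h3⟩ | ⟨h2, h3⟩ | ⟨h2, h3⟩ | ⟨h2, h3⟩
    · obtain rfl := List.length_eq_zero_iff.1 h2
      obtain rfl := List.length_eq_zero_iff.1 h3
      exact hl ![] rfl (hμ.mu_curvature.trans hν.mu_curvature.symm)
    · obtain ⟨f, rfl⟩ := List.length_eq_one_iff.1 h2
      obtain rfl := List.length_eq_zero_iff.1 h3
      exact hl ![inF f] rfl ((hμ.mu_f f).trans (hν.mu_f f).symm)
    · obtain rfl := List.length_eq_zero_iff.1 h2
      obtain ⟨a, b, rfl⟩ := List.length_eq_two.1 h3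
      exact hl ![inE a, inE b] rfl ((hμ.mu_ee a b).trans (hν.mu_ee a b).symm)
    · obtain ⟨f, rfl⟩ := List.length_eq_one_iff.1 h2
      obtain ⟨a, rfl⟩ := List.length_eq_one_iff.1 h3
      exact hl ![inE a, inF f] rfl ((hμ.mu_ef a f).trans (hν.mu_ef a f).symm)
    · obtain rfl := List.length_eq_zero_iff.1 h2
      obtain ⟨a, b, c, rfl⟩ := List.length_eq_three.1 h3
      exact hl ![inE a, inE b, inE c] rfl ((hμ.mu_eee a b c).trans (hν.mu_eee a b c).symm)
  · obtain rfl := hz1 h0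
    obtain rfl := List.length_eq_zero_iff.1 h1
    rcases h with ⟨h2, h3⟩ | ⟨h2, h3⟩ | ⟨h2, h3⟩ | ⟨h2, h3⟩
    · obtain ⟨f, rfl⟩ := List.length_eq_one_iff.1 h2
      obtain ⟨a, rfl⟩ := List.length_eq_one_iff.1 h3
      exact hl ![muZero d M F V, inE a, inF f] rfl ((hμ.mu_0ef a f).trans (hν.mu_0ef a f).symm)
    · obtain ⟨f, g, rfl⟩ := List.length_eq_two.1 h2
      obtain rfl := List.length_eq_zero_iff.1 h3
      exact hl ![muZero d M F V, inF f, inF g] rfl ((hμ.mu_0ff f g).trans (hν.mu_0ff f g).symm)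
    · obtain rfl := List.length_eq_zero_iff.1 h2
      obtain ⟨a, b, c, rfl⟩ := List.length_eq_three.1 h3
      exact hl ![muZero d M F V, inE a, inE b, inE c] rfl
        ((hμ.mu_0eee a b c).trans (hν.mu_0eee a b c).symm)
    · obtain rfl := List.length_eq_zero_iff.1 h2
      obtain ⟨a, b, c, e, rfl⟩ : ∃ a b c e, es = [a, b, c, e] := by
        obtain ⟨a, es, rfl⟩ := List.exists_cons_of_length_eq_add_one h3
        obtain ⟨b, c, e, rfl⟩ := List.length_eq_three.1 (Nat.succ_injective h3)
        exact ⟨a, b, c, e, rfl⟩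
      exact hl ![muZero d M F V, inE a, inE b, inE c, inE e] rfl
        ((hμ.mu_0eeee a b c e).trans (hν.mu_0eeee a b c e).symm)
  · obtain rfl := List.length_eq_zero_iff.1 h0
    obtain rfl := List.length_eq_zero_iff.1 h1
    obtain ⟨a, rfl⟩ := List.length_eq_one_iff.1 h2
    exact hh ![inE a] rfl (IsVectorField.unique (hμ.mu_he _ _ a) (hν.mu_he _ _ a))
  · obtain rfl := hz1 h0
    obtain ⟨f, rfl⟩ := List.length_eq_one_iff.1 h1
    obtain rfl := List.length_eq_zero_iff.1 h2
    exact hh ![muZero d M F V, inF f] rfl 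
      (IsVectorField.unique (hμ.mu_h0f _ _ f) (hν.mu_h0f _ _ f))
  · obtain rfl := hz1 h0
    obtain rfl := List.length_eq_zero_iff.1 h1
    obtain ⟨a, b, rfl⟩ := List.length_eq_two.1 h2
    exact hh ![muZero d M F V, inE a, inE b] rfl
      (IsVectorField.unique (hμ.mu_h0ee _ _ a b) (hν.mu_h0ee _ _ a b))

end BracketBundle

/-! ## The homotopy relations -/

namespace BracketBundle

variable {d : ℕ} {M : Type*} [TopologicalSpace M] [ChartedSpace (DoubledSpace d) M]
  [IsManifold 𝓘(ℝ, DoubledSpace d) ∞ M]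
  {F : Type*} [NormedAddCommGroup F] [NormedSpace ℝ F]
  {V : M → Type*} [TopologicalSpace (TotalSpace F V)]
  [∀ x, AddCommGroup (V x)] [∀ x, Module ℝ (V x)] [∀ x, TopologicalSpace (V x)]
  [∀ x, IsTopologicalAddGroup (V x)] [∀ x, ContinuousSMul ℝ (V x)]
  [FiberBundle F V] [VectorBundle ℝ F V]
  [ContMDiffVectorBundle ∞ F V 𝓘(ℝ, DoubledSpace d)]
  (A : BracketBundle d M F V)
  [FiniteDimensional ℝ F] [IsDoubledManifold d M]

theorem homotopyJacobi_append {k m : ℕ} (h : Fin k → VectorFields d M)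
    (b : Fin m → Arg (Functions d M) (Sections d F V) (VectorFields d M)) :
    homotopyJacobi A.calculus.mu (k + m) (Fin.append (fun _ => 1) (fun i => (b i).deg))
      (Fin.append (fun j => inH (h j)) (fun i => (b i).val)) =
        A.calculus.jacList ((List.ofFn h).map Arg.h ++ List.ofFn b) := by
  have h1 := A.calculus.homotopyJacobi_args (Fin.append (fun j => Arg.h (h j)) b)
  rw [List.ofFn_fin_append] at h1
  rw [List.map_ofFn]
  refine Eq.trans ?_ h1
  congr 1
  · funext i
    refine Fin.addCases (fun i => ?_) (fun i => ?_) i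
    · rw [Fin.append_left, Fin.append_left]; rfl
    · rw [Fin.append_right, Fin.append_right]
  · funext i
    refine Fin.addCases (fun i => ?_) (fun i => ?_) i
    · rw [Fin.append_left, Fin.append_left]; rfl
    · rw [Fin.append_right, Fin.append_right]

theorem isVectorField_homotopyJacobi {k m : ℕ} (h : Fin k → VectorFields d M)
    (b : Fin m → Arg (Functions d M) (Sections d F V) (VectorFields d M)) {deg : Fin m → ℤ}
    {l : Fin m → ExtSpace d M F V} (hd : deg = fun i => (b i).deg)
    (hl : l = fun i => (b i).val) {v : VectorFields d M} {w : RawVectorField d M}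
    (hv : A.calculus.jacList ((List.ofFn h).map Arg.h ++ List.ofFn b) =
      (0, 0, A.calculus.pd (List.ofFn h) v, 0)) (hw : ∀ x, v x = w x) :
    IsVectorField (homotopyJacobi A.calculus.mu (k + m) (Fin.append (fun _ => 1) deg)
      (Fin.append (fun j => inH (h j)) l)) (fun x => flatDeriv k w x fun j => h j x) := by
  subst hd hl
  exact isVectorField_iterDeriv h v hw ((A.homotopyJacobi_append h b).trans hv)

theorem homotopyRelationsReproduce : A.HomotopyRelationsReproduce A.calculus.mu where
  rel_f k h f := by
    refine A.isVectorField_homotopyJacobi h ![.f f] (by funext i; fin_cases i; rfl)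
      (by funext i; fin_cases i; rfl) (A.calculus.jacList_f _ f) fun x => ?_
    rfl
  rel_ee k h a b := by
    refine A.isVectorField_homotopyJacobi h ![.e a, .e b] (by funext i; fin_cases i <;> rfl)
      (by funext i; fin_cases i <;> rfl) (A.calculus.jacList_ee _ a b) fun x => ?_
    rw [← A.coe_lie]
    rfl
  rel_eee a b c := by
    have h := A.calculus.homotopyJacobi_args ![.e a, .e b, .e c]
    have h1 : ![Arg.e a, Arg.e b, Arg.e c] = fun i => (![Arg.e a, Arg.e b, Arg.e c] :
      Fin 3 → Arg (Functions d M) (Sections d F V) (VectorFields d M)) i := rfl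
    rw [A.hasExtendedBrackets_mu.mu_0eee]
    refine Eq.trans ?_ ((h.trans (A.calculus.jacList_eee a b c)).trans ?_)
    · congr 1 <;> (funext i; fin_cases i <;> rfl)
    · simp [inE]
      rfl
  rel_0ef k h a f := by
    refine A.isVectorField_homotopyJacobi h ![.z 1, .e a, .f f]
      (by funext i; fin_cases i <;> rfl) (by funext i; fin_cases i <;> rfl)
      (A.calculus.jacList_zef _ a f) fun x => ?_
    have h1 : (fun z => (1 / 2 : ℝ) • etaGrad (d := d) f z : RawVectorField d M) =
      halfEtaGrad f := rfl
    rw [h1, ← A.coe_lie]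
    rfl
  rel_0eee k h a b c := by
    refine A.isVectorField_homotopyJacobi h ![.z 1, .e a, .e b, .e c]
      (by funext i; fin_cases i <;> rfl) (by funext i; fin_cases i <;> rfl)
      (A.calculus.jacList_zeee _ a b c) fun x => ?_
    have h1 : ∀ a b : Sections d F V, A.SCrho a b = A.SCL a b := fun _ _ => rfl
    simp only [h1]
    rw [← A.coe_lie, ← A.coe_lie, ← A.coe_lie]
    rfl

end BracketBundle

/-! ## The anchor of a bundle satisfying the axioms is an isometry -/

section Bump

variable {d : ℕ} {M : Type*} [TopologicalSpace M] [T2Space M] [ChartedSpace (DoubledSpace d) M]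
  [IsManifold 𝓘(ℝ, DoubledSpace d) ∞ M]

/-- There are smooth functions with support in a given neighbourhood of a point which are one at
that point. -/
theorem exists_cutoff (x : M) {s : Set M} (hs : s ∈ 𝓝 x) :
    ∃ χ : Functions d M, χ x = 1 ∧ ∀ y, χ y ≠ 0 → y ∈ s := by
  obtain ⟨f, -, hf⟩ := (SmoothBumpFunction.nhds_basis_support (I := 𝓘(ℝ, DoubledSpace d)) hs).mem_iff.1 hs
  exact ⟨⟨f, f.contMDiff⟩, f.eq_one, fun y hy => hf hy⟩

/-- A linear form of the coordinates around a point extends to a smooth function. -/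
theorem exists_linear (x : M) (α : DoubledSpace d →L[ℝ] ℝ) :
    ∃ g : Functions d M, ∀ᶠ y in 𝓝 (coord d x), frep x g y = α y := by
  obtain ⟨f⟩ : Nonempty (SmoothBumpFunction 𝓘(ℝ, DoubledSpace d) x) := inferInstance
  have hα : ContMDiffOn 𝓘(ℝ, DoubledSpace d) 𝓘(ℝ, ℝ) ∞
      (fun y => α (extChartAt 𝓘(ℝ, DoubledSpace d) x y)) (chartAt (DoubledSpace d) x).source :=
    α.contMDiff.comp_contMDiffOn contMDiffOn_extChartAt
  refine ⟨⟨fun y => f y • α (extChartAt 𝓘(ℝ, DoubledSpace d) x y), f.contMDiff_smul hα⟩, ?_⟩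
  have h1 : Filter.Tendsto (extChartAt 𝓘(ℝ, DoubledSpace d) x).symm (𝓝 (coord d x)) (𝓝 x) := by
    have := continuousAt_extChartAt_symm (I := 𝓘(ℝ, DoubledSpace d)) x
    rwa [ContinuousAt, extChartAt_to_inv] at this
  filter_upwards [h1.eventually f.eventuallyEq_one,
    (isOpen_coordDomain x).mem_nhds (coord_mem x)] with y hy hy'
  change f _ • α (extChartAt 𝓘(ℝ, DoubledSpace d) x
    ((extChartAt 𝓘(ℝ, DoubledSpace d) x).symm y)) = _
  rw [hy, (extChartAt 𝓘(ℝ, DoubledSpace d) x).right_inv hy', Pi.one_apply, one_smul]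

theorem fderiv_frep_of_eventually_linear {x : M} {α : DoubledSpace d →L[ℝ] ℝ} {g : Functions d M}
    (h : ∀ᶠ y in 𝓝 (coord d x), frep x g y = α y) :
    ∀ᶠ y in 𝓝 (coord d x), fderiv ℝ (frep x g) y = α := by
  filter_upwards [h.eventually_nhds] with y hy
  rw [Filter.EventuallyEq.fderiv_eq (f := α) hy, α.fderiv]

theorem exists_fderiv_eq (x : M) (α : DoubledSpace d →L[ℝ] ℝ) :
    ∃ g : Functions d M, fderiv ℝ (frep x g) (coord d x) = α :=
  let ⟨g, hg⟩ := exists_linear x α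
  ⟨g, (fderiv_frep_of_eventually_linear hg).self_of_nhds⟩

theorem frep_eta [IsDoubledManifold d M] (x : M) (u v : RawVectorField d M) {y : DoubledSpace d}
    (hy : y ∈ coordDomain d x) :
    frep x (fun z => eta (vec (u z)) (vec (v z))) y = eta (rep x u y) (rep x v y) := by
  obtain ⟨K, b, hK, hb, hev⟩ := exists_transition_symm x hy
  set z := (extChartAt 𝓘(ℝ, DoubledSpace d) x).symm y with hz
  have hw : ∀ u : RawVectorField d M, K (rep x u y) = vec (u z) := fun u => by
    rw [hev.self_of_nhds.rep_eq, hb, K.apply_symm_apply, rep_coord]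
  rw [frep, ← hz, ← hw, ← hw, hK]

end Bump

namespace BracketBundle

variable {d : ℕ} {M : Type*} [TopologicalSpace M] [T2Space M] [ChartedSpace (DoubledSpace d) M]
  [IsManifold 𝓘(ℝ, DoubledSpace d) ∞ M]
  {F : Type*} [NormedAddCommGroup F] [NormedSpace ℝ F]
  {V : M → Type*} [TopologicalSpace (TotalSpace F V)]
  [∀ x, AddCommGroup (V x)] [∀ x, Module ℝ (V x)] [∀ x, TopologicalSpace (V x)]
  [∀ x, IsTopologicalAddGroup (V x)] [∀ x, ContinuousSMul ℝ (V x)]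
  [FiberBundle F V] [VectorBundle ℝ F V]
  [ContMDiffVectorBundle ∞ F V 𝓘(ℝ, DoubledSpace d)]
  {A : BracketBundle d M F V}
  [FiniteDimensional ℝ F] [IsDoubledManifold d M]

namespace SatisfiesAxioms

/-- Axiom 1 reads `½ ρ(Dg)f = ¼ η⁻¹(df,dg)`, and `df` can be any covector at `x`. -/
theorem vec_rho_D (h : A.SatisfiesAxioms) (g : Functions d M) (x : M) :
    vec (A.rho (A.D g) x) = (1 / 2 : ℝ) • sharp (fderiv ℝ (frep x g) (coord d x)) := by
  apply eta_ext
  intro w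
  -- The test function has differential `η(w,·)` at `x`, which turns axiom 1 into a pairing with
  -- `w`.
  obtain ⟨f, hf⟩ := exists_fderiv_eq x (etaL d w)
  have h1 := h.axiom_metric f g x
  have h2 : A.pair (A.D f) (A.D g) x = 1 / 2 * etaL d w (vec (A.rho (A.D g) x)) := by
    rw [A.pair_D, differential_eq, hf]
  have h3 : differential f x (etaGrad (d := d) g x) =
      etaL d w (sharp (fderiv ℝ (frep x g) (coord d x))) := by
    rw [differential_eq, hf, vec_etaGrad]
  rw [h2, h3, etaL_apply, etaL_apply] at h1
  rw [eta_comm, eta_comm _ w, ← etaL_apply, ← etaL_apply, map_smul, etaL_apply, etaL_apply,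
    smul_eq_mul]
  linarith

theorem rho_D (h : A.SatisfiesAxioms) (g : Functions d M) :
    A.rho (A.D g) = halfEtaGrad g :=
  VectorFields.ext_rep fun x => by
    rw [h.vec_rho_D, coe_halfEtaGrad, vec_smul, vec_etaGrad]

/-- A function with constant differential near `x` has a gradient with constant components. These
sections form frames with constant anchor, hence with constant pairings. -/
theorem exists_rho_D_eq (h : A.SatisfiesAxioms) (x : M) (w : DoubledSpace d) :
    ∃ g : Functions d M, ∀ᶠ y in 𝓝 (coord d x), rep x (A.rho (A.D g)) y = w := by
  -- The factor 2 compensates the ½ in `ρ(Dg) = ½ η⁻¹(dg)`.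
  obtain ⟨g, hg⟩ := exists_linear x (etaL d ((2 : ℝ) • w))
  refine ⟨g, ?_⟩
  filter_upwards [fderiv_frep_of_eventually_linear hg,
    (isOpen_coordDomain x).mem_nhds (coord_mem x)] with y hy hy'
  have h1 : rep x (A.rho (A.D g)) y = (1 / 2 : ℝ) • rep x (etaGradField g) y := by
    rw [h.rho_D]
    exact eventuallyEq_rep_smul x _ _ y hy'
  rw [h1, coe_etaGradField, rep_etaGrad x g hy', hy]
  have h2 : sharp (etaL d ((2 : ℝ) • w)) = (2 : ℝ) • w :=
    (eq_sharp fun u => (etaL_apply _ _).symm).symm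
  rw [h2, smul_smul]
  norm_num

theorem anchor_surjective (h : A.SatisfiesAxioms) (x : M) : Function.Surjective (A.anchor x) := by
  intro w
  obtain ⟨g, hg⟩ := h.exists_rho_D_eq x (vec w)
  refine ⟨A.D g x, vec_injective x ?_⟩
  rw [← hg.self_of_nhds, rep_coord, rho_apply]

theorem anchor_bijective (h : A.SatisfiesAxioms) (hF : Module.finrank ℝ F = 2 * d) (x : M) :
    Function.Bijective (A.anchor x) := by
  refine ⟨?_, h.anchor_surjective x⟩
  have := finiteDimensional_fiber (F := F) V x
  have h1 : Module.finrank ℝ (V x) = Module.finrank ℝ (DoubledSpace d) := by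
    rw [((trivializationAt F V x).linearEquivAt ℝ x
      (FiberBundle.mem_baseSet_trivializationAt' x)).finrank_eq, hF]
    simp [two_mul]
  exact (LinearMap.injective_iff_surjective_of_finrank_eq_finrank (f := (A.anchor x).toLinearMap)
    h1).2 (h.anchor_surjective x)

/-- As the anchor is injective, every vector at `x` is a value of some `D g`, and `⟨Dg,w⟩ = ½ ρ(w)g
= η(ρ(Dg),ρ(w))`. -/
theorem form_eq_eta (h : A.SatisfiesAxioms) (hF : Module.finrank ℝ F = 2 * d) (x : M)
    (v w : V x) : A.form x v w = eta (vec (A.anchor x v)) (vec (A.anchor x w)) := by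
  obtain ⟨g, hg⟩ := h.exists_rho_D_eq x (vec (A.anchor x v))
  have h1 : vec (A.rho (A.D g) x) = vec (A.anchor x v) := by
    rw [← hg.self_of_nhds, rep_coord]
  have h2 : A.D g x = v := (h.anchor_bijective hF x).1 (vec_injective x h1)
  rw [← h1, h.vec_rho_D, ← h2, A.form_D, differential_eq, ← etaL_apply, map_smul,
    _root_.smul_apply, etaL_apply, eta_sharp, smul_eq_mul]

theorem pair_eq_eta (h : A.SatisfiesAxioms) (hF : Module.finrank ℝ F = 2 * d)
    (a b : Sections d F V) (x : M) : A.pair a b x = eta (vec (A.rho a x)) (vec (A.rho b x)) :=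
  h.form_eq_eta hF x (a x) (b x)

theorem frep_pair (h : A.SatisfiesAxioms) (hF : Module.finrank ℝ F = 2 * d)
    (a b : Sections d F V) (x : M) {y : DoubledSpace d} (hy : y ∈ coordDomain d x) :
    frep x (A.pair a b) y = eta (rep x (A.rho a) y) (rep x (A.rho b) y) := by
  rw [← frep_eta x _ _ hy, frep, frep, h.pair_eq_eta hF]

end SatisfiesAxioms

end BracketBundle

/-! ## Tensoriality of the defect of the anchor -/

section Bump

variable {d : ℕ} {M : Type*} [TopologicalSpace M] [ChartedSpace (DoubledSpace d) M]
  [IsManifold 𝓘(ℝ, DoubledSpace d) ∞ M]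

theorem tendsto_extChartAt_symm (x : M) :
    Filter.Tendsto (extChartAt 𝓘(ℝ, DoubledSpace d) x).symm (𝓝 (coord d x)) (𝓝 x) := by
  have := continuousAt_extChartAt_symm (I := 𝓘(ℝ, DoubledSpace d)) x
  rwa [ContinuousAt, extChartAt_to_inv] at this

theorem eventually_of_eventually_coord {x : M} {p : M → Prop}
    (h : ∀ᶠ y in 𝓝 (coord d x), p ((extChartAt 𝓘(ℝ, DoubledSpace d) x).symm y)) :
    ∀ᶠ z in 𝓝 x, p z := by
  have h1 := (continuousAt_extChartAt (I := 𝓘(ℝ, DoubledSpace d)) x).eventually h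
  filter_upwards [h1, (isOpen_extChartAt_source (I := 𝓘(ℝ, DoubledSpace d)) x).mem_nhds
    (mem_extChartAt_source x)] with z hz hz'
  rwa [(extChartAt 𝓘(ℝ, DoubledSpace d) x).left_inv hz'] at hz

variable [IsDoubledManifold d M]

theorem exists_equiv_rep (x : M) {y : DoubledSpace d} (hy : y ∈ coordDomain d x) :
    ∃ K : DoubledSpace d ≃L[ℝ] DoubledSpace d, ∀ u : RawVectorField d M,
      vec (u ((extChartAt 𝓘(ℝ, DoubledSpace d) x).symm y)) = K (rep x u y) := by
  obtain ⟨K, b, hK, hb, hev⟩ := exists_transition_symm x hy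
  refine ⟨K, fun u => ?_⟩
  rw [hev.self_of_nhds.rep_eq, hb, K.apply_symm_apply, rep_coord]

theorem vec_lie (u v : VectorFields d M) (x : M) :
    vec (iterDeriv [u] v x) = fderiv ℝ (rep x v) (coord d x) (vec (u x)) := rfl

end Bump

namespace BracketBundle

variable {d : ℕ} {M : Type*} [TopologicalSpace M] [ChartedSpace (DoubledSpace d) M]
  [IsManifold 𝓘(ℝ, DoubledSpace d) ∞ M]
  {F : Type*} [NormedAddCommGroup F] [NormedSpace ℝ F]
  {V : M → Type*} [TopologicalSpace (TotalSpace F V)]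
  [∀ x, AddCommGroup (V x)] [∀ x, Module ℝ (V x)] [∀ x, TopologicalSpace (V x)]
  [∀ x, IsTopologicalAddGroup (V x)] [∀ x, ContinuousSMul ℝ (V x)]
  [FiberBundle F V] [VectorBundle ℝ F V]
  [ContMDiffVectorBundle ∞ F V 𝓘(ℝ, DoubledSpace d)]
  (A : BracketBundle d M F V)
  [FiniteDimensional ℝ F] [IsDoubledManifold d M]

theorem eta_SCL (a b : Sections d F V) (x : M) (w : DoubledSpace d) :
    eta (vec (A.SCL a b x)) w =
      1 / 2 * eta (vec (A.rho a x)) (fderiv ℝ (rep x (A.rho b)) (coord d x) w) -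
      1 / 2 * eta (vec (A.rho b x)) (fderiv ℝ (rep x (A.rho a)) (coord d x) w) := by
  have h : vec (A.SCL a b x) = (1 / 2 : ℝ) • vec (contractDeriv (A.rho a) (A.rho b) x) -
      (1 / 2 : ℝ) • vec (contractDeriv (A.rho b) (A.rho a) x) := rfl
  rw [h, vec_contractDeriv, vec_contractDeriv, ← etaL_apply]
  simp only [map_sub, map_smul, _root_.sub_apply, _root_.smul_apply, etaL_apply, eta_sharp,
    ContinuousLinearMap.comp_apply, smul_eq_mul]

/-- The vector field `ρ[[a,b]] - [ρ(a),ρ(b)] + SC_ρ(a,b)`. -/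
def anchorDefect (a b : Sections d F V) : VectorFields d M :=
  A.rho (A.bracket a b) - A.calculus.lie (A.rho a) (A.rho b) + A.SCL a b

theorem eta_anchorDefect (a b : Sections d F V) (x : M) (w : DoubledSpace d) :
    eta (vec (A.anchorDefect a b x)) w = eta (vec (A.rho (A.bracket a b) x)) w -
      (eta (fderiv ℝ (rep x (A.rho b)) (coord d x) (vec (A.rho a x))) w -
        eta (fderiv ℝ (rep x (A.rho a)) (coord d x) (vec (A.rho b x))) w) +
      (1 / 2 * eta (vec (A.rho a x)) (fderiv ℝ (rep x (A.rho b)) (coord d x) w) -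
      1 / 2 * eta (vec (A.rho b x)) (fderiv ℝ (rep x (A.rho a)) (coord d x) w)) := by
  have h : vec (A.anchorDefect a b x) = vec (A.rho (A.bracket a b) x) -
      (fderiv ℝ (rep x (A.rho b)) (coord d x) (vec (A.rho a x)) -
        fderiv ℝ (rep x (A.rho a)) (coord d x) (vec (A.rho b x))) + vec (A.SCL a b x) := rfl
  rw [h, ← eta_SCL, ← etaL_apply, ← etaL_apply, ← etaL_apply, ← etaL_apply, ← etaL_apply]
  simp only [map_sub, map_add, _root_.sub_apply, _root_.add_apply]

theorem vec_anchorDefect_skew (a b : Sections d F V) (x : M) :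
    vec (A.anchorDefect a b x) = -vec (A.anchorDefect b a x) := by
  apply eta_ext
  intro w
  have h1 : vec (A.rho (A.bracket a b) x) = -vec (A.rho (A.bracket b a) x) := by
    rw [A.bracket_skew]
    exact map_neg (A.anchor x) _
  have h2 : eta (-vec (A.anchorDefect b a x)) w = -eta (vec (A.anchorDefect b a x)) w := by
    rw [← etaL_apply, map_neg, _root_.neg_apply, etaL_apply]
  rw [h2, eta_anchorDefect, eta_anchorDefect, h1, ← etaL_apply (-_), map_neg, _root_.neg_apply,
    etaL_apply]
  ring

/-- The defect of the anchor as an additive map of the second section. -/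
def anchorDefectHom (a : Sections d F V) : Sections d F V →+ VectorFields d M :=
  AddMonoidHom.mk' (A.anchorDefect a) fun b b' => VectorFields.ext_rep fun x => by
    rw [vec_coe_add]
    apply eta_ext
    intro w
    have h1 : A.rho (A.bracket a (b + b')) = A.rho (A.bracket a b) + A.rho (A.bracket a b') := by
      rw [map_add]
      exact A.rhoL.map_add _ _
    have h2 : A.rho (b + b') = A.rho b + A.rho b' := A.rhoL.map_add _ _
    rw [← etaL_apply (_ + _), map_add, _root_.add_apply, etaL_apply, etaL_apply, eta_anchorDefect,
      eta_anchorDefect, eta_anchorDefect, h1, h2, fderiv_rep_add]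
    simp only [← etaL_apply, vec_coe_add, map_add, _root_.add_apply]
    ring

theorem rep_fsmul (f : Functions d M) (b : Sections d F V) (x : M) :
    ∀ y ∈ coordDomain d x, rep x (A.rho (fsmul f b)) y = frep x f y • rep x (A.rho b) y := by
  intro y hy
  rw [frep, ← rep_smul x f _ hy]
  congr 1
  funext z
  exact map_smul (A.anchor z) (f z) (b z)

theorem fderiv_rep_fsmul (f : Functions d M) (b : Sections d F V) (x : M) (w : DoubledSpace d) :
    fderiv ℝ (rep x (A.rho (fsmul f b))) (coord d x) w =
      f x • fderiv ℝ (rep x (A.rho b)) (coord d x) w +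
        fderiv ℝ (frep x f) (coord d x) w • vec (A.rho b x) := by
  rw [eq_of_forall_mem_fderiv (isOpen_coordDomain x) (A.rep_fsmul f b x) (coord_mem x),
    fderiv_fun_smul (differentiableAt_frep x f) (differentiableAt_rep x (A.rho b)), rep_coord,
    frep_coord]
  rfl

variable {A} in
-- The term `(ρ(a)f)ρ(b)` of the Leibniz rule cancels against the Lie bracket. The term `-⟨a,b⟩ρ(Df)
-- = -½ η(ρ(a),ρ(b)) η⁻¹(df)` cancels the derivative of `f` in `SC_ρ(a,fb)`.
theorem SatisfiesAxioms.anchorDefect_fsmul [T2Space M] (h : A.SatisfiesAxioms)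
    (hF : Module.finrank ℝ F = 2 * d) (a b : Sections d F V) (f : Functions d M) (x : M) :
    vec (A.anchorDefect a (fsmul f b) x) = f x • vec (A.anchorDefect a b x) := by
  apply eta_ext
  intro w
  have h1 : vec (A.rho (A.bracket a (fsmul f b)) x) = f x • vec (A.rho (A.bracket a b) x) +
      fderiv ℝ (frep x f) (coord d x) (vec (A.rho a x)) • vec (A.rho b x) -
      eta (vec (A.rho a x)) (vec (A.rho b x)) • vec (A.rho (A.D f) x) := by
    rw [← h.pair_eq_eta hF, ← differential_eq, rho_apply, h.axiom_leibniz]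
    simp only [map_sub, map_add, map_smul]
    rfl
  have h2 : vec (A.rho (fsmul f b) x) = f x • vec (A.rho b x) :=
    congrArg vec (map_smul (A.anchor x) (f x) (b x))
  rw [eta_anchorDefect, h1, h2, h.vec_rho_D, A.fderiv_rep_fsmul, A.fderiv_rep_fsmul]
  have h3 : eta (f x • vec (A.anchorDefect a b x)) w = f x * eta (vec (A.anchorDefect a b x)) w := by
    rw [← etaL_apply, map_smul, _root_.smul_apply, etaL_apply, smul_eq_mul]
  rw [h3, eta_anchorDefect]
  simp only [← etaL_apply, map_sub, map_add, map_smul, _root_.sub_apply, _root_.add_apply,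
    _root_.smul_apply, smul_eq_mul]
  rw [etaL_apply (sharp _), eta_sharp]
  ring

variable {A}

/-- Near `x` the section `b` is a combination of the frame with function coefficients; additivity
and linearity over functions do the rest. -/
theorem SatisfiesAxioms.anchorDefect_eq_zero_of_frame [T2Space M] (h : A.SatisfiesAxioms)
    (hF : Module.finrank ℝ F = 2 * d) {x : M} {s : Fin d ⊕ Fin d → Sections d F V}
    (hs : ∀ i, ∀ᶠ y in 𝓝 (coord d x), rep x (A.rho (s i)) y = Pi.single i 1)
    (a b : Sections d F V) (h0 : ∀ i, vec (A.anchorDefect a (s i) x) = 0) :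
    vec (A.anchorDefect a b x) = 0 := by
  -- The frame dual to `s i` for `η` is `s i.swap`, which gives the coefficients.
  have hs' : ∀ᶠ y in 𝓝 (coord d x), b ((extChartAt 𝓘(ℝ, DoubledSpace d) x).symm y) =
      ∑ i, A.pair b (s i.swap) ((extChartAt 𝓘(ℝ, DoubledSpace d) x).symm y) •
        s i ((extChartAt 𝓘(ℝ, DoubledSpace d) x).symm y) := by
    filter_upwards [Filter.eventually_all.2 hs,
      (isOpen_coordDomain x).mem_nhds (coord_mem x)] with y hy hy'
    obtain ⟨K, hK⟩ := exists_equiv_rep x hy'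
    refine (h.anchor_bijective hF _).1 (vec_injective _ ?_)
    have h1 := hK (A.rho b)
    rw [rho_apply] at h1
    rw [h1, map_sum]
    have h2 : ∀ i, A.pair b (s i.swap) ((extChartAt 𝓘(ℝ, DoubledSpace d) x).symm y) =
        rep x (A.rho b) y i := fun i => by
      have h3 := h.frep_pair hF b (s i.swap) x hy'
      rw [hy, eta_single] at h3
      exact h3
    have h4 : rep x (A.rho b) y = ∑ i, rep x (A.rho b) y i • Pi.single i (1 : ℝ) :=
      (pi_eq_sum_univ' _)
    have h5 : ∀ v : Fin d ⊕ Fin d → TangentSpace 𝓘(ℝ, DoubledSpace d)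
        ((extChartAt 𝓘(ℝ, DoubledSpace d) x).symm y), vec (∑ i, v i) = ∑ i, vec (v i) :=
      fun v => rfl
    rw [h5]
    conv_lhs => rw [h4, map_sum]
    refine Finset.sum_congr rfl fun i _ => ?_
    rw [map_smul, map_smul, vec_smul, h2, ← hy i, ← hK]
    rfl
  -- The defect takes global sections, so the local expansion is cut off; since `χ x = 1`, the value
  -- at `x` is unchanged.
  obtain ⟨χ, hχ, hsupp⟩ := exists_cutoff (d := d) x (eventually_of_eventually_coord (d := d)
    (p := fun z => b z = ∑ i, A.pair b (s i.swap) z • s i z) hs')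
  have h6 : fsmul χ b = ∑ i, fsmul (χ * A.pair b (s i.swap)) (s i) := by
    refine ContMDiffSection.ext fun y => ?_
    have h7 : (∑ i, fsmul (χ * A.pair b (s i.swap)) (s i)) y =
        ∑ i, (χ y * A.pair b (s i.swap) y) • s i y := by
      rw [← ContMDiffSection.coeAddHom_apply, map_sum, Finset.sum_apply]
      rfl
    rw [h7]
    change χ y • b y = _
    by_cases hy : χ y = 0
    · simp [hy]
    · have h8 := hsupp y hy
      simp only [Set.mem_ofPred_eq] at h8
      rw [h8, Finset.smul_sum]
      refine Finset.sum_congr rfl fun i _ => ?_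
      rw [smul_smul]
  have h9 : vec (A.anchorDefectHom a (fsmul χ b) x) = 0 := by
    rw [h6, map_sum]
    have h10 : ∀ v : Fin d ⊕ Fin d → VectorFields d M, vec ((∑ i, v i) x) = ∑ i, vec (v i x) := by
      intro v
      rw [← ContMDiffSection.coeAddHom_apply, map_sum, Finset.sum_apply]
      rfl
    rw [h10]
    refine Finset.sum_eq_zero fun i _ => ?_
    refine (h.anchorDefect_fsmul hF _ _ _ _).trans ?_
    rw [h0, smul_zero]
  have h11 := h.anchorDefect_fsmul hF a b χ x
  rw [hχ, one_smul] at h11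
  rw [← h11]
  exact h9

theorem vec_dirDeriv (u v : VectorFields d M) (x : M) :
    vec (dirDeriv (u : RawVectorField d M) v x) = fderiv ℝ (rep x v) (coord d x) (vec (u x)) := by
  rw [← coe_iterDeriv_single, vec_lie]

/-- On sections with constant anchor the flux vanishes, hence so does the twist; the Lie bracket and
`SC_ρ` vanish too. Linearity over functions in one argument, with skewness for the other, extends
this to all sections. -/
theorem SatisfiesAxioms.anchorDefect_eq_zero [T2Space M] (h : A.SatisfiesAxioms)
    (hF : Module.finrank ℝ F = 2 * d) (hc : A.IsCBracket) (a b : Sections d F V) :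
    A.anchorDefect a b = 0 := by
  refine VectorFields.ext_rep fun x => ?_
  have hex := fun w => h.exists_rho_D_eq x w
  choose g hg using hex
  have key : ∀ v w, vec (A.anchorDefect (A.D (g v)) (A.D (g w)) x) = 0 := by
    intro v w
    apply eta_ext
    intro u
    have hz : ∀ v, fderiv ℝ (rep x (A.rho (A.D (g v)))) (coord d x) = 0 := fun v => by
      rw [Filter.EventuallyEq.fderiv_eq (f := fun _ => v) (hg v), fderiv_fun_const]
      rfl
    have hx : ∀ v, vec (A.rho (A.D (g v)) x) = v := fun v => by
      rw [← rep_coord, (hg v).self_of_nhds]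
    have h1 := hc ![A.D (g v), A.D (g w), A.D (g u)] x (by
      have h2 : ∀ v w, ∀ᶠ y in 𝓝 x, A.pair (A.D (g v)) (A.D (g w)) y =
          A.pair (A.D (g v)) (A.D (g w)) x := by
        intro v w
        refine eventually_of_eventually_coord (d := d) ?_
        filter_upwards [hg v, hg w, (isOpen_coordDomain x).mem_nhds (coord_mem x)]
          with y hv hw hy
        have h3 := h.frep_pair hF (A.D (g v)) (A.D (g w)) x hy
        rw [frep] at h3
        rw [h3, hv, hw, h.pair_eq_eta hF, hx, hx]
      intro I J
      have h4 : ∀ I, ∃ v', ![A.D (g v), A.D (g w), A.D (g u)] I = A.D (g v') := by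
        intro I
        fin_cases I
        exacts [⟨v, rfl⟩, ⟨w, rfl⟩, ⟨u, rfl⟩]
      obtain ⟨v', hv'⟩ := h4 I
      obtain ⟨w', hw'⟩ := h4 J
      rw [hv', hw']
      exact h2 v' w')
    have h5 : ∀ v w u, eta (dirDeriv (A.rho (A.D (g v))) (A.rho (A.D (g w))) x)
        (A.rho (A.D (g u)) x) = 0 := by
      intro v w u
      change eta (vec (dirDeriv (A.rho (A.D (g v))) (A.rho (A.D (g w))) x))
        (vec (A.rho (A.D (g u)) x)) = 0
      rw [vec_dirDeriv, hz, ← etaL_apply]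
      simp
    have h6 : A.pair (A.bracket (A.D (g v)) (A.D (g w))) (A.D (g u)) x = 0 := by
      refine h1.trans ?_
      simp only [Matrix.cons_val_zero, Matrix.cons_val_one, Matrix.cons_val]
      rw [h5, h5, h5]
      norm_num
    rw [h.pair_eq_eta hF, hx] at h6
    rw [eta_anchorDefect, h6, hz, hz]
    simp only [← etaL_apply]
    simp
  have hsk : ∀ (a b : Sections d F V), vec (A.anchorDefect a b x) = 0 →
      vec (A.anchorDefect b a x) = 0 := fun a b hab => by
    rw [A.vec_anchorDefect_skew, hab, neg_zero]
  refine h.anchorDefect_eq_zero_of_frame hF (s := fun i => A.D (g (Pi.single i 1)))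
    (fun i => hg _) a b fun i => hsk _ _ ?_
  exact h.anchorDefect_eq_zero_of_frame hF (s := fun i => A.D (g (Pi.single i 1)))
    (fun i => hg _) _ a fun j => key _ _

/-- The vanishing defect expresses the twist as `η([ρ₀,ρ₁] - SC_ρ, ρ₂)`. Constant pairings give
`η(∂ρ_I,ρ_J) = -η(ρ_I,∂ρ_J)`, by which the two halves of `SC_ρ` merge into one flux term and `-∂ρ₀`
along `ρ₁` becomes another. -/
theorem SatisfiesAxioms.isCBracket [T2Space M] (h : A.SatisfiesAxioms)
    (hF : Module.finrank ℝ F = 2 * d) (h0 : ∀ a b, A.anchorDefect a b = 0) : A.IsCBracket := by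
  intro e x he
  set X : Fin 3 → DoubledSpace d := fun I => vec (A.rho (e I) x) with hX
  set L : Fin 3 → DoubledSpace d →L[ℝ] DoubledSpace d :=
    fun I => fderiv ℝ (rep x (A.rho (e I))) (coord d x) with hL
  have h1 : ∀ I J w, eta (L I w) (X J) + eta (X I) (L J w) = 0 := by
    intro I J w
    have h2 : ∀ᶠ y in 𝓝 (coord d x), etaL d (rep x (A.rho (e I)) y) (rep x (A.rho (e J)) y) =
        A.pair (e I) (e J) x := by
      filter_upwards [(tendsto_extChartAt_symm x).eventually (he I J),
        (isOpen_coordDomain x).mem_nhds (coord_mem x)] with y hy hy'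
      rw [etaL_apply, ← h.frep_pair hF _ _ x hy', frep, hy]
    have h3 : HasFDerivAt (fun y => etaL d (rep x (A.rho (e I)) y) (rep x (A.rho (e J)) y)) _
        (coord d x) := (etaL d).hasFDerivAt_of_bilinear
      (differentiableAt_rep x (A.rho (e I))).hasFDerivAt
      (differentiableAt_rep x (A.rho (e J))).hasFDerivAt
    have h4 := congrArg (fun T => T w) (h3.fderiv.symm.trans
      (Filter.EventuallyEq.fderiv_eq (f := fun _ => A.pair (e I) (e J) x) h2))
    simp only [fderiv_fun_const, Pi.zero_apply, _root_.zero_apply, _root_.add_apply,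
      ContinuousLinearMap.precompR_apply, ContinuousLinearMap.precompL_apply, rep_coord,
      ContinuousLinearMap.compL_apply, ContinuousLinearMap.comp_apply,
      etaL_apply] at h4
    rw [add_comm]
    exact h4
  have h5 : ∀ I J K, eta (dirDeriv (A.rho (e I)) (A.rho (e J)) x) (A.rho (e K) x) =
      eta (L J (X I)) (X K) := by
    intro I J K
    change eta (vec (dirDeriv (A.rho (e I)) (A.rho (e J)) x)) (X K) = _
    rw [vec_dirDeriv]
  have h6 := A.eta_anchorDefect (e 0) (e 1) x (X 2)
  have h7 : eta (vec (A.anchorDefect (e 0) (e 1) x)) (X 2) = 0 := by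
    rw [h0]
    change eta (0 : DoubledSpace d) _ = 0
    rw [← etaL_apply]
    simp
  rw [h5, h5, h5, h.pair_eq_eta hF]
  rw [h7] at h6
  have h8 := h1 2 0 (X 1)
  have h11 := eta_comm (X 1) (L 0 (X 2))
  have h12 := eta_comm (X 2) (L 0 (X 1))
  have h13 := h1 0 1 (X 2)
  simp only [hX, hL] at *
  linarith

end BracketBundle

/-! ## A cyclic identity for the derivative of the defect of the anchor -/

section Local

variable {d : ℕ} {U : Set (DoubledSpace d)}

theorem ContDiffOn.differentiableAt_fderiv {X : DoubledSpace d → DoubledSpace d}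
    (hX : ContDiffOn ℝ ∞ X U) (hU : IsOpen U) {c : DoubledSpace d} (hc : c ∈ U) :
    DifferentiableAt ℝ (fderiv ℝ X) c :=
  (hX.fderiv_of_isOpen (m := ∞) hU (by simp)).differentiableAt_of_isOpen hU hc

theorem fderiv_eta_fderiv {X Y : DoubledSpace d → DoubledSpace d}
    (hX : ContDiffOn ℝ ∞ X U) (hY : ContDiffOn ℝ ∞ Y U) (hU : IsOpen U) {c : DoubledSpace d}
    (hc : c ∈ U) (u : DoubledSpace d) :
    ∃ T : DoubledSpace d →L[ℝ] ℝ, HasFDerivAt (fun y => eta (X y) (fderiv ℝ Y y u)) T c ∧ ∀ v,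
      T v = eta (fderiv ℝ X c v) (fderiv ℝ Y c u) +
        eta (X c) (fderiv ℝ (fderiv ℝ Y) c v u) := by
  have h1 := (hX.differentiableAt_of_isOpen hU hc).hasFDerivAt
  have h2 := (hY.differentiableAt_fderiv hU hc).hasFDerivAt.clm_apply (hasFDerivAt_const u c)
  simp only [← etaL_apply]
  refine ⟨_, (etaL d).hasFDerivAt_of_bilinear h1 h2, fun v => ?_⟩
  simp only [_root_.add_apply, ContinuousLinearMap.precompR_apply,
    ContinuousLinearMap.precompL_apply, ContinuousLinearMap.compL_apply,
    ContinuousLinearMap.comp_apply, ContinuousLinearMap.comp_zero, zero_add,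
    ContinuousLinearMap.flip_apply]
  rw [add_comm]

/-- Derivative of a field `S` with `η(S,u) = ½ η(X,∂_u Y) - ½ η(Y,∂_u X)`. -/
theorem eta_fderiv_of_eta_eq {X Y S : DoubledSpace d → DoubledSpace d}
    (hX : ContDiffOn ℝ ∞ X U) (hY : ContDiffOn ℝ ∞ Y U) (hS : ContDiffOn ℝ ∞ S U) (hU : IsOpen U)
    (h : ∀ y ∈ U, ∀ u, eta (S y) u = 1 / 2 * eta (X y) (fderiv ℝ Y y u) -
      1 / 2 * eta (Y y) (fderiv ℝ X y u)) {c : DoubledSpace d} (hc : c ∈ U)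
    (v u : DoubledSpace d) :
    eta (fderiv ℝ S c v) u =
      1 / 2 * (eta (fderiv ℝ X c v) (fderiv ℝ Y c u) +
        eta (X c) (fderiv ℝ (fderiv ℝ Y) c v u)) -
      1 / 2 * (eta (fderiv ℝ Y c v) (fderiv ℝ X c u) +
        eta (Y c) (fderiv ℝ (fderiv ℝ X) c v u)) := by
  obtain ⟨T, hT, hTv⟩ := fderiv_eta_fderiv hX hY hU hc u
  obtain ⟨T', hT', hTv'⟩ := fderiv_eta_fderiv hY hX hU hc u
  have h1 : HasFDerivAt (fun y => eta (S y) u) ((1 / 2 : ℝ) • T - (1 / 2 : ℝ) • T') c := by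
    refine ((hT.const_smul (1 / 2 : ℝ)).sub (hT'.const_smul (1 / 2 : ℝ))).congr_of_eventuallyEq ?_
    filter_upwards [hU.mem_nhds hc] with y hy
    exact h y hy u
  have h2 : HasFDerivAt (fun y => eta (S y) u) (((etaL d).flip u).comp (fderiv ℝ S c)) c := by
    simp only [← etaL_apply]
    exact ((etaL d).flip u).hasFDerivAt.comp c (hS.differentiableAt_of_isOpen hU hc).hasFDerivAt
  have h3 := congrArg (fun T => T v) (h2.unique h1)
  simp only [ContinuousLinearMap.comp_apply, ContinuousLinearMap.flip_apply, etaL_apply,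
    _root_.sub_apply, _root_.smul_apply, smul_eq_mul, hTv, hTv'] at h3
  exact h3

/-- Derivative of `Y = [X₁,X₂] - S`. -/
theorem fderiv_of_eq_bracket {X₁ X₂ S Y : DoubledSpace d → DoubledSpace d}
    (h₁ : ContDiffOn ℝ ∞ X₁ U) (h₂ : ContDiffOn ℝ ∞ X₂ U) (hS : ContDiffOn ℝ ∞ S U)
    (hU : IsOpen U)
    (h : ∀ y ∈ U, Y y = fderiv ℝ X₂ y (X₁ y) - fderiv ℝ X₁ y (X₂ y) - S y) {c : DoubledSpace d}
    (hc : c ∈ U) (w : DoubledSpace d) :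
    fderiv ℝ Y c w = fderiv ℝ X₂ c (fderiv ℝ X₁ c w) + fderiv ℝ (fderiv ℝ X₂) c w (X₁ c) -
      (fderiv ℝ X₁ c (fderiv ℝ X₂ c w) + fderiv ℝ (fderiv ℝ X₁) c w (X₂ c)) - fderiv ℝ S c w := by
  have d₁ := (h₁.differentiableAt_of_isOpen hU hc).hasFDerivAt
  have d₂ := (h₂.differentiableAt_of_isOpen hU hc).hasFDerivAt
  have e₁ := (h₁.differentiableAt_fderiv hU hc).hasFDerivAt
  have e₂ := (h₂.differentiableAt_fderiv hU hc).hasFDerivAt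
  have h1 := ((e₂.clm_apply d₁).sub (e₁.clm_apply d₂)).sub
    (hS.differentiableAt_of_isOpen hU hc).hasFDerivAt
  have h2 := h1.congr_of_eventuallyEq (f₁ := Y)
    (by filter_upwards [hU.mem_nhds hc] with y hy using h y hy)
  rw [h2.fderiv]
  rfl

theorem fderiv_fderiv_symm {X : DoubledSpace d → DoubledSpace d} (hX : ContDiffOn ℝ ∞ X U)
    (hU : IsOpen U) {c : DoubledSpace d} (hc : c ∈ U) (u v : DoubledSpace d) :
    fderiv ℝ (fderiv ℝ X) c u v = fderiv ℝ (fderiv ℝ X) c v u := by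
  have h : IsSymmSndFDerivAt ℝ X c :=
    (hX.contDiffAt (hU.mem_nhds hc)).isSymmSndFDerivAt
      (by rw [minSmoothness_of_isRCLikeNormedField]; exact WithTop.coe_le_coe.2 le_top)
  exact h u v

theorem eta_add_left (u v w : DoubledSpace d) : eta (u + v) w = eta u w + eta v w := by
  rw [← etaL_apply, map_add, _root_.add_apply, etaL_apply, etaL_apply]

theorem eta_sub_left (u v w : DoubledSpace d) : eta (u - v) w = eta u w - eta v w := by
  rw [← etaL_apply, map_sub, _root_.sub_apply, etaL_apply, etaL_apply]

theorem eta_neg_left (u w : DoubledSpace d) : eta (-u) w = -eta u w := by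
  rw [← etaL_apply, map_neg, _root_.neg_apply, etaL_apply]

theorem eta_smul_left (c : ℝ) (u w : DoubledSpace d) : eta (c • u) w = c * eta u w := by
  rw [← etaL_apply, map_smul, _root_.smul_apply, etaL_apply, smul_eq_mul]

theorem eta_add_right (u v w : DoubledSpace d) : eta w (u + v) = eta w u + eta w v := by
  rw [eta_comm, eta_add_left, eta_comm u, eta_comm v]

theorem eta_sub_right (u v w : DoubledSpace d) : eta w (u - v) = eta w u - eta w v := by
  rw [eta_comm, eta_sub_left, eta_comm u, eta_comm v]

/-- For `Y_{ij} = [X_i,X_j] - S_{ij}` the derivative of `⅙ ∑ η(Y_{ij},X_k)`. -/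
theorem cyclic_identity {X S Y : Fin 3 → DoubledSpace d → DoubledSpace d}
    (hX : ∀ i, ContDiffOn ℝ ∞ (X i) U) (hS : ∀ i, ContDiffOn ℝ ∞ (S i) U) (hU : IsOpen U)
    (hSX : ∀ i, ∀ y ∈ U, ∀ u, eta (S i y) u =
      1 / 2 * eta (X i y) (fderiv ℝ (X (i + 1)) y u) -
      1 / 2 * eta (X (i + 1) y) (fderiv ℝ (X i) y u))
    (hYX : ∀ i, ∀ y ∈ U, Y i y = fderiv ℝ (X (i + 1)) y (X i y) - fderiv ℝ (X i) y (X (i + 1) y) -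
      S i y) {c : DoubledSpace d} (hc : c ∈ U) (w : DoubledSpace d) :
    ∑ i, (eta (fderiv ℝ (S i) c (X (i + 2) c)) w -
      (1 / 2 * eta (Y i c) (fderiv ℝ (X (i + 2)) c w) -
        1 / 2 * eta (X (i + 2) c) (fderiv ℝ (Y i) c w))) =
      1 / 6 * ∑ i, (eta (fderiv ℝ (Y i) c w) (X (i + 2) c) +
        eta (Y i c) (fderiv ℝ (X (i + 2)) c w)) := by
  -- Indices are cyclic: `S i` and `Y i` belong to the pair `i`, `i + 1`, with third index `i + 2`.
  have hdS : ∀ i v u, _ := fun i v u =>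
    eta_fderiv_of_eta_eq (hX i) (hX (i + 1)) (hS i) hU (hSX i) hc v u
  have hdY : ∀ i w, _ := fun i w =>
    fderiv_of_eq_bracket (hX i) (hX (i + 1)) (hS i) hU (hYX i) hc w
  have hsym : ∀ i u v, _ := fun i u v => fderiv_fderiv_symm (hX i) hU hc u v
  simp only [hdY, hYX _ c hc, eta_add_left, eta_sub_left, eta_sub_right, eta_add_right, hdS,
    hSX _ c hc, eta_comm (X _ c) (fderiv ℝ (S _) c w)]
  -- Symmetry of second derivatives and of `η` brings all terms to a common form, after which the
  -- cyclic sum cancels.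
  simp only [hsym _ (X _ c) w, eta_comm (fderiv ℝ (X _) c _) (X _ c),
    eta_comm (fderiv ℝ (fderiv ℝ (X _)) c _ _) (X _ c),
    eta_comm (fderiv ℝ (X _) c w) (fderiv ℝ (X _) c (X _ c))]
  simp only [Fin.sum_univ_three]
  have e1 : (0 : Fin 3) + 1 = 1 := rfl
  have e2 : (1 : Fin 3) + 1 = 2 := rfl
  have e3 : (2 : Fin 3) + 1 = 0 := rfl
  have e4 : (0 : Fin 3) + 2 = 2 := rfl
  have e5 : (1 : Fin 3) + 2 = 0 := rfl
  have e6 : (2 : Fin 3) + 2 = 1 := rfl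
  simp only [e1, e2, e3, e4, e5, e6]
  ring

end Local

/-! ## The Jacobiator -/

namespace BracketBundle

variable {d : ℕ} {M : Type*} [TopologicalSpace M] [ChartedSpace (DoubledSpace d) M]
  [IsManifold 𝓘(ℝ, DoubledSpace d) ∞ M]
  {F : Type*} [NormedAddCommGroup F] [NormedSpace ℝ F]
  {V : M → Type*} [TopologicalSpace (TotalSpace F V)]
  [∀ x, AddCommGroup (V x)] [∀ x, Module ℝ (V x)] [∀ x, TopologicalSpace (V x)]
  [∀ x, IsTopologicalAddGroup (V x)] [∀ x, ContinuousSMul ℝ (V x)]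
  [FiberBundle F V] [VectorBundle ℝ F V]
  [ContMDiffVectorBundle ∞ F V 𝓘(ℝ, DoubledSpace d)]
  (A : BracketBundle d M F V)
  [FiniteDimensional ℝ F] [IsDoubledManifold d M]

/-- The Lie bracket cancels the directional derivatives contained in the two contractions, leaving
only the terms that make up `SC_ρ`. -/
theorem vec_SCJacVector (a b : Sections d F V) (x : M) :
    vec (A.SCJacVector a b x) = -((2 : ℝ) • vec (A.SCL a b x)) := by
  have h1 : vec (A.SCJacVector a b x) =
      -(vec (contractDeriv (A.rho a) (A.rho b) x) + vec (dirDeriv (A.rho a) (A.rho b) x)) +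
      (vec (contractDeriv (A.rho b) (A.rho a) x) + vec (dirDeriv (A.rho b) (A.rho a) x)) +
      vec (VectorField.mlieBracket 𝓘(ℝ, DoubledSpace d) (A.rho a) (A.rho b) x) := rfl
  have h2 : vec (A.SCL a b x) = (1 / 2 : ℝ) • vec (contractDeriv (A.rho a) (A.rho b) x) -
      (1 / 2 : ℝ) • vec (contractDeriv (A.rho b) (A.rho a) x) := rfl
  rw [h1, h2, mlieBracket_eq, vec_sub]
  module

theorem form_rhoInv (h : RawVectorField d M) (x : M) (w : V x) :
    A.form x (A.rhoInv h x) w = eta (vec (h x)) (vec (A.anchor x w)) := by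
  rw [rhoInv]
  exact Exists.choose_spec (p := fun v => ∀ w, A.form x v w = eta (h x) (A.anchor x w)) _ w

variable {A}

/-- Since the form is `η` pulled back by the surjective anchor, the metric adjoint `rhoInv` is a
right inverse of the anchor. -/
theorem SatisfiesAxioms.anchor_rhoInv [T2Space M] (hA : A.SatisfiesAxioms)
    (hF : Module.finrank ℝ F = 2 * d) (h : RawVectorField d M) (x : M) :
    A.anchor x (A.rhoInv h x) = h x := by
  apply vec_injective
  apply eta_ext
  intro w
  obtain ⟨v, hv⟩ := hA.anchor_surjective x w
  have h1 := A.form_rhoInv h x v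
  rw [hA.form_eq_eta hF, hv] at h1
  exact h1

theorem SatisfiesAxioms.vec_anchor_SCJac [T2Space M] (hA : A.SatisfiesAxioms)
    (hF : Module.finrank ℝ F = 2 * d) (a b c : Sections d F V) (x : M) :
    vec (A.anchor x (A.SCJac a b c x)) =
      -(fderiv ℝ (rep x (A.rho c)) (coord d x) (vec (A.SCL a b x)) +
        fderiv ℝ (rep x (A.rho a)) (coord d x) (vec (A.SCL b c x)) +
        fderiv ℝ (rep x (A.rho b)) (coord d x) (vec (A.SCL c a x))) := by
  have h1 : ∀ a b c : Sections d F V, vec (dirDeriv (A.SCJacVector a b) (A.rho c) x) =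
      -((2 : ℝ) • fderiv ℝ (rep x (A.rho c)) (coord d x) (vec (A.SCL a b x))) := by
    intro a b c
    rw [← map_smul, ← map_neg, ← vec_SCJacVector]
    change iteratedFDeriv ℝ 1 (rep x (A.rho c)) (coord d x) ![vec (A.SCJacVector a b x)] = _
    rw [iteratedFDeriv_one_apply]
    rfl
  have h2 : vec (A.anchor x (A.SCJac a b c x)) =
      (1 / 2 : ℝ) • vec (dirDeriv (A.SCJacVector a b) (A.rho c) x) +
      (1 / 2 : ℝ) • vec (dirDeriv (A.SCJacVector b c) (A.rho a) x) +
      (1 / 2 : ℝ) • vec (dirDeriv (A.SCJacVector c a) (A.rho b) x) := by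
    rw [SCJac, map_add, map_add, map_smul, map_smul, map_smul, hA.anchor_rhoInv hF,
      hA.anchor_rhoInv hF, hA.anchor_rhoInv hF]
    rfl
  rw [h2, h1, h1, h1]
  module

theorem SatisfiesAxioms.isCompatible [T2Space M] (hA : A.SatisfiesAxioms)
    (hd : ∀ a b, A.anchorDefect a b = 0) : A.calculus.IsCompatible where
  rho_D f := hA.rho_D f
  rho_br a b := by
    have h := hd a b
    rw [anchorDefect, add_eq_zero_iff_eq_neg, sub_eq_iff_eq_add] at h
    refine h.trans ?_
    rw [neg_add_eq_sub]
    rfl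
  compat a b c := ContMDiffMap.ext fun x => by
    refine (hA.axiom_compat a b c x).trans ?_
    change _ = (2 : ℝ) * A.pair (A.D (A.pair a b)) c x
    rw [A.pair_D]
    ring

/-- The relation `ρ[[a,b]] = [ρ(a),ρ(b)] - SC_ρ(a,b)` in coordinates. -/
theorem rep_rho_bracket {a b : Sections d F V} (h : A.anchorDefect a b = 0) (x : M)
    {y : DoubledSpace d} (hy : y ∈ coordDomain d x) :
    rep x (A.rho (A.bracket a b)) y =
      fderiv ℝ (rep x (A.rho b)) y (rep x (A.rho a) y) -
        fderiv ℝ (rep x (A.rho a)) y (rep x (A.rho b) y) - rep x (A.SCL a b) y := by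
  have h1 : A.rho (A.bracket a b) =
      iterDeriv [A.rho a] (A.rho b) - iterDeriv [A.rho b] (A.rho a) - A.SCL a b := by
    rw [anchorDefect, add_eq_zero_iff_eq_neg, sub_eq_iff_eq_add, neg_add_eq_sub] at h
    exact h
  have h2 : ∀ u v : VectorFields d M, rep x (u - v : VectorFields d M) y =
      rep x u y - rep x v y := fun u v => rep_sub x u v hy
  rw [h1, h2, h2, rep_iterDeriv x _ _ hy, rep_iterDeriv x _ _ hy]
  rfl

theorem eta_rep_SCL (a b : Sections d F V) (x : M) {y : DoubledSpace d}
    (hy : y ∈ coordDomain d x) (u : DoubledSpace d) :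
    eta (rep x (A.SCL a b) y) u =
      1 / 2 * eta (rep x (A.rho a) y) (fderiv ℝ (rep x (A.rho b)) y u) -
      1 / 2 * eta (rep x (A.rho b) y) (fderiv ℝ (rep x (A.rho a)) y u) := by
  have h1 : A.SCL a b = (1 / 2 : ℝ) • contractField (A.rho a) (A.rho b) -
    (1 / 2 : ℝ) • contractField (A.rho b) (A.rho a) := rfl
  have h2 : ∀ u v : VectorFields d M, rep x (u - v : VectorFields d M) y =
      rep x u y - rep x v y := fun u v => rep_sub x u v hy
  rw [h1, h2, eventuallyEq_rep_smul x _ _ y hy, eventuallyEq_rep_smul x _ _ y hy,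
    coe_contractField, coe_contractField, rep_contractDeriv x _ _ hy, rep_contractDeriv x _ _ hy,
    eta_sub_left, eta_smul_left, eta_smul_left, eta_sharp, eta_sharp,
    ContinuousLinearMap.comp_apply, ContinuousLinearMap.comp_apply, etaL_apply, etaL_apply]

theorem SatisfiesAxioms.fderiv_calN [T2Space M] (hA : A.SatisfiesAxioms)
    (hF : Module.finrank ℝ F = 2 * d) (a b c : Sections d F V) (x : M) (w : DoubledSpace d) :
    fderiv ℝ (frep x (A.calN a b c)) (coord d x) w = 1 / 3 *
      ((eta (fderiv ℝ (rep x (A.rho (A.bracket a b))) (coord d x) w) (vec (A.rho c x)) +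
        eta (vec (A.rho (A.bracket a b) x)) (fderiv ℝ (rep x (A.rho c)) (coord d x) w)) +
      (eta (fderiv ℝ (rep x (A.rho (A.bracket b c))) (coord d x) w) (vec (A.rho a x)) +
        eta (vec (A.rho (A.bracket b c) x)) (fderiv ℝ (rep x (A.rho a)) (coord d x) w)) +
      (eta (fderiv ℝ (rep x (A.rho (A.bracket c a))) (coord d x) w) (vec (A.rho b x)) +
        eta (vec (A.rho (A.bracket c a) x)) (fderiv ℝ (rep x (A.rho b)) (coord d x) w))) := by
  have h1 : ∀ a b : Sections d F V, fderiv ℝ (frep x (A.pair a b)) (coord d x) w =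
      eta (fderiv ℝ (rep x (A.rho a)) (coord d x) w) (vec (A.rho b x)) +
        eta (vec (A.rho a x)) (fderiv ℝ (rep x (A.rho b)) (coord d x) w) := by
    intro a b
    have h2 : ∀ᶠ y in 𝓝 (coord d x), frep x (A.pair a b) y =
        etaL d (rep x (A.rho a) y) (rep x (A.rho b) y) := by
      filter_upwards [(isOpen_coordDomain x).mem_nhds (coord_mem x)] with y hy
      rw [etaL_apply, hA.frep_pair hF _ _ x hy]
    have h3 : HasFDerivAt (fun y => etaL d (rep x (A.rho a) y) (rep x (A.rho b) y)) _
        (coord d x) := (etaL d).hasFDerivAt_of_bilinear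
      (differentiableAt_rep x (A.rho a)).hasFDerivAt (differentiableAt_rep x (A.rho b)).hasFDerivAt
    rw [Filter.EventuallyEq.fderiv_eq h2, h3.fderiv]
    simp only [_root_.add_apply, ContinuousLinearMap.precompR_apply,
      ContinuousLinearMap.precompL_apply, rep_coord, ContinuousLinearMap.compL_apply,
      ContinuousLinearMap.comp_apply, etaL_apply]
    rw [add_comm]
  rw [calN, fderiv_frep_smul, fderiv_frep_add, fderiv_frep_add, _root_.smul_apply,
    _root_.add_apply, _root_.add_apply, h1, h1, h1, smul_eq_mul]

/-- The anchor is injective, so it suffices to compare images. The relation for `μ_0` and three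
sections gives `ρ(DN - Jac)`. In it the derivatives of the anchors along `SC_ρ` form `-ρ(SC_Jac)`,
and the gradient of `N`, the terms `SC_ρ([[·,·]],·)` and the derivatives of `SC_ρ` cancel by
`cyclic_identity`. -/
theorem SatisfiesAxioms.jacobiator [T2Space M] (hA : A.SatisfiesAxioms)
    (hF : Module.finrank ℝ F = 2 * d) (hd : ∀ a b, A.anchorDefect a b = 0)
    (a b c : Sections d F V) (x : M) :
    (A.Jac a b c - A.D (A.calN a b c)) x = A.SCJac a b c x := by
  apply (hA.anchor_bijective hF x).1
  apply vec_injective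
  rw [hA.vec_anchor_SCJac hF]
  have h0 := (A.calculus.jacList_zeee [] a b c).symm.trans
    ((hA.isCompatible hd).jacList_eq_zero _)
  have h1 : A.calculus.pd [] _ = 0 := congrArg (fun l => l.2.2.1) h0
  rw [A.calculus.pd_nil] at h1
  have h1' : A.rho (A.DNsubJac a b c) - halfEtaGrad (A.calN a b c) -
      (A.SCL (A.bracket a b) c + A.SCL (A.bracket b c) a + A.SCL (A.bracket c a) b) -
      (A.calculus.lie (A.SCL a b) (A.rho c) + A.calculus.lie (A.SCL b c) (A.rho a) +
        A.calculus.lie (A.SCL c a) (A.rho b)) = 0 := h1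
  have h2 : vec (A.anchor x ((A.Jac a b c - A.D (A.calN a b c)) x)) =
      -vec (A.rho (A.DNsubJac a b c) x) := by
    rw [← vec_neg, rho_apply, ← map_neg]
    congr 2
    change _ = -((A.D (A.calN a b c)) x - (A.Jac a b c) x)
    rw [neg_sub]
    rfl
  have h3 : vec (A.rho (A.DNsubJac a b c) x) =
      vec (halfEtaGrad (A.calN a b c) x) +
      (vec (A.SCL (A.bracket a b) c x) + vec (A.SCL (A.bracket b c) a x) +
        vec (A.SCL (A.bracket c a) b x)) +
      ((fderiv ℝ (rep x (A.rho c)) (coord d x) (vec (A.SCL a b x)) -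
          fderiv ℝ (rep x (A.SCL a b)) (coord d x) (vec (A.rho c x))) +
        (fderiv ℝ (rep x (A.rho a)) (coord d x) (vec (A.SCL b c x)) -
          fderiv ℝ (rep x (A.SCL b c)) (coord d x) (vec (A.rho a x))) +
        (fderiv ℝ (rep x (A.rho b)) (coord d x) (vec (A.SCL c a x)) -
          fderiv ℝ (rep x (A.SCL c a)) (coord d x) (vec (A.rho b x)))) := by
    rw [sub_eq_zero, sub_eq_iff_eq_add, sub_eq_iff_eq_add] at h1'
    rw [h1']
    have hl : ∀ u v : VectorFields d M, vec (A.calculus.lie u v x) =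
      fderiv ℝ (rep x v) (coord d x) (vec (u x)) -
        fderiv ℝ (rep x u) (coord d x) (vec (v x)) := fun _ _ => rfl
    simp only [vec_coe_add, hl]
    abel
  rw [h2, h3]
  apply eta_ext
  intro w
  have h5 := cyclic_identity (U := coordDomain d x)
    (X := ![rep x (A.rho a), rep x (A.rho b), rep x (A.rho c)])
    (S := ![rep x (A.SCL a b), rep x (A.SCL b c), rep x (A.SCL c a)])
    (Y := ![rep x (A.rho (A.bracket a b)), rep x (A.rho (A.bracket b c)),
      rep x (A.rho (A.bracket c a))])
    (fun i => by fin_cases i <;> exact contDiffOn_rep x _)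
    (fun i => by fin_cases i <;> exact contDiffOn_rep x _) (isOpen_coordDomain x)
    (fun i y hy u => by fin_cases i <;> exact eta_rep_SCL _ _ x hy u)
    (fun i y hy => by fin_cases i <;> exact rep_rho_bracket (hd _ _) x hy) (coord_mem x) w
  -- This ½ and the ⅓ in `N` give the factor 1/6 of `cyclic_identity`.
  have h6 : eta (vec (halfEtaGrad (A.calN a b c) x)) w =
      1 / 2 * fderiv ℝ (frep x (A.calN a b c)) (coord d x) w := by
    rw [coe_halfEtaGrad, vec_smul, vec_etaGrad, eta_smul_left, eta_sharp]
  simp only [Fin.sum_univ_three] at h5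
  have e1 : (0 : Fin 3) + 2 = 2 := rfl
  have e2 : (1 : Fin 3) + 2 = 0 := rfl
  have e3 : (2 : Fin 3) + 2 = 1 := rfl
  simp only [e1, e2, e3, Matrix.cons_val_zero, Matrix.cons_val_one, Matrix.cons_val, rep_coord]
    at h5
  simp only [eta_neg_left, eta_add_left, eta_sub_left, h6, hA.fderiv_calN hF, eta_SCL]
  linarith

end BracketBundle

/-! ## The characteristic identities of a DFT algebroid -/

section Flat

variable {d : ℕ} {M : Type*} [TopologicalSpace M] [ChartedSpace (DoubledSpace d) M]
  [IsManifold 𝓘(ℝ, DoubledSpace d) ∞ M] [IsDoubledManifold d M]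

/-- The iterated derivative along tangent vectors, as a linear map of the differentiated field. -/
def flatDerivL (k : ℕ) (x : M) (w : Fin k → TangentSpace 𝓘(ℝ, DoubledSpace d) x) :
    VectorFields d M →ₗ[ℝ] TangentSpace 𝓘(ℝ, DoubledSpace d) x where
  toFun v := flatDeriv k v x w
  map_add' u v := vec_injective x <| by
    rw [flatDeriv_eq_ider, ider_congr (isOpen_coordDomain x) (eventuallyEq_rep_add x u v) _ _
      (coord_mem x), ider_add (isOpen_coordDomain x) (contDiffOn_rep x u) (contDiffOn_rep x v) _ _
      (coord_mem x), vec_add, flatDeriv_eq_ider, flatDeriv_eq_ider]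
  map_smul' c v := vec_injective x <| by
    rw [flatDeriv_eq_ider, ider_congr (isOpen_coordDomain x) (eventuallyEq_rep_smul x c v) _ _
      (coord_mem x), ider_const_smul (isOpen_coordDomain x) (contDiffOn_rep x v) _ _ _
      (coord_mem x), RingHom.id_apply, vec_smul, flatDeriv_eq_ider]

end Flat

namespace BracketBundle

variable {d : ℕ} {M : Type*} [TopologicalSpace M] [T2Space M] [ChartedSpace (DoubledSpace d) M]
  [IsManifold 𝓘(ℝ, DoubledSpace d) ∞ M]
  {F : Type*} [NormedAddCommGroup F] [NormedSpace ℝ F]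
  {V : M → Type*} [TopologicalSpace (TotalSpace F V)]
  [∀ x, AddCommGroup (V x)] [∀ x, Module ℝ (V x)] [∀ x, TopologicalSpace (V x)]
  [∀ x, IsTopologicalAddGroup (V x)] [∀ x, ContinuousSMul ℝ (V x)]
  [FiberBundle F V] [VectorBundle ℝ F V]
  [ContMDiffVectorBundle ∞ F V 𝓘(ℝ, DoubledSpace d)]
  {A : BracketBundle d M F V}
  [FiniteDimensional ℝ F] [IsDoubledManifold d M]

theorem SatisfiesAxioms.satisfiesIdentities (hA : A.SatisfiesAxioms)
    (hF : Module.finrank ℝ F = 2 * d) (hd : ∀ a b, A.anchorDefect a b = 0) :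
    A.SatisfiesIdentities := by
  have hbr : ∀ a b, A.rho (A.bracket a b) - A.calculus.lie (A.rho a) (A.rho b) = -A.SCL a b :=
    fun a b => eq_neg_of_add_eq_zero_left (hd a b)
  have hlie : ∀ u v : VectorFields d M,
      lie (u : RawVectorField d M) v = A.calculus.lie u v :=
    fun u v => funext fun x => (A.coe_lie u v x).symm
  have hSC : ∀ a b, A.SCrho a b = A.SCL a b := fun _ _ => rfl
  refine ⟨fun f x => ?_, fun a b x => ?_, hA.jacobiator hF hd, fun k f x w => ?_,
    fun k a b x w => ?_, fun k a b c x w => ?_⟩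
  · rw [hA.rho_D, coe_halfEtaGrad]
  · rw [hlie, hSC]
    exact DFunLike.congr_fun (hbr a b) x
  · rw [hA.rho_D]
    exact (flatDerivL k x w).map_smul (1 / 2 : ℝ) (etaGradField f)
  · rw [hlie, hSC]
    refine ((flatDerivL k x w).map_sub _ _).symm.trans ?_
    rw [hbr, map_neg]
    rfl
  · have h1 : (fun y => A.anchor y (A.SCJac a b c y)) =
        (A.rho (A.Jac a b c) - A.rho (A.D (A.calN a b c)) : VectorFields d M) := by
      funext y
      rw [← hA.jacobiator hF hd]
      exact map_sub (A.anchor y) _ _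
    rw [h1]
    exact ((flatDerivL k x w).map_sub _ _).symm

theorem SatisfiesAxioms.isCurvedLInfinityAlgebra (hA : A.SatisfiesAxioms)
    (hd : ∀ a b, A.anchorDefect a b = 0) :
    IsCurvedLInfinityAlgebra (extGrading d M F V) A.calculus.mu where
  toIsLInfinityAlgebra := (hA.isCompatible hd).isLInfinityAlgebra
  curved h := by
    rw [A.hasExtendedBrackets_mu.mu_curvature] at h
    exact one_ne_zero (congrArg (fun l => l.2.2.2) h)

/-- The homotopy relation for two sections is the vanishing of the defect itself. -/
theorem anchorDefect_eq_zero_of_isLInfinityAlgebra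
    (h : IsLInfinityAlgebra (extGrading d M F V) A.calculus.mu) (a b : Sections d F V) :
    A.anchorDefect a b = 0 := by
  have h1 := A.calculus.homotopyJacobi_args ![.e a, .e b]
  rw [h.jacobi _ _ _ fun i => Arg.val_mem _] at h1
  have h2 := h1.trans (A.calculus.jacList_ee [] a b)
  have h3 : A.calculus.pd [] _ = 0 := congrArg (fun l => l.2.2.1) h2.symm
  rw [A.calculus.pd_nil] at h3
  exact h3

end BracketBundle

end

theorem mainTheorem2 (d : ℕ) (M : Type*) [TopologicalSpace M] [T2Space M] [SigmaCompactSpace M]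
    [ChartedSpace (DoubledSpace d) M] [IsManifold 𝓘(ℝ, DoubledSpace d) ∞ M]
    [IsDoubledManifold d M]
    (F : Type*) [NormedAddCommGroup F] [NormedSpace ℝ F] [FiniteDimensional ℝ F]
    (hF : Module.finrank ℝ F = 2 * d)
    (V : M → Type*) [TopologicalSpace (TotalSpace F V)]
    [∀ x, AddCommGroup (V x)] [∀ x, Module ℝ (V x)] [∀ x, TopologicalSpace (V x)]
    [∀ x, IsTopologicalAddGroup (V x)] [∀ x, ContinuousSMul ℝ (V x)]
    [FiberBundle F V] [VectorBundle ℝ F V]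
    [ContMDiffVectorBundle ∞ F V 𝓘(ℝ, DoubledSpace d)]
    (A : BracketBundle d M F V) :
    (∃! μ : Brackets (ExtSpace d M F V),
      IsGradedAntisymmetric (extGrading d M F V) μ ∧ A.HasExtendedBrackets μ) ∧
    ∀ μ : Brackets (ExtSpace d M F V),
      IsGradedAntisymmetric (extGrading d M F V) μ → A.HasExtendedBrackets μ →
        (A.IsDFTAlgebroid →
          IsCurvedLInfinityAlgebra (extGrading d M F V) μ ∧ A.SatisfiesIdentities ∧
          ∀ (e₁ e₂ e₃ : Sections d F V) (s : Sections d F V),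
            (∀ x, s x = A.SCJac e₁ e₂ e₃ x) →
              μ 4 ![muZero d M F V, inE e₁, inE e₂, inE e₃] = -inE s) ∧
        A.HomotopyRelationsReproduce μ ∧
        (A.SatisfiesAxioms →
          (A.IsCBracket ↔ IsCurvedLInfinityAlgebra (extGrading d M F V) μ)) := by
  refine ⟨⟨A.calculus.mu, ⟨A.calculus.mu_isGradedAntisymmetric, A.hasExtendedBrackets_mu⟩,
    fun μ hμ => hμ.2.unique A.hasExtendedBrackets_mu hμ.1
      A.calculus.mu_isGradedAntisymmetric⟩, fun μ hg hμ => ?_⟩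
  -- By uniqueness everything can be checked on the constructed brackets.
  obtain rfl : μ = A.calculus.mu :=
    hμ.unique A.hasExtendedBrackets_mu hg A.calculus.mu_isGradedAntisymmetric
  refine ⟨fun hA => ?_, A.homotopyRelationsReproduce, fun hA => ⟨fun hc => ?_, fun h => ?_⟩⟩
  · have hd := hA.toSatisfiesAxioms.anchorDefect_eq_zero hF hA.cBracket
    refine ⟨hA.isCurvedLInfinityAlgebra hd, hA.satisfiesIdentities hF hd,
      fun e₁ e₂ e₃ s hs => ?_⟩
    rw [hμ.mu_0eee, BracketBundle.DNsubJac]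
    have h1 : s = A.Jac e₁ e₂ e₃ - A.D (A.calN e₁ e₂ e₃) :=
      ContMDiffSection.ext fun x =>
        (hs x).trans (hA.toSatisfiesAxioms.jacobiator hF hd e₁ e₂ e₃ x).symm
    rw [h1, ← neg_sub (A.Jac e₁ e₂ e₃)]
    simp [inE]
  · exact hA.isCurvedLInfinityAlgebra (hA.anchorDefect_eq_zero hF hc)
  · exact hA.isCBracket hF
      (BracketBundle.anchorDefect_eq_zero_of_isLInfinityAlgebra h.toIsLInfinityAlgebra)
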